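/- Let $\Omega\subset\mathbb R^d$, $d\in\{1,2,3\}$, be a bounded convex polygonal (polyhedral) domain, i.e. the nonempty interior of the convex hull of finitely many points, and let $A=-\Delta$ be the Dirichlet Laplacian in $L^2(\Omega)$ (complex-valued functions), with domain $D(A)=\{u\in H^1_0(\Omega):\Delta u\in L^2(\Omega)\}$ (which equals $H^1_0(\Omega)\cap H^2(\Omega)$ since $\Omega$ is convex). Let $\mu\in C[0,1]$ be nonnegative with $\mu(0)\mu(1)>0$, and consider the distributed-order problem $$\int_0^1\partial_t^\alpha u(t)\,\mu(\alpha)\,d\alpha+Au(t)=0\quad(t>0),\qquad u(0)=v,\qquad \partial_t^\alpha u(t)=\frac1{\Gamma(1-\alpha)}\int_0^t(t-s)^{-\alpha}u'(s)\,ds .$$ For $\theta\in(\pi/2,\pi)$ and $\delta>0$ let $\Gamma_{\theta,\delta}=\{|z|=\delta,\ |\arg z|\le\theta\}\cup\{z=\rho e^{\pm i\theta}:\rho\ge\delta\}$, oriented with increasing imaginary part, and define the solution operator, for $t>0$, by $$S(t)=\frac1{2\pi i}\int_{\Gamma_{\theta,\delta}}e^{zt}H(z)\,dz,\qquad H(z)=w(z)\,(zw(z)I+A)^{-1},\qquad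 w(z)=\int_0^1z^{\alpha-1}\mu(\alpha)\,d\alpha .$$ Write $\|\cdot\|$ for the norm of $L^2(\Omega)$ and $S^{(m)}$ for the $m$-th derivative of $S$. Then the following holds. (a) For all $\theta\in(\pi/2,\pi)$ and $\delta>0$, $S$ is infinitely differentiable on $(0,\infty)$ in the operator norm of $L^2(\Omega)$; $S(t)v\to v$ in $L^2(\Omega)$ as $t\to0^+$ for every $v\in L^2(\Omega)$; and for every $v\in D(A)$ the function $u(t)=S(t)v$ solves the above problem for all $t>0$, with absolutely convergent integrals. (b) For every integer $m\ge0$ and every $T>0$ there is a constant $c_T>0$, independent of $t$, $v$, $\theta$, $\delta$, such that for all $t\in(0,T]$, $v\in L^2(\Omega)$ and $\nu\in\{0,1\}$ we have $S^{(m)}(t)v\in D(A)$ and $$\|A^\nu S^{(m)}(t)v\|\le c_T\,t^{-m-\nu}\Big(\log\frac{2T}{t}\Big)^{-\nu}\|v\| .$$ (c) For every integer $m\ge0$ there is a constant $c>0$, independent of $T$, $t$, $v$, $\theta$, $\delta$, such that for all $T>0$, $t\in(0,T]$, $v\in D(A)$ and $\nu\in\{0,1\}$ with $\nu+m\ge1$,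 $$\|A^\nu S^{(m)}(t)v\|\le c\,t^{-m+1-\nu}\big(\log\max(t^{-1},2)\big)^{1-\nu}\|Av\| .$$ For $\nu=1$ and every $m\ge 0$, $S^{(m)}(t)v\in D(A)$. -/

import Mathlib

open Real Set Filter Topology MeasureTheory TopologicalSpace
open scoped ContDiff ENNReal Laplacian

noncomputable section

/-- Bounded convex polygonal (polyhedral) domain: the nonempty interior of the convex hull of
finitely many points. -/
def IsConvexPolytopeDomain {d : ℕ} (Ω : Opens (EuclideanSpace ℝ (Fin d))) : Prop :=
  (Ω : Set (EuclideanSpace ℝ (Fin d))).Nonempty ∧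
    ∃ s : Finset (EuclideanSpace ℝ (Fin d)),
      (Ω : Set (EuclideanSpace ℝ (Fin d))) =
        interior (convexHull ℝ (s : Set (EuclideanSpace ℝ (Fin d))))

/-- The complex Hilbert space `L²(Ω)`. -/
abbrev L2 {d : ℕ} (Ω : Opens (EuclideanSpace ℝ (Fin d))) : Type :=
  Lp ℂ 2 ((volume : Measure (EuclideanSpace ℝ (Fin d))).restrict
    (Ω : Set (EuclideanSpace ℝ (Fin d))))

/-- Test functions: `C_c^∞(Ω)`. -/
def IsTestFunction {d : ℕ} (Ω : Opens (EuclideanSpace ℝ (Fin d)))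
    (φ : EuclideanSpace ℝ (Fin d) → ℂ) : Prop :=
  ContDiff ℝ ∞ φ ∧ HasCompactSupport φ ∧ tsupport φ ⊆ (Ω : Set (EuclideanSpace ℝ (Fin d)))

/-- The partial derivative `∂φ/∂xᵢ`. -/
def partialDeriv {d : ℕ} (i : Fin d) (φ : EuclideanSpace ℝ (Fin d) → ℂ)
    (x : EuclideanSpace ℝ (Fin d)) : ℂ :=
  fderiv ℝ φ x (EuclideanSpace.single i 1)

/-- `u ∈ H¹₀(Ω)`, the closure of `C_c^∞(Ω)` in `H¹(Ω)`: some sequence of test functions converges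
to `u` in `L²(Ω)` while each of its first partial derivatives converges in `L²(Ω)`. -/
def MemH10 {d : ℕ} (Ω : Opens (EuclideanSpace ℝ (Fin d))) (u : L2 Ω) : Prop :=
  ∃ (φ : ℕ → EuclideanSpace ℝ (Fin d) → ℂ) (g : Fin d → L2 Ω),
    (∀ n, IsTestFunction Ω (φ n)) ∧
    Tendsto (fun n => eLpNorm (fun x => φ n x - u x) 2
      ((volume : Measure (EuclideanSpace ℝ (Fin d))).restrict
        (Ω : Set (EuclideanSpace ℝ (Fin d))))) atTop (𝓝 0) ∧
    ∀ i, Tendsto (fun n => eLpNorm (fun x => partialDeriv i (φ n) x - g i x) 2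
      ((volume : Measure (EuclideanSpace ℝ (Fin d))).restrict
        (Ω : Set (EuclideanSpace ℝ (Fin d))))) atTop (𝓝 0)

/-- `-Δu = f` in the sense of distributions on `Ω`. -/
def IsWeakNegLaplacian {d : ℕ} (Ω : Opens (EuclideanSpace ℝ (Fin d))) (u f : L2 Ω) : Prop :=
  ∀ φ : EuclideanSpace ℝ (Fin d) → ℂ, IsTestFunction Ω φ →
    -∫ x in (Ω : Set (EuclideanSpace ℝ (Fin d))), u x * (Δ φ) x =
      ∫ x in (Ω : Set (EuclideanSpace ℝ (Fin d))), f x * φ x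

variable {d : ℕ} {Ω : Opens (EuclideanSpace ℝ (Fin d))}

theorem IsTestFunction.add {φ ψ : EuclideanSpace ℝ (Fin d) → ℂ}
    (hφ : IsTestFunction Ω φ) (hψ : IsTestFunction Ω ψ) :
    IsTestFunction Ω (fun x => φ x + ψ x) :=
  ⟨hφ.1.add hψ.1, hφ.2.1.add hψ.2.1,
    (tsupport_add φ ψ).trans (union_subset hφ.2.2 hψ.2.2)⟩

theorem IsTestFunction.const_mul {φ : EuclideanSpace ℝ (Fin d) → ℂ}
    (c : ℂ) (hφ : IsTestFunction Ω φ) : IsTestFunction Ω (fun x => c * φ x) :=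
  ⟨contDiff_const.mul hφ.1, hφ.2.1.mul_left, (tsupport_mul_subset_right).trans hφ.2.2⟩

theorem IsTestFunction.memLp {φ : EuclideanSpace ℝ (Fin d) → ℂ}
    (hφ : IsTestFunction Ω φ) (p : ℝ≥0∞) (ν : Measure (EuclideanSpace ℝ (Fin d)))
    [IsFiniteMeasureOnCompacts ν] : MemLp φ p ν :=
  hφ.1.continuous.memLp_of_hasCompactSupport hφ.2.1

theorem IsTestFunction.zero : IsTestFunction Ω (fun _ => 0) :=
  ⟨contDiff_const, HasCompactSupport.zero, by
    have : tsupport (fun _ : EuclideanSpace ℝ (Fin d) => (0 : ℂ)) = ∅ :=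
      tsupport_eq_empty_iff.2 rfl
    simp [this]⟩

theorem IsTestFunction.partialDeriv_continuous {φ : EuclideanSpace ℝ (Fin d) → ℂ}
    (hφ : IsTestFunction Ω φ) (i : Fin d) : Continuous (partialDeriv i φ) :=
  (hφ.1.continuous_fderiv (by simp)).clm_apply continuous_const

theorem IsTestFunction.laplacian_memLp {φ : EuclideanSpace ℝ (Fin d) → ℂ}
    (hφ : IsTestFunction Ω φ) (p : ℝ≥0∞) (ν : Measure (EuclideanSpace ℝ (Fin d)))
    [IsFiniteMeasureOnCompacts ν] : MemLp (Δ φ) p ν := by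
  have hΔ := InnerProductSpace.laplacian_eq_iteratedFDeriv_stdOrthonormalBasis φ
  have hcont : Continuous (iteratedFDeriv ℝ 2 φ) :=
    (contDiff_infty.1 hφ.1 2).continuous_iteratedFDeriv (m := 2) le_rfl
  have hc : Continuous (Δ φ) := by
    rw [hΔ]
    refine continuous_finsetSum _ fun i _ => ?_
    generalize ![stdOrthonormalBasis ℝ (EuclideanSpace ℝ (Fin d)) i,
      stdOrthonormalBasis ℝ (EuclideanSpace ℝ (Fin d)) i] = m
    exact (ContinuousMultilinearMap.apply ℝ (fun _ : Fin 2 => EuclideanSpace ℝ (Fin d)) ℂ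
      m).continuous.comp hcont
  refine hc.memLp_of_hasCompactSupport ?_
  refine HasCompactSupport.mono' (f := φ) hφ.2.1 ?_
  refine (fun x hx => support_iteratedFDeriv_subset (𝕜 := ℝ) (f := φ) 2 ?_)
  intro h0
  apply hx
  rw [hΔ]
  simp [h0]

theorem MemH10.zero : MemH10 Ω (0 : L2 Ω) := by
  refine ⟨fun _ _ => 0, fun _ => 0, fun _ => IsTestFunction.zero, ?_, fun i => ?_⟩
  · refine tendsto_const_nhds.congr fun n => ?_
    refine Eq.symm ((eLpNorm_congr_ae (g := fun _ => (0 : ℂ)) ?_).trans eLpNorm_zero)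
    filter_upwards [Lp.coeFn_zero ℂ 2 ((volume : Measure (EuclideanSpace ℝ (Fin d))).restrict
      (Ω : Set (EuclideanSpace ℝ (Fin d))))] with x hx
    simp only [hx, Pi.zero_apply, sub_zero]
  · refine tendsto_const_nhds.congr fun n => ?_
    refine Eq.symm ((eLpNorm_congr_ae (g := fun _ => (0 : ℂ)) ?_).trans eLpNorm_zero)
    filter_upwards [Lp.coeFn_zero ℂ 2 ((volume : Measure (EuclideanSpace ℝ (Fin d))).restrict
      (Ω : Set (EuclideanSpace ℝ (Fin d))))] with x hx
    simp only [hx, Pi.zero_apply, sub_zero]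
    simp [partialDeriv]

theorem tendsto_eLpNorm_sub_add {a b : ℕ → EuclideanSpace ℝ (Fin d) → ℂ} {u v : L2 Ω}
    (ha : ∀ n, Continuous (a n)) (hb : ∀ n, Continuous (b n))
    (hu : Tendsto (fun n => eLpNorm (fun x => a n x - u x) 2
      ((volume : Measure (EuclideanSpace ℝ (Fin d))).restrict
        (Ω : Set (EuclideanSpace ℝ (Fin d))))) atTop (𝓝 0))
    (hv : Tendsto (fun n => eLpNorm (fun x => b n x - v x) 2
      ((volume : Measure (EuclideanSpace ℝ (Fin d))).restrict
        (Ω : Set (EuclideanSpace ℝ (Fin d))))) atTop (𝓝 0)) :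
    Tendsto (fun n => eLpNorm (fun x => a n x + b n x - (u + v : L2 Ω) x) 2
      ((volume : Measure (EuclideanSpace ℝ (Fin d))).restrict
        (Ω : Set (EuclideanSpace ℝ (Fin d))))) atTop (𝓝 0) := by
  have h := hu.add hv
  rw [add_zero] at h
  refine tendsto_of_tendsto_of_tendsto_of_le_of_le tendsto_const_nhds h
    (fun n => zero_le) fun n => ?_
  refine le_trans (le_of_eq (eLpNorm_congr_ae ?_)) (eLpNorm_add_le
    ((ha n).aestronglyMeasurable.sub (Lp.aestronglyMeasurable u))
    ((hb n).aestronglyMeasurable.sub (Lp.aestronglyMeasurable v)) (by norm_num))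
  filter_upwards [Lp.coeFn_add u v] with x hx
  simp only [hx, Pi.add_apply]
  ring

theorem tendsto_eLpNorm_sub_smul {a : ℕ → EuclideanSpace ℝ (Fin d) → ℂ} {u : L2 Ω} (c : ℂ)
    (hu : Tendsto (fun n => eLpNorm (fun x => a n x - u x) 2
      ((volume : Measure (EuclideanSpace ℝ (Fin d))).restrict
        (Ω : Set (EuclideanSpace ℝ (Fin d))))) atTop (𝓝 0)) :
    Tendsto (fun n => eLpNorm (fun x => c * a n x - (c • u : L2 Ω) x) 2
      ((volume : Measure (EuclideanSpace ℝ (Fin d))).restrict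
        (Ω : Set (EuclideanSpace ℝ (Fin d))))) atTop (𝓝 0) := by
  have h := ENNReal.Tendsto.const_mul (a := ‖c‖ₑ) hu (Or.inr enorm_ne_top)
  rw [mul_zero] at h
  refine h.congr fun n => ?_
  rw [← eLpNorm_const_smul]
  refine eLpNorm_congr_ae ?_
  filter_upwards [Lp.coeFn_smul c u] with x hx
  simp only [hx, Pi.smul_apply, smul_eq_mul]
  ring

theorem MemH10.add {u v : L2 Ω} (hu : MemH10 Ω u) (hv : MemH10 Ω v) : MemH10 Ω (u + v) := by
  obtain ⟨φ, g, hφ, h1, h2⟩ := hu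
  obtain ⟨ψ, k, hψ, h3, h4⟩ := hv
  refine ⟨fun n x => φ n x + ψ n x, fun i => g i + k i, fun n => (hφ n).add (hψ n),
    tendsto_eLpNorm_sub_add (fun n => (hφ n).1.continuous) (fun n => (hψ n).1.continuous) h1 h3,
    fun i => ?_⟩
  have h := tendsto_eLpNorm_sub_add (fun n => (hφ n).partialDeriv_continuous i)
    (fun n => (hψ n).partialDeriv_continuous i) (h2 i) (h4 i)
  refine h.congr fun n => ?_
  congr 1
  ext x
  have := fderiv_fun_add (𝕜 := ℝ) (x := x) ((hφ n).1.differentiable (by simp) x)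
    ((hψ n).1.differentiable (by simp) x)
  simp [partialDeriv, this]

theorem MemH10.smul {u : L2 Ω} (c : ℂ) (hu : MemH10 Ω u) : MemH10 Ω (c • u) := by
  obtain ⟨φ, g, hφ, h1, h2⟩ := hu
  refine ⟨fun n x => c * φ n x, fun i => c • g i, fun n => (hφ n).const_mul c,
    tendsto_eLpNorm_sub_smul c h1, fun i => ?_⟩
  refine (tendsto_eLpNorm_sub_smul c (h2 i)).congr fun n => ?_
  congr 1
  ext x
  have := fderiv_const_mul (𝕜 := ℝ) (x := x) ((hφ n).1.differentiable (by simp) x) c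
  simp [partialDeriv, this]

theorem IsWeakNegLaplacian.zero : IsWeakNegLaplacian Ω (0 : L2 Ω) 0 := by
  intro φ _
  have h0 := Lp.coeFn_zero ℂ 2 ((volume : Measure (EuclideanSpace ℝ (Fin d))).restrict
      (Ω : Set (EuclideanSpace ℝ (Fin d))))
  have key : ∀ ψ : EuclideanSpace ℝ (Fin d) → ℂ,
      ∫ x in (Ω : Set (EuclideanSpace ℝ (Fin d))), (0 : L2 Ω) x * ψ x = 0 := by
    intro ψ
    refine integral_eq_zero_of_ae ?_
    filter_upwards [h0] with x hx
    simp only [hx, Pi.zero_apply, zero_mul]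
  rw [key, key, neg_zero]

theorem integral_L2_add_mul (u v : L2 Ω) {ψ : EuclideanSpace ℝ (Fin d) → ℂ}
    (hψ : MemLp ψ 2 ((volume : Measure (EuclideanSpace ℝ (Fin d))).restrict
      (Ω : Set (EuclideanSpace ℝ (Fin d))))) :
    ∫ x in (Ω : Set (EuclideanSpace ℝ (Fin d))), (u + v : L2 Ω) x * ψ x =
      (∫ x in (Ω : Set (EuclideanSpace ℝ (Fin d))), u x * ψ x) +
      ∫ x in (Ω : Set (EuclideanSpace ℝ (Fin d))), v x * ψ x := by
  refine Eq.trans (integral_congr_ae ?_)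
    (integral_add ((Lp.memLp u).integrable_mul hψ) ((Lp.memLp v).integrable_mul hψ))
  filter_upwards [Lp.coeFn_add u v] with x hx
  simp only [hx, Pi.add_apply, add_mul]

theorem integral_L2_smul_mul (c : ℂ) (u : L2 Ω) (ψ : EuclideanSpace ℝ (Fin d) → ℂ) :
    ∫ x in (Ω : Set (EuclideanSpace ℝ (Fin d))), (c • u : L2 Ω) x * ψ x =
      c * ∫ x in (Ω : Set (EuclideanSpace ℝ (Fin d))), u x * ψ x := by
  rw [← integral_const_mul]
  refine integral_congr_ae ?_
  filter_upwards [Lp.coeFn_smul c u] with x hx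
  simp only [hx, Pi.smul_apply, smul_eq_mul, mul_assoc]

theorem IsWeakNegLaplacian.add {u v f g : L2 Ω} (hu : IsWeakNegLaplacian Ω u f)
    (hv : IsWeakNegLaplacian Ω v g) : IsWeakNegLaplacian Ω (u + v) (f + g) := by
  intro φ hφ
  rw [integral_L2_add_mul _ _ (hφ.laplacian_memLp 2 _),
    integral_L2_add_mul _ _ (hφ.memLp 2 _), ← hu φ hφ, ← hv φ hφ, neg_add]

theorem IsWeakNegLaplacian.smul {u f : L2 Ω} (c : ℂ) (hu : IsWeakNegLaplacian Ω u f) :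
    IsWeakNegLaplacian Ω (c • u) (c • f) := by
  intro φ hφ
  rw [integral_L2_smul_mul, integral_L2_smul_mul, ← hu φ hφ, mul_neg]

theorem IsWeakNegLaplacian.unique {u f g : L2 Ω} (hf : IsWeakNegLaplacian Ω u f)
    (hg : IsWeakNegLaplacian Ω u g) : f = g := by
  have hfi := (Lp.memLp f).locallyIntegrable (by norm_num)
  have hgi := (Lp.memLp g).locallyIntegrable (by norm_num)
  have h := Ω.isOpen.ae_eq_zero_of_integral_contDiff_smul_eq_zero
    (μ := (volume : Measure (EuclideanSpace ℝ (Fin d))).restrict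
      (Ω : Set (EuclideanSpace ℝ (Fin d))))
    (f := fun x => f x - g x) ((hfi.sub hgi).locallyIntegrableOn _) (by
      intro φ h1 h2 h3
      have ht : IsTestFunction Ω (fun x => (φ x : ℂ)) := by
        refine ⟨Complex.ofRealCLM.contDiff.comp h1,
          h2.comp_left (g := fun r : ℝ => (r : ℂ)) (by simp), ?_⟩
        refine (closure_mono fun x hx => ?_).trans h3
        intro h0
        exact hx (by simp [h0])
      have e := (hf _ ht).symm.trans (hg _ ht)
      have m := ht.memLp 2 ((volume : Measure (EuclideanSpace ℝ (Fin d))).restrict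
        (Ω : Set (EuclideanSpace ℝ (Fin d))))
      have s := integral_sub ((Lp.memLp f).integrable_mul m) ((Lp.memLp g).integrable_mul m)
      simp only [Pi.mul_apply] at s
      rw [e, sub_self] at s
      rw [← s]
      refine integral_congr_ae (Eventually.of_forall fun x => ?_)
      simp only [Complex.real_smul]
      ring)
  refine Lp.ext ?_
  filter_upwards [h, ae_restrict_mem Ω.isOpen.measurableSet] with x hx hxm
  exact sub_eq_zero.1 (hx hxm)

variable (Ω) in
/-- The Dirichlet Laplacian `A = -Δ`, an unbounded operator in `L²(Ω)` with domain
`{u ∈ H¹₀(Ω) : Δu ∈ L²(Ω)}` (which is `H¹₀(Ω) ∩ H²(Ω)` when `Ω` is convex). -/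
def dirichletLaplacian : L2 Ω →ₗ.[ℂ] L2 Ω where
  domain :=
    { carrier := {u | MemH10 Ω u ∧ ∃ f : L2 Ω, IsWeakNegLaplacian Ω u f}
      add_mem' := fun ⟨hu, f, hf⟩ ⟨hv, g, hg⟩ => ⟨hu.add hv, f + g, hf.add hg⟩
      zero_mem' := ⟨MemH10.zero, 0, IsWeakNegLaplacian.zero⟩
      smul_mem' := fun c _ ⟨hu, f, hf⟩ => ⟨hu.smul c, c • f, hf.smul c⟩ }
  toFun :=
    { toFun := fun u => u.2.2.choose
      map_add' := fun u v => IsWeakNegLaplacian.unique (u + v).2.2.choose_spec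
        (u.2.2.choose_spec.add v.2.2.choose_spec)
      map_smul' := fun c u => IsWeakNegLaplacian.unique (c • u).2.2.choose_spec
        (u.2.2.choose_spec.smul c) }

variable (Ω) in
/-- `R = (ζ I + A)⁻¹`: a bounded two-sided inverse of `ζ I + A : D(A) → L²(Ω)`. -/
def IsShiftInverse (ζ : ℂ) (R : L2 Ω →L[ℂ] L2 Ω) : Prop :=
  (∀ f : L2 Ω, ∃ h : R f ∈ (dirichletLaplacian Ω).domain,
    ζ • R f + dirichletLaplacian Ω ⟨R f, h⟩ = f) ∧
  ∀ u : (dirichletLaplacian Ω).domain, R (ζ • (u : L2 Ω) + dirichletLaplacian Ω u) = u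

open Classical in
variable (Ω) in
/-- The operator `(ζ I + A)⁻¹` (with value `0` if `ζ I + A` is not boundedly invertible). -/
def shiftInverse (ζ : ℂ) : L2 Ω →L[ℂ] L2 Ω :=
  if h : ∃ R, IsShiftInverse Ω ζ R then h.choose else 0

/-- `w(z) = ∫₀¹ z^{α-1} μ(α) dα`. -/
def kernelW (μ : ℝ → ℝ) (z : ℂ) : ℂ :=
  ∫ α in (0 : ℝ)..1, z ^ ((α : ℂ) - 1) * (μ α : ℂ)

variable (Ω) in
/-- `H(z) = (z w(z) I + A)⁻¹ w(z)`. -/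
def kernelH (μ : ℝ → ℝ) (z : ℂ) : L2 Ω →L[ℂ] L2 Ω :=
  kernelW μ z • shiftInverse Ω (z * kernelW μ z)

/-- The integral of `F` along the contour
`Γ_{θ,δ} = {|z| = δ, |arg z| ≤ θ} ∪ {z = ρ e^{± i θ}, ρ ≥ δ}`,
oriented with increasing imaginary part. -/
def contourIntegral {X : Type*} [NormedAddCommGroup X] [NormedSpace ℂ X] (θ δ : ℝ)
    (F : ℂ → X) : X :=
  (∫ ρ in Ioi δ, Complex.exp (θ * Complex.I) • F (ρ * Complex.exp (θ * Complex.I)))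
  - (∫ ρ in Ioi δ, Complex.exp (-(θ * Complex.I)) • F (ρ * Complex.exp (-(θ * Complex.I))))
  + ∫ ψ in (-θ)..θ, (Complex.I * δ * Complex.exp (ψ * Complex.I)) •
      F (δ * Complex.exp (ψ * Complex.I))

variable (Ω) in
/-- The solution operator `S(t) = (2πi)⁻¹ ∫_{Γ_{θ,δ}} e^{zt} H(z) dz`, for `t > 0`. -/
def solutionOp (μ : ℝ → ℝ) (θ δ t : ℝ) : L2 Ω →L[ℂ] L2 Ω :=
  (2 * (π : ℂ) * Complex.I)⁻¹ •
    contourIntegral θ δ (fun z => Complex.exp (z * t) • kernelH Ω μ z)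

/-- The Caputo derivative `∂ₜ^α u(t) = Γ(1-α)⁻¹ ∫₀ᵗ (t-s)^{-α} u'(s) ds`, `0 < α < 1`. -/
def caputoDeriv {X : Type*} [NormedAddCommGroup X] [NormedSpace ℝ X] (α : ℝ) (u : ℝ → X)
    (t : ℝ) : X :=
  (Real.Gamma (1 - α))⁻¹ • ∫ s in (0 : ℝ)..t, (t - s) ^ (-α) • deriv u s

/-- The distributed order derivative `D^μ u(t) = ∫₀¹ ∂ₜ^α u(t) μ(α) dα`. -/
def distributedDeriv {X : Type*} [NormedAddCommGroup X] [NormedSpace ℝ X] (μ : ℝ → ℝ)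
    (u : ℝ → X) (t : ℝ) : X :=
  ∫ α in (0 : ℝ)..1, μ α • caputoDeriv α u t

/-- `u` is a strong solution of `D^μ u - Δu = 0` in `Ω` for all `t > 0`, `u = 0` on `∂Ω`,
`u(0) = v`; all the integrals that define `D^μ u` converge absolutely. -/
structure IsStrongSolution (μ : ℝ → ℝ) (v : L2 Ω) (u : ℝ → L2 Ω) : Prop where
  initial : Tendsto u (𝓝[>] 0) (𝓝 v)
  differentiableAt : ∀ t, 0 < t → DifferentiableAt ℝ u t
  caputo_integrable : ∀ t, 0 < t → ∀ α ∈ Ioo (0 : ℝ) 1,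
    IntervalIntegrable (fun s => (t - s) ^ (-α) • deriv u s) volume 0 t
  distributed_integrable : ∀ t, 0 < t →
    IntervalIntegrable (fun α => μ α • caputoDeriv α u t) volume 0 1
  equation : ∀ t, 0 < t → ∃ h : u t ∈ (dirichletLaplacian Ω).domain,
    distributedDeriv μ u t + dirichletLaplacian Ω ⟨u t, h⟩ = 0

end

/-! The proof combines two facts about `A` with two bounds on the symbol `z * kernelW μ z`.

The quadratic form of `A` is real and nonnegative, and `I + A` is onto. Hence `ζ I + A` is boundedly
invertible, with norm at most `1 / Re (bζ)`, as soon as some unimodular `b` with `Re b > 0`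
satisfies `Re (bζ) > 0`. For `z = ρ e^{iψ}`, `|ψ| < π`, the number `ζ = z w(z) = ∫ z^α μ(α) dα` is a
positive superposition of numbers with arguments between `0` and `ψ`. The rotation `b = e^{-iψ/2}`
therefore gives `Re (bζ) ≥ cos(ψ/2) s(ρ)`, where `s = kernelSymbol μ`, while `|ζ| ≤ s(ρ)`
(`cos_mul_kernelSymbol_le`, `norm_mul_kernelW_le`). So `ζ (ζ I + A)⁻¹` is bounded on every sector,
uniformly in `ρ`; in particular `‖H(z)‖ ≤ 2/ρ` and `‖A H(z)‖ ≤ 3 |w(z)|` for `|ψ| ≤ 2π/3`.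

Logarithms enter twice. Since `μ(1) > 0`, `s(ρ) ≥ c ρ / log max(ρ, 2)` (`exists_le_kernelSymbol`),
which costs a logarithm in the resolvent. Since `∫ a^{1-α} dα ≤ 1 / log a⁻¹`, `|w(z)| ≤ K /
log(2T/t)` for `|z| ≥ 1/t` (`exists_norm_kernelW_le`), which gains one.

By Cauchy's theorem the contour may be replaced by the one with angle `2π/3` and radius `1/t`. There
a symbol of size `M` for `|z| ~ 1/t` has an inverse transform of size `M/t` (`norm_laplaceInv_le`),
independently of the original `θ` and `δ`; a derivative multiplies the symbol by `z`. This gives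
(b). For (c), `A H(z) v = H(z) A v` and `z H(z) v = v - R(z) A v` with `R(z) = (z w(z) I + A)⁻¹`,
and polynomials in `z` have inverse transform zero for `t > 0`.

For the equation, `S'(t) v` is the inverse transform of `-R(z) A v`. Fractional integration
multiplies the symbol by `z^{α-1}`, as a comparison of Laplace transforms shows, and integration
against `μ` turns `z^{α-1}` into `w(z)`. The result is `-S(t) A v = -A S(t) v`. The initial value
follows from the rate `t log(1/t)` on `D(A)`, the density of `D(A)` and the uniform boundedness of
`S(t)`. -/

noncomputable section Elliptic

/-! ### The quadratic form of the Dirichlet Laplacian and the solvability of `u - Δu = f`. -/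

variable {d : ℕ} {Ω : Opens (EuclideanSpace ℝ (Fin d))}

variable (Ω) in
open Classical in
/-- The class in `L²(Ω)` of a square-integrable function (and `0` for any other function). -/
def toL2 (f : EuclideanSpace ℝ (Fin d) → ℂ) : L2 Ω :=
  if h : MemLp f 2 ((volume : Measure (EuclideanSpace ℝ (Fin d))).restrict
    (Ω : Set (EuclideanSpace ℝ (Fin d)))) then h.toLp f else 0

theorem coeFn_toL2 {f : EuclideanSpace ℝ (Fin d) → ℂ}
    (h : MemLp f 2 ((volume : Measure (EuclideanSpace ℝ (Fin d))).restrict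
      (Ω : Set (EuclideanSpace ℝ (Fin d))))) :
    toL2 Ω f =ᵐ[(volume : Measure (EuclideanSpace ℝ (Fin d))).restrict
      (Ω : Set (EuclideanSpace ℝ (Fin d)))] f := by
  rw [toL2, dif_pos h]
  exact h.coeFn_toLp

theorem tendsto_toL2_iff {f : ℕ → EuclideanSpace ℝ (Fin d) → ℂ} {u : L2 Ω}
    (h : ∀ n, MemLp (f n) 2 ((volume : Measure (EuclideanSpace ℝ (Fin d))).restrict
      (Ω : Set (EuclideanSpace ℝ (Fin d))))) :
    Tendsto (fun n => toL2 Ω (f n)) atTop (𝓝 u) ↔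
      Tendsto (fun n => eLpNorm (fun x => f n x - u x) 2
        ((volume : Measure (EuclideanSpace ℝ (Fin d))).restrict
          (Ω : Set (EuclideanSpace ℝ (Fin d))))) atTop (𝓝 0) := by
  rw [Lp.tendsto_Lp_iff_tendsto_eLpNorm']
  refine tendsto_congr fun n => eLpNorm_congr_ae ?_
  filter_upwards [coeFn_toL2 (h n)] with x hx
  simp [hx]

theorem inner_toL2 {f : EuclideanSpace ℝ (Fin d) → ℂ}
    (h : MemLp f 2 ((volume : Measure (EuclideanSpace ℝ (Fin d))).restrict
      (Ω : Set (EuclideanSpace ℝ (Fin d))))) (u : L2 Ω) :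
    inner ℂ (toL2 Ω f) u =
      ∫ x in (Ω : Set (EuclideanSpace ℝ (Fin d))), u x * (starRingEnd ℂ) (f x) := by
  rw [L2.inner_def]
  refine integral_congr_ae ?_
  filter_upwards [coeFn_toL2 h] with x hx
  simp [hx]

theorem IsTestFunction.partialDeriv {φ : EuclideanSpace ℝ (Fin d) → ℂ}
    (hφ : IsTestFunction Ω φ) (i : Fin d) : IsTestFunction Ω (partialDeriv i φ) := by
  have hs : Function.support (_root_.partialDeriv i φ) ⊆ tsupport φ := by
    refine Subset.trans ?_ (support_fderiv_subset ℝ (f := φ))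
    intro x hx h0
    exact hx (by simp [_root_.partialDeriv, h0])
  refine ⟨?_, hφ.2.1.mono' hs, (closure_minimal hs (isClosed_tsupport _)).trans hφ.2.2⟩
  have := hφ.1.fderiv_right (m := ∞) (by simp)
  exact this.clm_apply contDiff_const

theorem IsTestFunction.conj {φ : EuclideanSpace ℝ (Fin d) → ℂ}
    (hφ : IsTestFunction Ω φ) : IsTestFunction Ω (fun x => (starRingEnd ℂ) (φ x)) := by
  refine ⟨Complex.conjCLE.contDiff.comp hφ.1,
    hφ.2.1.comp_left (g := fun r : ℂ => (starRingEnd ℂ) r) (by simp), ?_⟩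
  refine (closure_mono fun x hx => ?_).trans hφ.2.2
  intro h0
  exact hx (by simp [h0])

theorem partialDeriv_conj {φ : EuclideanSpace ℝ (Fin d) → ℂ}
    (hφ : IsTestFunction Ω φ) (i : Fin d) (x : EuclideanSpace ℝ (Fin d)) :
    partialDeriv i (fun x => (starRingEnd ℂ) (φ x)) x = (starRingEnd ℂ) (partialDeriv i φ x) := by
  have h := (Complex.conjCLE.toContinuousLinearMap.hasFDerivAt (x := φ x)).comp x
    ((hφ.1.differentiable (by simp) x).hasFDerivAt)
  have h2 := h.fderiv
  unfold partialDeriv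
  have e : (fun x => (starRingEnd ℂ) (φ x)) = Complex.conjCLE.toContinuousLinearMap ∘ φ := rfl
  rw [e, h2]
  rfl

theorem IsTestFunction.laplacian_eq {φ : EuclideanSpace ℝ (Fin d) → ℂ}
    (hφ : IsTestFunction Ω φ) (x : EuclideanSpace ℝ (Fin d)) :
    (Δ φ) x = ∑ i, _root_.partialDeriv i (_root_.partialDeriv i φ) x := by
  rw [InnerProductSpace.laplacian_eq_iteratedFDeriv_orthonormalBasis φ
    (EuclideanSpace.basisFun (Fin d) ℝ)]
  refine Finset.sum_congr rfl fun i _ => ?_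
  rw [iteratedFDeriv_two_apply]
  have hd : DifferentiableAt ℝ (fderiv ℝ φ) x :=
    (hφ.1.fderiv_right (m := ∞) (by simp)).differentiable (by simp) x
  have := (hd.hasFDerivAt.clm_apply (hasFDerivAt_const (EuclideanSpace.single i (1:ℝ)) x)).fderiv
  unfold _root_.partialDeriv
  rw [this]
  simp

theorem IsTestFunction.laplacian_conj {φ : EuclideanSpace ℝ (Fin d) → ℂ}
    (hφ : IsTestFunction Ω φ) (x : EuclideanSpace ℝ (Fin d)) :
    (Δ (fun x => (starRingEnd ℂ) (φ x))) x = (starRingEnd ℂ) ((Δ φ) x) := by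
  rw [hφ.conj.laplacian_eq, hφ.laplacian_eq, map_sum]
  refine Finset.sum_congr rfl fun i _ => ?_
  rw [← partialDeriv_conj (hφ.partialDeriv i)]
  congr 1
  funext y
  exact partialDeriv_conj hφ i y

theorem integral_partialDeriv_mul {φ ψ : EuclideanSpace ℝ (Fin d) → ℂ}
    (hφ : IsTestFunction Ω φ) (hψ : IsTestFunction Ω ψ) (i : Fin d) :
    ∫ x in (Ω : Set (EuclideanSpace ℝ (Fin d))), φ x * partialDeriv i ψ x =
      -∫ x in (Ω : Set (EuclideanSpace ℝ (Fin d))), partialDeriv i φ x * ψ x := by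
  have hm : ∀ {a b : EuclideanSpace ℝ (Fin d) → ℂ}, IsTestFunction Ω a → IsTestFunction Ω b →
      Integrable (fun x => a x * b x) := fun ha hb =>
    (ha.memLp 2 volume).integrable_mul (hb.memLp 2 volume)
  have h0 : ∀ {a b : EuclideanSpace ℝ (Fin d) → ℂ}, IsTestFunction Ω a →
      ∫ x in (Ω : Set (EuclideanSpace ℝ (Fin d))), a x * b x = ∫ x, a x * b x := by
    intro a b ha
    refine setIntegral_eq_integral_of_forall_compl_eq_zero fun x hx => ?_
    rw [image_eq_zero_of_notMem_tsupport (fun h => hx (ha.2.2 h)), zero_mul]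
  rw [h0 hφ, h0 (hφ.partialDeriv i)]
  exact integral_mul_fderiv_eq_neg_fderiv_mul_of_integrable (hm (hφ.partialDeriv i) hψ)
    (hm hφ (hψ.partialDeriv i)) (hm hφ hψ) (fun x _ => hφ.1.differentiable (by simp) x)
    (fun x _ => hψ.1.differentiable (by simp) x)

theorem inner_partialDeriv {φ ψ : EuclideanSpace ℝ (Fin d) → ℂ}
    (hφ : IsTestFunction Ω φ) (hψ : IsTestFunction Ω ψ) (i : Fin d) :
    inner ℂ (toL2 Ω (partialDeriv i ψ)) (toL2 Ω φ) =
      -inner ℂ (toL2 Ω ψ) (toL2 Ω (partialDeriv i φ)) := by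
  have hc : ∀ {a b : EuclideanSpace ℝ (Fin d) → ℂ}, IsTestFunction Ω a → IsTestFunction Ω b →
      inner ℂ (toL2 Ω b) (toL2 Ω a) =
        ∫ x in (Ω : Set (EuclideanSpace ℝ (Fin d))), a x * (starRingEnd ℂ) (b x) := by
    intro a b ha hb
    rw [inner_toL2 (hb.memLp 2 _)]
    refine integral_congr_ae ?_
    filter_upwards [coeFn_toL2 (ha.memLp 2 _)] with x hx
    rw [hx]
  rw [hc hφ (hψ.partialDeriv i), hc (hφ.partialDeriv i) hψ, ← integral_partialDeriv_mul hφ hψ.conj i]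
  refine integral_congr_ae (Eventually.of_forall fun x => ?_)
  simp only [partialDeriv_conj hψ]

theorem toL2_laplacian {ψ : EuclideanSpace ℝ (Fin d) → ℂ} (hψ : IsTestFunction Ω ψ) :
    toL2 Ω (Δ ψ) = ∑ i, toL2 Ω (partialDeriv i (partialDeriv i ψ)) := by
  refine Lp.ext ?_
  have h : ∀ i ∈ (Finset.univ : Finset (Fin d)), MemLp (partialDeriv i (partialDeriv i ψ)) 2
      ((volume : Measure (EuclideanSpace ℝ (Fin d))).restrict
        (Ω : Set (EuclideanSpace ℝ (Fin d)))) :=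
    fun i _ => (((hψ.partialDeriv i).partialDeriv i).memLp 2 _)
  have h2 : ∀ᵐ x ∂((volume : Measure (EuclideanSpace ℝ (Fin d))).restrict
        (Ω : Set (EuclideanSpace ℝ (Fin d)))), ∀ i,
      toL2 Ω (partialDeriv i (partialDeriv i ψ)) x = partialDeriv i (partialDeriv i ψ) x := by
    rw [ae_all_iff]
    exact fun i => coeFn_toL2 (h i (Finset.mem_univ i))
  filter_upwards [coeFn_toL2 (hψ.laplacian_memLp 2 _), h2,
    Lp.coeFn_finsetSum Finset.univ (fun i => toL2 Ω (partialDeriv i (partialDeriv i ψ)))]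
    with x hx hx2 hx3
  rw [hx, hx3, hψ.laplacian_eq]
  simp [hx2]

/-- The distributional pairing is bilinear; replacing the test function by its conjugate turns it
into the inner product, which makes Hilbert space arguments available. -/
theorem isWeakNegLaplacian_iff {u f : L2 Ω} :
    IsWeakNegLaplacian Ω u f ↔ ∀ ψ, IsTestFunction Ω ψ →
      -inner ℂ (toL2 Ω (Δ ψ)) u = inner ℂ (toL2 Ω ψ) f := by
  constructor
  · intro h ψ hψ
    rw [inner_toL2 (hψ.laplacian_memLp 2 _), inner_toL2 (hψ.memLp 2 _), ← h _ hψ.conj]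
    simp_rw [hψ.laplacian_conj]
  · intro h φ hφ
    have := h _ hφ.conj
    rw [inner_toL2 (hφ.conj.laplacian_memLp 2 _), inner_toL2 (hφ.conj.memLp 2 _)] at this
    simpa [hφ.laplacian_conj] using this

/-- `(u, g)` is a limit of pairs `(φ, ∇φ)` of test functions and their gradients. -/
def IsH10Gradient (u : L2 Ω) (g : Fin d → L2 Ω) : Prop :=
  ∃ φ : ℕ → EuclideanSpace ℝ (Fin d) → ℂ, (∀ n, IsTestFunction Ω (φ n)) ∧
    Tendsto (fun n => toL2 Ω (φ n)) atTop (𝓝 u) ∧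
    ∀ i, Tendsto (fun n => toL2 Ω (partialDeriv i (φ n))) atTop (𝓝 (g i))

theorem memH10_iff {u : L2 Ω} : MemH10 Ω u ↔ ∃ g, IsH10Gradient u g := by
  constructor
  · rintro ⟨φ, g, h1, h2, h3⟩
    exact ⟨g, φ, h1, (tendsto_toL2_iff fun n => (h1 n).memLp 2 _).2 h2,
      fun i => (tendsto_toL2_iff fun n => ((h1 n).partialDeriv i).memLp 2 _).2 (h3 i)⟩
  · rintro ⟨g, φ, h1, h2, h3⟩
    exact ⟨φ, g, h1, (tendsto_toL2_iff fun n => (h1 n).memLp 2 _).1 h2,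
      fun i => (tendsto_toL2_iff fun n => ((h1 n).partialDeriv i).memLp 2 _).1 (h3 i)⟩

/-- Integration by parts for two test functions survives the limit in one of them, because only that
function and its first derivatives appear after one integration. -/
theorem IsH10Gradient.inner_laplacian {u : L2 Ω} {g : Fin d → L2 Ω} (h : IsH10Gradient u g)
    {ψ : EuclideanSpace ℝ (Fin d) → ℂ} (hψ : IsTestFunction Ω ψ) :
    -inner ℂ (toL2 Ω (Δ ψ)) u = ∑ i, inner ℂ (toL2 Ω (partialDeriv i ψ)) (g i) := by
  obtain ⟨φ, h1, h2, h3⟩ := h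
  have hl := ((tendsto_const_nhds (x := toL2 Ω (Δ ψ))).inner h2 (𝕜 := ℂ)).neg
  have hr := tendsto_finsetSum Finset.univ fun i _ =>
    (tendsto_const_nhds (x := toL2 Ω (partialDeriv i ψ))).inner (h3 i) (𝕜 := ℂ)
  refine tendsto_nhds_unique hl (hr.congr fun n => ?_)
  rw [toL2_laplacian hψ, sum_inner, ← Finset.sum_neg_distrib]
  refine Finset.sum_congr rfl fun i _ => ?_
  rw [inner_partialDeriv (h1 n) (hψ.partialDeriv i), neg_neg]

theorem dirichletLaplacian_spec (u : (dirichletLaplacian Ω).domain) :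
    IsWeakNegLaplacian Ω (u : L2 Ω) (dirichletLaplacian Ω u) :=
  u.2.2.choose_spec

theorem mem_domain_iff {u : L2 Ω} : u ∈ (dirichletLaplacian Ω).domain ↔
    MemH10 Ω u ∧ ∃ f : L2 Ω, IsWeakNegLaplacian Ω u f := Iff.rfl

theorem dirichletLaplacian_apply_eq {u f : L2 Ω} (hu : u ∈ (dirichletLaplacian Ω).domain)
    (h : IsWeakNegLaplacian Ω u f) : dirichletLaplacian Ω ⟨u, hu⟩ = f :=
  (dirichletLaplacian_spec ⟨u, hu⟩).unique h

/-- The quadratic form of the Dirichlet Laplacian is real and nonnegative. -/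
theorem exists_inner_dirichletLaplacian (u : (dirichletLaplacian Ω).domain) :
    ∃ q : ℝ, 0 ≤ q ∧ inner ℂ (u : L2 Ω) (dirichletLaplacian Ω u) = (q : ℂ) := by
  obtain ⟨g, hg⟩ := memH10_iff.1 (mem_domain_iff.1 u.2).1
  have hw := isWeakNegLaplacian_iff.1 (dirichletLaplacian_spec u)
  -- The form equals the Dirichlet energy: test the weak equation with the approximants `φ n` of `u`
  -- and pass to the limit.
  refine ⟨∑ i, ‖g i‖ ^ 2, by positivity, ?_⟩
  obtain ⟨φ, h1, h2, h3⟩ := id hg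
  have hl := h2.inner (tendsto_const_nhds (x := dirichletLaplacian Ω u)) (𝕜 := ℂ)
  have hr := tendsto_finsetSum Finset.univ fun i _ =>
    (h3 i).inner (tendsto_const_nhds (x := g i)) (𝕜 := ℂ)
  rw [tendsto_nhds_unique hl (hr.congr fun n => ?_)]
  · push_cast
    exact Finset.sum_congr rfl fun i _ => inner_self_eq_norm_sq_to_K (g i)
  · rw [← hw _ (h1 n), hg.inner_laplacian (h1 n)]


theorem toL2_add {f g : EuclideanSpace ℝ (Fin d) → ℂ}
    (hf : MemLp f 2 ((volume : Measure (EuclideanSpace ℝ (Fin d))).restrict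
      (Ω : Set (EuclideanSpace ℝ (Fin d)))))
    (hg : MemLp g 2 ((volume : Measure (EuclideanSpace ℝ (Fin d))).restrict
      (Ω : Set (EuclideanSpace ℝ (Fin d))))) :
    toL2 Ω (fun x => f x + g x) = toL2 Ω f + toL2 Ω g := by
  have h : MemLp (fun x => f x + g x) 2 _ := hf.add hg
  rw [toL2, toL2, toL2, dif_pos hf, dif_pos hg, dif_pos h]
  rfl

theorem toL2_const_mul (c : ℂ) {f : EuclideanSpace ℝ (Fin d) → ℂ}
    (hf : MemLp f 2 ((volume : Measure (EuclideanSpace ℝ (Fin d))).restrict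
      (Ω : Set (EuclideanSpace ℝ (Fin d))))) :
    toL2 Ω (fun x => c * f x) = c • toL2 Ω f := by
  rw [toL2, toL2, dif_pos hf, dif_pos (hf.const_mul c)]
  rfl

theorem partialDeriv_add {φ ψ : EuclideanSpace ℝ (Fin d) → ℂ} (hφ : IsTestFunction Ω φ)
    (hψ : IsTestFunction Ω ψ) (i : Fin d) :
    partialDeriv i (fun x => φ x + ψ x) = fun x => partialDeriv i φ x + partialDeriv i ψ x := by
  funext x
  have := fderiv_fun_add (𝕜 := ℝ) (x := x) (hφ.1.differentiable (by simp) x)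
    (hψ.1.differentiable (by simp) x)
  simp [partialDeriv, this]

theorem partialDeriv_const_mul (c : ℂ) {φ : EuclideanSpace ℝ (Fin d) → ℂ}
    (hφ : IsTestFunction Ω φ) (i : Fin d) :
    partialDeriv i (fun x => c * φ x) = fun x => c * partialDeriv i φ x := by
  funext x
  have := fderiv_const_mul (𝕜 := ℝ) (x := x) (hφ.1.differentiable (by simp) x) c
  simp [partialDeriv, this]

variable (Ω) in
/-- The pairs `(φ, ∇φ)` of test functions and their gradients. -/
def testGraph : Submodule ℂ (WithLp 2 (L2 Ω × PiLp 2 fun _ : Fin d => L2 Ω)) where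
  carrier := {w | ∃ φ, IsTestFunction Ω φ ∧ w.fst = toL2 Ω φ ∧
    ∀ i, w.snd i = toL2 Ω (partialDeriv i φ)}
  zero_mem' := by
    have h0 : toL2 Ω (fun _ => 0) = 0 := by
      simpa using toL2_const_mul (Ω := Ω) 0 (f := fun _ => 0) MemLp.zero
    refine ⟨fun _ => 0, IsTestFunction.zero, h0.symm, fun i => ?_⟩
    have : partialDeriv i (fun _ : EuclideanSpace ℝ (Fin d) => (0 : ℂ)) = fun _ => 0 := by
      funext x
      simp [partialDeriv]
    rw [this, h0]
    rfl
  add_mem' := by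
    rintro a b ⟨φ, hφ, h1, h2⟩ ⟨ψ, hψ, h3, h4⟩
    refine ⟨_, hφ.add hψ, ?_, fun i => ?_⟩
    · rw [toL2_add (hφ.memLp 2 _) (hψ.memLp 2 _), ← h1, ← h3]
      rfl
    · rw [partialDeriv_add hφ hψ, toL2_add ((hφ.partialDeriv i).memLp 2 _)
        ((hψ.partialDeriv i).memLp 2 _), ← h2, ← h4]
      rfl
  smul_mem' := by
    rintro c a ⟨φ, hφ, h1, h2⟩
    refine ⟨_, hφ.const_mul c, ?_, fun i => ?_⟩
    · rw [toL2_const_mul c (hφ.memLp 2 _), ← h1]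
      rfl
    · rw [partialDeriv_const_mul c hφ, toL2_const_mul c ((hφ.partialDeriv i).memLp 2 _), ← h2]
      rfl

/-- The equation `u - Δu = f` has a solution `u ∈ D(A)` for every `f ∈ L²(Ω)`. -/
theorem exists_add_dirichletLaplacian_eq (f : L2 Ω) :
    ∃ u : (dirichletLaplacian Ω).domain, (u : L2 Ω) + dirichletLaplacian Ω u = f := by
  have : CompleteSpace (testGraph Ω).topologicalClosure :=
    (testGraph Ω).isClosed_topologicalClosure.completeSpace_coe
  -- The orthogonal projection of `(f, 0)` onto the closed graph of the gradient is `(u, ∇u)` with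
  -- `u ∈ H¹₀`. Orthogonality of the remainder `(f - u, -∇u)` to every `(ψ, ∇ψ)` is the weak form of
  -- `-Δu = f - u`.
  obtain ⟨y, hy, z, hz, hyz⟩ := (testGraph Ω).topologicalClosure.exists_add_mem_mem_orthogonal
    (WithLp.toLp 2 (f, 0))
  have hgrad : IsH10Gradient y.fst (fun i => y.snd i) := by
    obtain ⟨w, hw, hlim⟩ := mem_closure_iff_seq_limit.1 hy
    choose φ hφ h1 h2 using hw
    refine ⟨φ, hφ, ?_, fun i => ?_⟩
    · have := ((WithLp.continuous_fst 2 _ _).tendsto y).comp hlim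
      exact this.congr fun n => h1 n
    · have := (((PiLp.continuous_apply 2 _ i).comp (WithLp.continuous_snd 2 _ _)).tendsto y).comp hlim
      exact this.congr fun n => h2 n i
  have hz1 : z.fst = f - y.fst := by
    rw [eq_sub_iff_add_eq', ← WithLp.add_fst, ← hyz, WithLp.toLp_fst]
  have hz2 : ∀ i, z.snd i = - y.snd i := by
    intro i
    rw [eq_neg_iff_add_eq_zero, add_comm, ← PiLp.add_apply, ← WithLp.add_snd, ← hyz]
    rfl
  have hweak : IsWeakNegLaplacian Ω y.fst (f - y.fst) := by
    refine isWeakNegLaplacian_iff.2 fun ψ hψ => ?_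
    rw [hgrad.inner_laplacian hψ]
    have h := (Submodule.mem_orthogonal _ _).1 hz
      (WithLp.toLp 2 (toL2 Ω ψ, WithLp.toLp 2 fun i => toL2 Ω (partialDeriv i ψ)))
      ((testGraph Ω).le_topologicalClosure ⟨ψ, hψ, rfl, fun _ => rfl⟩)
    rw [WithLp.prod_inner_apply, PiLp.inner_apply] at h
    have h' : inner ℂ (toL2 Ω ψ) z.fst + ∑ i, inner ℂ (toL2 Ω (partialDeriv i ψ)) (z.snd i) = 0 := h
    simp only [hz1, hz2, inner_neg_right, Finset.sum_neg_distrib] at h'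
    exact (eq_of_sub_eq_zero (by rw [sub_eq_add_neg]; exact h')).symm
  have hdom : y.fst ∈ (dirichletLaplacian Ω).domain :=
    mem_domain_iff.2 ⟨memH10_iff.2 ⟨_, hgrad⟩, _, hweak⟩
  exact ⟨⟨y.fst, hdom⟩, by rw [dirichletLaplacian_apply_eq hdom hweak]; simp⟩

end Elliptic

/-! ### Invertibility, bounds and holomorphy of `(ζ I + A)⁻¹` off the negative axis. -/

noncomputable section Resolvent

variable {d : ℕ} {Ω : Opens (EuclideanSpace ℝ (Fin d))}

/-- A lower bound for `ζ I + A` from the numerical range: `b` rotates the sector spanned by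
`ζ` and `[0, ∞)` into the right half-plane. -/
theorem re_mul_norm_le_norm_add {b ζ : ℂ} (hb : ‖b‖ = 1) (hb0 : 0 ≤ b.re)
    (u : (dirichletLaplacian Ω).domain) :
    (b * ζ).re * ‖(u : L2 Ω)‖ ≤ ‖ζ • (u : L2 Ω) + dirichletLaplacian Ω u‖ := by
  obtain ⟨q, hq, hqe⟩ := exists_inner_dirichletLaplacian u
  rcases eq_or_ne (u : L2 Ω) 0 with h0 | h0
  · rw [h0, norm_zero, mul_zero]
    positivity
  have hpos : 0 < ‖(u : L2 Ω)‖ := norm_pos_iff.2 h0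
  refine le_of_mul_le_mul_right ?_ hpos
  have h1 : b * inner ℂ (u : L2 Ω) (ζ • (u : L2 Ω) + dirichletLaplacian Ω u) =
      b * ζ * ((‖(u : L2 Ω)‖ ^ 2 : ℝ) : ℂ) + b * (q : ℂ) := by
    rw [inner_add_right, inner_smul_right, hqe, inner_self_eq_norm_sq_to_K]
    push_cast
    simp only [Complex.coe_algebraMap]
    ring
  have h2 : (b * inner ℂ (u : L2 Ω) (ζ • (u : L2 Ω) + dirichletLaplacian Ω u)).re =
      (b * ζ).re * ‖(u : L2 Ω)‖ ^ 2 + b.re * q := by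
    rw [h1, Complex.add_re, Complex.re_mul_ofReal, Complex.re_mul_ofReal]
  have h3 := Complex.re_le_norm (b * inner ℂ (u : L2 Ω) (ζ • (u : L2 Ω) + dirichletLaplacian Ω u))
  rw [norm_mul, hb, one_mul, h2] at h3
  have h4 := norm_inner_le_norm (𝕜 := ℂ) (u : L2 Ω) (ζ • (u : L2 Ω) + dirichletLaplacian Ω u)
  nlinarith [mul_nonneg hb0 hq]

theorem eq_of_shift_eq {b ζ : ℂ} (hb : ‖b‖ = 1) (hb0 : 0 ≤ b.re) (hζ : 0 < (b * ζ).re)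
    {u v : (dirichletLaplacian Ω).domain}
    (h : ζ • (u : L2 Ω) + dirichletLaplacian Ω u = ζ • (v : L2 Ω) + dirichletLaplacian Ω v) :
    u = v := by
  have h1 := re_mul_norm_le_norm_add (ζ := ζ) hb hb0 (u - v)
  have h2 : ζ • ((u - v : (dirichletLaplacian Ω).domain) : L2 Ω) +
      dirichletLaplacian Ω (u - v) = 0 := by
    rw [LinearPMap.map_sub, Submodule.coe_sub, smul_sub, sub_add_sub_comm, h, sub_self]
  rw [h2, norm_zero] at h1
  have h3 : ‖((u - v : (dirichletLaplacian Ω).domain) : L2 Ω)‖ = 0 := by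
    refine le_antisymm ?_ (norm_nonneg _)
    by_contra! h4
    nlinarith [mul_pos hζ h4]
  have h4 : u - v = 0 := Subtype.ext (by simpa using h3)
  exact sub_eq_zero.1 h4

/-- The numerical range bound makes `ζ I + A` injective, so a right inverse is automatically
two-sided. -/
theorem isShiftInverse_of_rightInverse {b ζ : ℂ} (hb : ‖b‖ = 1) (hb0 : 0 ≤ b.re)
    (hζ : 0 < (b * ζ).re) {R : L2 Ω →L[ℂ] L2 Ω}
    (h : ∀ f : L2 Ω, ∃ h : R f ∈ (dirichletLaplacian Ω).domain,
      ζ • R f + dirichletLaplacian Ω ⟨R f, h⟩ = f) : IsShiftInverse Ω ζ R := by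
  refine ⟨h, fun u => ?_⟩
  obtain ⟨h1, h2⟩ := h (ζ • (u : L2 Ω) + dirichletLaplacian Ω u)
  exact congrArg Subtype.val (eq_of_shift_eq hb hb0 hζ (u := ⟨_, h1⟩) h2)

theorem IsShiftInverse.eq {ζ : ℂ} {R R' : L2 Ω →L[ℂ] L2 Ω} (h : IsShiftInverse Ω ζ R)
    (h' : IsShiftInverse Ω ζ R') : R = R' := by
  ext1 f
  obtain ⟨h1, h2⟩ := h'.1 f
  have := h.2 ⟨R' f, h1⟩
  rwa [h2] at this

theorem IsShiftInverse.shiftInverse_eq {ζ : ℂ} {R : L2 Ω →L[ℂ] L2 Ω} (h : IsShiftInverse Ω ζ R) :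
    shiftInverse Ω ζ = R := by
  have hex : ∃ R, IsShiftInverse Ω ζ R := ⟨R, h⟩
  rw [shiftInverse, dif_pos hex]
  exact hex.choose_spec.eq h

variable (Ω) in
theorem exists_isShiftInverse_one : ∃ R, IsShiftInverse Ω 1 R := by
  have hb : ‖(1 : ℂ)‖ = 1 := norm_one
  choose u hu using exists_add_dirichletLaplacian_eq (Ω := Ω)
  have hu1 : ∀ f, (1 : ℂ) • (u f : L2 Ω) + dirichletLaplacian Ω (u f) = f := by simpa using hu
  have hinj : ∀ {v w : (dirichletLaplacian Ω).domain},
      (v : L2 Ω) + dirichletLaplacian Ω v = w + dirichletLaplacian Ω w → v = w := fun {v w} h =>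
    eq_of_shift_eq (b := 1) (ζ := 1) hb (by simp) (by simp) (by simpa using h)
  let R : L2 Ω →ₗ[ℂ] L2 Ω :=
    { toFun := fun f => u f
      map_add' := fun f g => by
        rw [← Submodule.coe_add]
        refine congrArg Subtype.val (hinj ?_)
        rw [hu, LinearPMap.map_add, Submodule.coe_add, add_add_add_comm, hu, hu]
      map_smul' := fun c f => by
        rw [RingHom.id_apply, ← Submodule.coe_smul]
        refine congrArg Subtype.val (hinj ?_)
        rw [hu, LinearPMap.map_smul, Submodule.coe_smul, ← smul_add, hu] }
  refine ⟨R.mkContinuous 1 fun f => ?_, isShiftInverse_of_rightInverse (b := 1) hb (by simp)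
    (by simp) fun f => ⟨(u f).2, hu1 f⟩⟩
  have := re_mul_norm_le_norm_add (b := 1) (ζ := 1) hb (by simp) (u f)
  rw [hu1] at this
  rw [one_mul]
  simpa using! this

theorem isShiftInverse_one : IsShiftInverse Ω 1 (shiftInverse Ω 1) := by
  obtain ⟨R, h⟩ := exists_isShiftInverse_one Ω
  rwa [h.shiftInverse_eq]

/-- With `u = (I + A)⁻¹ f` the pairing is `‖u‖² + ⟨u, A u⟩`. So `(I + A)⁻¹` is a nonnegative
contraction in the sense of forms, which places the numerical range of `1 + (ζ - 1) (I + A)⁻¹` on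
the segment from `1` to `ζ`. -/
theorem inner_shiftInverse_one (f : L2 Ω) : ∃ q : ℝ, 0 ≤ q ∧ q ≤ ‖f‖ ^ 2 ∧
    inner ℂ (shiftInverse Ω 1 f) f = (q : ℂ) := by
  obtain ⟨h, h1⟩ := isShiftInverse_one.1 f
  obtain ⟨q, hq, hqe⟩ := exists_inner_dirichletLaplacian ⟨_, h⟩
  have h2 : inner ℂ (shiftInverse Ω 1 f) f = ((‖shiftInverse Ω 1 f‖ ^ 2 + q : ℝ) : ℂ) := by
    nth_rw 2 [← h1]
    rw [one_smul, inner_add_right, hqe, inner_self_eq_norm_sq_to_K]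
    push_cast
    rfl
  refine ⟨_, by positivity, ?_, h2⟩
  have h3 := norm_inner_le_norm (𝕜 := ℂ) (shiftInverse Ω 1 f) f
  rw [h2, Complex.norm_real, Real.norm_of_nonneg (by positivity)] at h3
  have h4 := re_mul_norm_le_norm_add (b := 1) (ζ := 1) norm_one (by simp) ⟨_, h⟩
  rw [h1] at h4
  simp only [mul_one, Complex.one_re, one_mul] at h4
  nlinarith [norm_nonneg f]

-- Here `⟨f, (1 + (ζ - 1) (I + A)⁻¹) f⟩ = (‖f‖² - q) + ζ q` with `0 ≤ q ≤ ‖f‖²`. Since `b` rotates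
-- both `1` and `ζ` into the open right half-plane, the form is coercive with constant `min (Re b)
-- (Re (bζ))`, and coercive bounded operators are invertible.
variable (Ω) in
theorem isUnit_one_add_smul_shiftInverse {b ζ : ℂ} (hb : ‖b‖ = 1) (hb0 : 0 < b.re)
    (hζ : 0 < (b * ζ).re) : IsUnit (1 + (ζ - 1) • shiftInverse Ω 1) := by
  set m := min b.re (b * ζ).re with hm
  have hmpos : 0 < m := lt_min hb0 hζ
  refine ContinuousLinearMap.isUnit_of_forall_le_norm_inner_map _ (c := ⟨m, hmpos.le⟩) hmpos
    fun f => ?_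
  obtain ⟨q, hq0, hq1, hq⟩ := inner_shiftInverse_one f
  rw [← inner_conj_symm, RCLike.norm_conj]
  have e : inner ℂ f ((1 + (ζ - 1) • shiftInverse Ω 1) f) =
      (((‖f‖ ^ 2 - q : ℝ) : ℂ) + ζ * (q : ℂ)) := by
    rw [add_apply, smul_apply, inner_add_right,
      inner_smul_right, ← inner_conj_symm f (shiftInverse Ω 1 f), hq, Complex.conj_ofReal,
      one_apply_eq_self, inner_self_eq_norm_sq_to_K]
    push_cast
    simp only [Complex.coe_algebraMap]
    ring
  rw [e]
  have h3 := Complex.re_le_norm (b * (((‖f‖ ^ 2 - q : ℝ) : ℂ) + ζ * (q : ℂ)))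
  rw [norm_mul, hb, one_mul] at h3
  refine le_trans ?_ h3
  rw [mul_add, ← mul_assoc, Complex.add_re, Complex.re_mul_ofReal, Complex.re_mul_ofReal]
  have h1 : m ≤ b.re := min_le_left _ _
  have h2 : m ≤ (b * ζ).re := min_le_right _ _
  change ‖f‖ ^ 2 * m ≤ _
  nlinarith [mul_le_mul_of_nonneg_right h1 (sub_nonneg.2 hq1), mul_le_mul_of_nonneg_right h2 hq0]

/-- Formally `ζ I + A = (1 + (ζ - 1) (I + A)⁻¹) (I + A)`. This reaches the whole range of admissible
`ζ` from the single point `1`, with no continuation argument. -/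
theorem isShiftInverse_mul_inverse {b ζ : ℂ} (hb : ‖b‖ = 1) (hb0 : 0 < b.re)
    (hζ : 0 < (b * ζ).re) : IsShiftInverse Ω ζ
      (shiftInverse Ω 1 * Ring.inverse (1 + (ζ - 1) • shiftInverse Ω 1)) := by
  have hU := isUnit_one_add_smul_shiftInverse Ω hb hb0 hζ
  refine isShiftInverse_of_rightInverse hb hb0.le hζ fun f => ?_
  set g := Ring.inverse (1 + (ζ - 1) • shiftInverse Ω 1) f with hg
  obtain ⟨h1, h2⟩ := isShiftInverse_one.1 g
  refine ⟨h1, ?_⟩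
  have h3 : g + (ζ - 1) • shiftInverse Ω 1 g = f :=
    DFunLike.congr_fun (Ring.mul_inverse_cancel _ hU) f
  have h4 : dirichletLaplacian Ω ⟨shiftInverse Ω 1 g, h1⟩ = g - shiftInverse Ω 1 g := by
    rw [one_smul] at h2
    rw [eq_sub_iff_add_eq', h2]
  change ζ • shiftInverse Ω 1 g + dirichletLaplacian Ω ⟨shiftInverse Ω 1 g, h1⟩ = f
  rw [h4, ← h3, sub_smul, one_smul]
  abel

theorem isShiftInverse_shiftInverse {b ζ : ℂ} (hb : ‖b‖ = 1) (hb0 : 0 < b.re)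
    (hζ : 0 < (b * ζ).re) : IsShiftInverse Ω ζ (shiftInverse Ω ζ) := by
  have h := isShiftInverse_mul_inverse (Ω := Ω) hb hb0 hζ
  rwa [h.shiftInverse_eq]

theorem norm_shiftInverse_le {b ζ : ℂ} (hb : ‖b‖ = 1) (hb0 : 0 < b.re)
    (hζ : 0 < (b * ζ).re) : ‖shiftInverse Ω ζ‖ ≤ (b * ζ).re⁻¹ := by
  refine ContinuousLinearMap.opNorm_le_bound _ (by positivity) fun f => ?_
  obtain ⟨h1, h2⟩ := (isShiftInverse_shiftInverse (Ω := Ω) hb hb0 hζ).1 f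
  have h3 := re_mul_norm_le_norm_add (ζ := ζ) hb hb0.le ⟨_, h1⟩
  rw [h2] at h3
  rwa [inv_mul_eq_div, le_div_iff₀' hζ]

/-- The factorization holds with the same `b` for all parameters near `ζ`, and inversion in a Banach
algebra is holomorphic. -/
theorem differentiableAt_shiftInverse {b ζ : ℂ} (hb : ‖b‖ = 1) (hb0 : 0 < b.re)
    (hζ : 0 < (b * ζ).re) : DifferentiableAt ℂ (shiftInverse Ω) ζ := by
  have h1 : DifferentiableAt ℂ
      (fun ζ => shiftInverse Ω 1 * Ring.inverse (1 + (ζ - 1) • shiftInverse Ω 1)) ζ := by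
    have h2 := differentiableAt_inverse (𝕜 := ℂ) (isUnit_one_add_smul_shiftInverse Ω hb hb0 hζ)
    have h3 : DifferentiableAt ℂ (fun ζ : ℂ => 1 + (ζ - 1) • shiftInverse Ω 1) ζ := by fun_prop
    have h4 := DifferentiableAt.comp (f := fun ζ : ℂ => 1 + (ζ - 1) • shiftInverse Ω 1) ζ h2 h3
    exact (differentiableAt_const (c := shiftInverse Ω 1)).mul h4
  refine h1.congr_of_eventuallyEq ?_
  have hc : Continuous fun z : ℂ => (b * z).re := by fun_prop
  filter_upwards [hc.continuousAt.eventually (lt_mem_nhds hζ)] with z hz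
  exact (isShiftInverse_mul_inverse hb hb0 hz).shiftInverse_eq

/-- The domain of the Dirichlet Laplacian is dense in `L²(Ω)`. -/
theorem dense_domain : Dense ((dirichletLaplacian Ω).domain : Set (L2 Ω)) := by
  rw [Submodule.dense_iff_topologicalClosure_eq_top, Submodule.topologicalClosure_eq_top_iff,
    Submodule.eq_bot_iff]
  intro f hf
  obtain ⟨h, h1⟩ := isShiftInverse_one.1 f
  obtain ⟨q, hq, hqe⟩ := exists_inner_dirichletLaplacian ⟨_, h⟩
  -- If `f` is orthogonal to `D(A)`, pairing it with `u = (I + A)⁻¹ f` gives `‖u‖² + ⟨u, A u⟩ = 0`;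
  -- hence `u = 0` and `f = (I + A) u = 0`.
  have h2 := (Submodule.mem_orthogonal _ _).1 hf _ h
  nth_rw 2 [← h1] at h2
  rw [one_smul, inner_add_right, hqe, inner_self_eq_norm_sq_to_K] at h2
  have h3 : ‖shiftInverse Ω 1 f‖ ^ 2 + q = 0 := by
    have := congrArg Complex.re h2
    simpa [← Complex.ofReal_pow] using this
  have h4 : shiftInverse Ω 1 f = 0 := by
    rw [← norm_eq_zero, ← sq_eq_zero_iff]
    nlinarith [sq_nonneg ‖shiftInverse Ω 1 f‖]
  have h5 : (⟨_, h⟩ : (dirichletLaplacian Ω).domain) = 0 := Subtype.ext h4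
  rw [← h1, h5, LinearPMap.map_zero, h4, smul_zero, add_zero]

end Resolvent

/-! ### Cauchy's theorem on sectors and deformation of the contour `Γ_{θ,δ}`. -/

noncomputable section Contour

variable {X : Type*} [NormedAddCommGroup X] [NormedSpace ℂ X]

/-- Cauchy's theorem on the annular sector `r ≤ |z| ≤ R`, `a ≤ arg z ≤ b`; the bounds `a`, `b`
may differ by any amount. -/
theorem integral_boundary_annular_sector [CompleteSpace X] {F : ℂ → X} {r R a b : ℝ} (hr : 0 < r)
    (hrR : r ≤ R) (hab : a ≤ b) (hF : ∀ ρ ∈ Icc r R, ∀ ψ ∈ Icc a b,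
      DifferentiableAt ℂ F (ρ * Complex.exp (ψ * Complex.I))) :
    (∫ ρ in r..R, Complex.exp (a * Complex.I) • F (ρ * Complex.exp (a * Complex.I)))
      - (∫ ρ in r..R, Complex.exp (b * Complex.I) • F (ρ * Complex.exp (b * Complex.I)))
      + (∫ ψ in a..b, (Complex.I * R * Complex.exp (ψ * Complex.I)) •
          F (R * Complex.exp (ψ * Complex.I)))
      - (∫ ψ in a..b, (Complex.I * r * Complex.exp (ψ * Complex.I)) •
          F (r * Complex.exp (ψ * Complex.I))) = 0 := by
  have hR : 0 < R := hr.trans_le hrR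
  have hlog : Real.log r ≤ Real.log R := Real.log_le_log hr hrR
  -- The exponential maps the rectangle `[log r, log R] × [a, b]` onto the sector and supplies the
  -- factor `e^ζ`, so Cauchy's theorem on rectangles suffices. Injectivity plays no role.
  set G : ℂ → X := fun ζ => Complex.exp ζ • F (Complex.exp ζ) with hG
  have hexp : ∀ x y : ℝ, Complex.exp (x + y * Complex.I) =
      (Real.exp x : ℂ) * Complex.exp (y * Complex.I) := fun x y => by
    rw [Complex.exp_add, Complex.ofReal_exp]
  have hdiff : DifferentiableOn ℂ G
      (uIcc ((Real.log r : ℂ) + a * Complex.I).re ((Real.log R : ℂ) + b * Complex.I).re ×ℂ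
        uIcc ((Real.log r : ℂ) + a * Complex.I).im ((Real.log R : ℂ) + b * Complex.I).im) := by
    intro ζ hζ
    rw [Complex.mem_reProdIm] at hζ
    simp only [Complex.add_re, Complex.mul_re, Complex.ofReal_re, Complex.I_re, Complex.ofReal_im,
      Complex.I_im, Complex.add_im, Complex.mul_im, mul_zero, mul_one, zero_add, add_zero,
      sub_zero, uIcc_of_le hlog, uIcc_of_le hab] at hζ
    have e : Complex.exp ζ = (Real.exp ζ.re : ℂ) * Complex.exp (ζ.im * Complex.I) := by
      rw [← hexp, Complex.re_add_im]
    have h1 := hF (Real.exp ζ.re) ⟨(Real.log_le_iff_le_exp hr).1 hζ.1.1,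
      (Real.le_log_iff_exp_le hR).1 hζ.1.2⟩ ζ.im hζ.2
    rw [← e] at h1
    exact (Complex.differentiableAt_exp.smul
      (h1.comp ζ Complex.differentiableAt_exp)).differentiableWithinAt
  have key := Complex.integral_boundary_rect_eq_zero_of_differentiableOn G _ _ hdiff
  simp only [Complex.add_re, Complex.mul_re, Complex.ofReal_re, Complex.I_re, Complex.ofReal_im,
      Complex.I_im, Complex.add_im, Complex.mul_im, mul_zero, mul_one, zero_add, add_zero,
      sub_zero] at key
  have hray : ∀ c ∈ Icc a b, (∫ x in Real.log r..Real.log R, G (x + c * Complex.I)) =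
      ∫ ρ in r..R, Complex.exp (c * Complex.I) • F (ρ * Complex.exp (c * Complex.I)) := by
    intro c hc
    have hsub := intervalIntegral.integral_deriv_smul_comp' (a := Real.log r) (b := Real.log R)
      (f := Real.exp) (f' := Real.exp)
      (g := fun ρ : ℝ => Complex.exp (c * Complex.I) • F (ρ * Complex.exp (c * Complex.I)))
      (fun x _ => Real.hasDerivAt_exp x) Real.continuous_exp.continuousOn ?_
    · rw [Real.exp_log hr, Real.exp_log hR] at hsub
      rw [← hsub]
      refine intervalIntegral.integral_congr fun x _ => ?_
      simp only [hG, hexp, Function.comp, smul_smul, ← Complex.coe_smul]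
    · rintro _ ⟨x, hx, rfl⟩
      rw [uIcc_of_le hlog] at hx
      have h1 := hF (Real.exp x) ⟨(Real.log_le_iff_le_exp hr).1 hx.1,
        (Real.le_log_iff_exp_le hR).1 hx.2⟩ c hc
      have h2 : ContinuousAt (fun ρ : ℝ => F (ρ * Complex.exp (c * Complex.I))) (Real.exp x) :=
        ContinuousAt.comp (f := fun ρ : ℝ => (ρ : ℂ) * Complex.exp (c * Complex.I))
          h1.continuousAt (by fun_prop)
      exact (h2.const_smul _).continuousWithinAt
  have harc : ∀ s : ℝ, 0 < s → Complex.I • (∫ y in a..b, G (Real.log s + y * Complex.I)) =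
      ∫ ψ in a..b, (Complex.I * s * Complex.exp (ψ * Complex.I)) •
          F (s * Complex.exp (ψ * Complex.I)) := by
    intro s hs
    rw [← intervalIntegral.integral_smul]
    refine intervalIntegral.integral_congr fun y _ => ?_
    simp only [hG, hexp, Real.exp_log hs, smul_smul, mul_assoc]
  rw [hray a ⟨le_rfl, hab⟩, hray b ⟨hab, le_rfl⟩, harc r hr, harc R hR] at key
  exact key

/-- Cauchy's theorem on the unbounded sector `r ≤ |z|`, `a ≤ arg z ≤ b`. -/
theorem integral_ray_sub_integral_ray [CompleteSpace X] {F : ℂ → X} {r a b : ℝ} {g : ℝ → ℝ}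
    (hr : 0 < r) (hab : a ≤ b)
    (hF : ∀ ρ, r ≤ ρ → ∀ ψ ∈ Icc a b, DifferentiableAt ℂ F (ρ * Complex.exp (ψ * Complex.I)))
    (hg : ∀ᶠ ρ : ℝ in atTop, ∀ ψ ∈ Icc a b, ‖F (ρ * Complex.exp (ψ * Complex.I))‖ ≤ g ρ)
    (hlim : Tendsto (fun ρ => ρ * g ρ) atTop (𝓝 0))
    (ha : IntegrableOn (fun ρ : ℝ => F (ρ * Complex.exp (a * Complex.I))) (Ioi r))
    (hb : IntegrableOn (fun ρ : ℝ => F (ρ * Complex.exp (b * Complex.I))) (Ioi r)) :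
    (∫ ρ in Ioi r, Complex.exp (a * Complex.I) • F (ρ * Complex.exp (a * Complex.I)))
      - (∫ ρ in Ioi r, Complex.exp (b * Complex.I) • F (ρ * Complex.exp (b * Complex.I)))
      = ∫ ψ in a..b, (Complex.I * r * Complex.exp (ψ * Complex.I)) •
          F (r * Complex.exp (ψ * Complex.I)) := by
  have h1 := intervalIntegral_tendsto_integral_Ioi r
    (f := fun ρ : ℝ => Complex.exp (a * Complex.I) • F (ρ * Complex.exp (a * Complex.I)))
    (ha.smul _) tendsto_id
  have h2 := intervalIntegral_tendsto_integral_Ioi r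
    (f := fun ρ : ℝ => Complex.exp (b * Complex.I) • F (ρ * Complex.exp (b * Complex.I)))
    (hb.smul _) tendsto_id
  -- The outer arc has length `R |b - a|`, so `R g(R) → 0` is exactly what makes it disappear.
  have h3 : Tendsto (fun R : ℝ => ∫ ψ in a..b, (Complex.I * R * Complex.exp (ψ * Complex.I)) •
          F (R * Complex.exp (ψ * Complex.I))) atTop (𝓝 0) := by
    refine squeeze_zero_norm' (a := fun R => (R * g R) * |b - a|) ?_
      (by simpa using hlim.mul_const |b - a|)
    filter_upwards [eventually_ge_atTop r, hg] with R hR hgR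
    refine intervalIntegral.norm_integral_le_of_norm_le_const fun ψ hψ => ?_
    rw [uIoc_of_le hab] at hψ
    rw [norm_smul, norm_mul, norm_mul, Complex.norm_I, Complex.norm_exp_ofReal_mul_I, one_mul,
      mul_one, Complex.norm_real, Real.norm_of_nonneg (hr.le.trans hR)]
    exact mul_le_mul_of_nonneg_left (hgR ψ ⟨hψ.1.le, hψ.2⟩) (hr.le.trans hR)
  have h4 := (h1.sub h2).add h3
  rw [add_zero] at h4
  refine tendsto_nhds_unique h4 (tendsto_const_nhds.congr' ?_)
  filter_upwards [eventually_ge_atTop r] with R hR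
  exact (sub_eq_zero.1 (integral_boundary_annular_sector hr hR hab
    fun ρ hρ ψ hψ => hF ρ hρ.1 ψ hψ)).symm

theorem contourIntegral_eq (θ δ : ℝ) (F : ℂ → X) :
    contourIntegral θ δ F =
      (∫ ρ in Ioi δ, Complex.exp (θ * Complex.I) • F (ρ * Complex.exp (θ * Complex.I)))
      - (∫ ρ in Ioi δ, Complex.exp ((-θ : ℝ) * Complex.I) •
          F (ρ * Complex.exp ((-θ : ℝ) * Complex.I)))
      + ∫ ψ in (-θ)..θ, (Complex.I * δ * Complex.exp (ψ * Complex.I)) •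
        F (δ * Complex.exp (ψ * Complex.I)) := by
  rw [contourIntegral]
  push_cast
  simp only [neg_mul]

theorem continuousOn_arc {F : ℂ → X} {δ a b : ℝ} (hF : ∀ ψ ∈ Icc a b,
      DifferentiableAt ℂ F (δ * Complex.exp (ψ * Complex.I))) :
    ContinuousOn (fun ψ : ℝ => (Complex.I * δ * Complex.exp (ψ * Complex.I)) •
        F (δ * Complex.exp (ψ * Complex.I))) (Icc a b) := by
  intro ψ hψ
  have h2 : ContinuousAt (fun ψ : ℝ => F (δ * Complex.exp (ψ * Complex.I))) ψ :=
    ContinuousAt.comp (f := fun ψ : ℝ => (δ : ℂ) * Complex.exp (ψ * Complex.I))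
      (hF ψ hψ).continuousAt (by fun_prop)
  have h3 : ContinuousAt (fun ψ : ℝ => Complex.I * δ * Complex.exp (ψ * Complex.I)) ψ := by
    fun_prop
  exact (h3.smul h2).continuousWithinAt

/-- The two contours share their rays beyond `δ₂` and together bound the annular sector `δ₁ ≤ |z| ≤
δ₂`, `|arg z| ≤ θ`. -/
theorem contourIntegral_congr_radius [CompleteSpace X] {F : ℂ → X} {θ δ₁ δ₂ : ℝ} (hθ : 0 ≤ θ)
    (hδ₁ : 0 < δ₁) (hδ : δ₁ ≤ δ₂)
    (hF : ∀ ρ : ℝ, 0 < ρ → ∀ ψ ∈ Icc (-θ) θ, DifferentiableAt ℂ F (ρ * Complex.exp (ψ * Complex.I)))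
    (hint : ∀ ψ, |ψ| = θ →
      IntegrableOn (fun ρ : ℝ => F (ρ * Complex.exp (ψ * Complex.I))) (Ioi δ₁)) :
    contourIntegral θ δ₁ F = contourIntegral θ δ₂ F := by
  have key := integral_boundary_annular_sector (F := F) hδ₁ hδ (neg_le_self hθ)
    fun ρ hρ ψ hψ => hF ρ (hδ₁.trans_le hρ.1) ψ hψ
  have hsplit : ∀ ψ, |ψ| = θ →
      (∫ ρ in Ioi δ₁, Complex.exp (ψ * Complex.I) • F (ρ * Complex.exp (ψ * Complex.I))) =
      (∫ ρ in δ₁..δ₂, Complex.exp (ψ * Complex.I) • F (ρ * Complex.exp (ψ * Complex.I))) +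
      ∫ ρ in Ioi δ₂, Complex.exp (ψ * Complex.I) • F (ρ * Complex.exp (ψ * Complex.I)) := by
    intro ψ hψ
    exact (intervalIntegral.integral_interval_add_Ioi ((hint ψ hψ).smul _)
      (((hint ψ hψ).mono_set (Ioi_subset_Ioi hδ)).smul _)).symm
  rw [contourIntegral_eq, contourIntegral_eq, hsplit θ (abs_of_nonneg hθ),
    hsplit (-θ) (by rw [abs_neg, abs_of_nonneg hθ])]
  linear_combination (norm := module) (-1 : ℂ) • key

/-- The contours differ by the two unbounded sectors `θ₁ ≤ |ψ| ≤ θ₂`, and decay is required only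
there. The angle `θ₂ = π` is admitted, which matters for functions without a cut. -/
theorem contourIntegral_congr_angle [CompleteSpace X] {F : ℂ → X} {θ₁ θ₂ δ : ℝ} {g : ℝ → ℝ}
    (hθ₁ : 0 ≤ θ₁) (hθ : θ₁ ≤ θ₂) (hδ : 0 < δ)
    (hF : ∀ ρ, δ ≤ ρ → ∀ ψ ∈ Icc (-θ₂) θ₂,
      DifferentiableAt ℂ F (ρ * Complex.exp (ψ * Complex.I)))
    (hg : ∀ ρ, δ ≤ ρ → ∀ ψ, |ψ| ∈ Icc θ₁ θ₂ → ‖F (ρ * Complex.exp (ψ * Complex.I))‖ ≤ g ρ)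
    (hlim : Tendsto (fun ρ => ρ * g ρ) atTop (𝓝 0))
    (hint : ∀ ψ, |ψ| ∈ Icc θ₁ θ₂ →
      IntegrableOn (fun ρ : ℝ => F (ρ * Complex.exp (ψ * Complex.I))) (Ioi δ)) :
    contourIntegral θ₁ δ F = contourIntegral θ₂ δ F := by
  have habs : ∀ ψ ∈ Icc θ₁ θ₂, |ψ| ∈ Icc θ₁ θ₂ := fun ψ hψ => by
    rwa [abs_of_nonneg (hθ₁.trans hψ.1)]
  have habs' : ∀ ψ ∈ Icc (-θ₂) (-θ₁), |ψ| ∈ Icc θ₁ θ₂ := fun ψ hψ => by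
    rw [abs_of_nonpos (by linarith [hψ.2])]
    exact ⟨by linarith [hψ.2], by linarith [hψ.1]⟩
  have up := integral_ray_sub_integral_ray (F := F) hδ hθ
    (fun ρ hρ ψ hψ => hF ρ hρ ψ ⟨by linarith [hψ.1], hψ.2⟩)
    ((eventually_ge_atTop δ).mono fun ρ hρ ψ hψ => hg ρ hρ ψ (habs ψ hψ)) hlim
      (hint _ (habs _ ⟨le_rfl, hθ⟩))
    (hint _ (habs _ ⟨hθ, le_rfl⟩))
  have low := integral_ray_sub_integral_ray (F := F) hδ (neg_le_neg hθ)
    (fun ρ hρ ψ hψ => hF ρ hρ ψ ⟨hψ.1, by linarith [hψ.2]⟩)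
    ((eventually_ge_atTop δ).mono fun ρ hρ ψ hψ => hg ρ hρ ψ (habs' ψ hψ)) hlim
      (hint _ (habs' _ ⟨le_rfl, neg_le_neg hθ⟩))
    (hint _ (habs' _ ⟨neg_le_neg hθ, le_rfl⟩))
  have hc : ∀ a b, -θ₂ ≤ a → a ≤ b → b ≤ θ₂ → IntervalIntegrable
      (fun ψ : ℝ => (Complex.I * δ * Complex.exp (ψ * Complex.I)) •
        F (δ * Complex.exp (ψ * Complex.I))) volume a b := fun a b ha hab hb =>
    (continuousOn_arc fun ψ hψ => hF δ le_rfl ψ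
      ⟨ha.trans hψ.1, hψ.2.trans hb⟩).intervalIntegrable_of_Icc hab
  rw [contourIntegral_eq, contourIntegral_eq,
    ← intervalIntegral.integral_add_adjacent_intervals (a := -θ₂) (b := -θ₁) (c := θ₂)
      (hc _ _ le_rfl (by linarith) (by linarith)) (hc _ _ (by linarith) (by linarith) le_rfl),
    ← intervalIntegral.integral_add_adjacent_intervals (a := -θ₁) (b := θ₁) (c := θ₂)
      (hc _ _ (by linarith) (by linarith) (by linarith)) (hc _ _ (by linarith) hθ le_rfl),
    ← up, ← low]
  abel

/-- Decay faster than `1/ρ` in the whole sector `|ψ| ≤ θ` allows the contour to be closed to the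
right, where `F` is holomorphic. -/
theorem contourIntegral_eq_zero [CompleteSpace X] {F : ℂ → X} {θ δ : ℝ} {g : ℝ → ℝ}
    (hθ : 0 ≤ θ) (hδ : 0 < δ)
    (hF : ∀ ρ, δ ≤ ρ → ∀ ψ ∈ Icc (-θ) θ,
      DifferentiableAt ℂ F (ρ * Complex.exp (ψ * Complex.I)))
    (hg : ∀ᶠ ρ : ℝ in atTop, ∀ ψ ∈ Icc (-θ) θ, ‖F (ρ * Complex.exp (ψ * Complex.I))‖ ≤ g ρ)
    (hlim : Tendsto (fun ρ => ρ * g ρ) atTop (𝓝 0))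
    (hint : ∀ ψ, |ψ| = θ →
      IntegrableOn (fun ρ : ℝ => F (ρ * Complex.exp (ψ * Complex.I))) (Ioi δ)) :
    contourIntegral θ δ F = 0 := by
  rw [contourIntegral_eq, ← integral_ray_sub_integral_ray hδ (neg_le_self hθ) hF hg hlim
    (hint _ (by rw [abs_neg, abs_of_nonneg hθ])) (hint _ (abs_of_nonneg hθ))]
  abel

/-- A parametrization over `ℝ` of the contour `Γ_{θ,δ}`. -/
def contourPath (θ δ x : ℝ) : ℂ :=
  ((δ + max (|x| - θ) 0 : ℝ) : ℂ) * Complex.exp ((max (-θ) (min x θ) : ℝ) * Complex.I)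

/-- The derivative of `contourPath`. -/
def contourPathDeriv (θ δ x : ℝ) : ℂ :=
  if x ≤ -θ then -Complex.exp ((-θ : ℝ) * Complex.I) else
    if x ≤ θ then Complex.I * δ * Complex.exp (x * Complex.I) else Complex.exp (θ * Complex.I)

theorem integral_comp_add_right_Ioi {E : Type*} [NormedAddCommGroup E] [NormedSpace ℝ E]
    (f : ℝ → E) (a c : ℝ) : ∫ x in Ioi a, f (x + c) = ∫ x in Ioi (a + c), f x := by
  have h := (measurePreserving_add_right volume c).setIntegral_preimage_emb
    (measurableEmbedding_addRight c) f (Ioi (a + c))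
  rw [← h]
  congr 2
  ext x
  simp

/-- A single integral over `ℝ` replaces the three pieces, so differentiation under the integral and
Fubini's theorem are each applied once. The integrals over the rays match after shifts, and a
reflection on the lower ray. -/
theorem contourIntegral_eq_integral {F : ℂ → X} {θ δ : ℝ} (hθ : 0 ≤ θ)
    (hint : Integrable fun x => contourPathDeriv θ δ x • F (contourPath θ δ x)) :
    contourIntegral θ δ F = ∫ x, contourPathDeriv θ δ x • F (contourPath θ δ x) := by
  rw [contourIntegral_eq, ← intervalIntegral.integral_Iic_add_Ioi (b := -θ) hint.integrableOn
    hint.integrableOn, ← intervalIntegral.integral_interval_add_Ioi (a := -θ) (b := θ)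
    hint.integrableOn hint.integrableOn]
  have h1 : ∫ x in Iic (-θ), contourPathDeriv θ δ x • F (contourPath θ δ x) =
      -∫ ρ in Ioi δ, Complex.exp ((-θ : ℝ) * Complex.I) •
          F (ρ * Complex.exp ((-θ : ℝ) * Complex.I)) := by
    have h := integral_comp_neg_Iic (-θ) (fun x : ℝ => Complex.exp ((-θ : ℝ) * Complex.I) •
      F ((x + (δ - θ) : ℝ) * Complex.exp ((-θ : ℝ) * Complex.I)))
    rw [neg_neg, integral_comp_add_right_Ioi (fun x : ℝ => Complex.exp ((-θ : ℝ) * Complex.I) •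
      F (x * Complex.exp ((-θ : ℝ) * Complex.I))), add_sub_cancel] at h
    rw [← h, ← integral_neg]
    refine setIntegral_congr_fun measurableSet_Iic fun x hx => ?_
    have hx' : x ≤ -θ := hx
    simp only [contourPathDeriv, contourPath, if_pos hx', min_eq_left (hx'.trans (neg_le_self hθ)),
      max_eq_left hx', abs_of_nonpos (hx'.trans (neg_nonpos.2 hθ)),
      max_eq_left (show (0 : ℝ) ≤ -x - θ by linarith), neg_smul]
    rw [show δ + (-x - θ) = -x + (δ - θ) by ring]
  have h2 : ∫ x in (-θ)..θ, contourPathDeriv θ δ x • F (contourPath θ δ x) =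
      ∫ ψ in (-θ)..θ, (Complex.I * δ * Complex.exp (ψ * Complex.I)) •
        F (δ * Complex.exp (ψ * Complex.I)) := by
    rw [intervalIntegral.integral_of_le (neg_le_self hθ),
      intervalIntegral.integral_of_le (neg_le_self hθ)]
    refine setIntegral_congr_fun measurableSet_Ioc fun x hx => ?_
    simp only [contourPathDeriv, contourPath, if_neg (not_le.2 hx.1), if_pos hx.2,
      min_eq_left hx.2, max_eq_right hx.1.le,
      max_eq_right (sub_nonpos.2 (abs_le.2 ⟨hx.1.le, hx.2⟩)), add_zero]
  have h3 : ∫ x in Ioi θ, contourPathDeriv θ δ x • F (contourPath θ δ x) =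
      ∫ ρ in Ioi δ, Complex.exp (θ * Complex.I) • F (ρ * Complex.exp (θ * Complex.I)) := by
    have h := integral_comp_add_right_Ioi (fun x : ℝ => Complex.exp (θ * Complex.I) •
      F (x * Complex.exp (θ * Complex.I))) θ (δ - θ)
    rw [add_sub_cancel] at h
    rw [← h]
    refine setIntegral_congr_fun measurableSet_Ioi fun x hx => ?_
    have hx' : θ < x := hx
    simp only [contourPathDeriv, contourPath, if_neg (not_le.2 hx'),
      if_neg (not_le.2 ((neg_le_self hθ).trans_lt hx')), min_eq_right hx'.le,
      max_eq_right (neg_le_self hθ), abs_of_pos (hθ.trans_lt hx'),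
      max_eq_left (show (0 : ℝ) ≤ x - θ by linarith)]
    rw [show δ + (x - θ) = x + (δ - θ) by ring]
  rw [h1, h2, h3]
  abel

end Contour

/-! ### The inverse Laplace transform of functions of polynomial growth in sectors. -/

noncomputable section InverseLaplace

variable {X : Type*} [NormedAddCommGroup X] [NormedSpace ℂ X]

theorem arg_polar {ρ ψ : ℝ} (hρ : 0 < ρ) (hψ : |ψ| < π) :
    (ρ * Complex.exp (ψ * Complex.I)).arg = ψ := by
  rw [Complex.exp_mul_I]
  exact Complex.arg_mul_cos_add_sin_mul_I hρ ⟨(abs_lt.1 hψ).1, (abs_lt.1 hψ).2.le⟩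

theorem norm_polar {ρ : ℝ} (hρ : 0 ≤ ρ) (ψ : ℝ) : ‖(ρ * Complex.exp (ψ * Complex.I))‖ = ρ := by
  rw [norm_mul, Complex.norm_exp_ofReal_mul_I, mul_one, Complex.norm_real, Real.norm_of_nonneg hρ]

theorem re_polar (ρ ψ : ℝ) : (ρ * Complex.exp (ψ * Complex.I)).re = ρ * Real.cos ψ := by
  rw [Complex.re_ofReal_mul, Complex.exp_ofReal_mul_I_re]

theorem polar_mem_slitPlane {ρ ψ : ℝ} (hρ : 0 < ρ) (hψ : |ψ| < π) :
    (ρ * Complex.exp (ψ * Complex.I)) ∈ Complex.slitPlane := by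
  rw [Complex.mem_slitPlane_iff_arg, arg_polar hρ hψ]
  exact ⟨fun h => absurd (h ▸ le_abs_self ψ) (not_le.2 hψ),
    mul_ne_zero (Complex.ofReal_ne_zero.2 hρ.ne') (Complex.exp_ne_zero _)⟩

/-- Functions that are holomorphic off the negative real axis and of at most polynomial growth in
each sector, away from the origin. -/
structure IsSectorial (F : ℂ → X) : Prop where
  differentiableAt : ∀ z ∈ Complex.slitPlane, DifferentiableAt ℂ F z
  bound : ∀ θ δ : ℝ, 0 < θ → θ < π → 0 < δ → ∃ (C : ℝ) (k : ℕ), 0 ≤ C ∧ ∀ ρ ψ : ℝ, δ ≤ ρ → |ψ| ≤ θ →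
    ‖F (ρ * Complex.exp (ψ * Complex.I))‖ ≤ C * ρ ^ k

theorem IsSectorial.smul {f : ℂ → ℂ} {F : ℂ → X} (hf : IsSectorial f) (hF : IsSectorial F) :
    IsSectorial fun z => f z • F z := by
  refine ⟨fun z hz => (hf.1 z hz).smul (hF.1 z hz), fun θ δ hθ hθ' hδ => ?_⟩
  obtain ⟨C, k, hC, h⟩ := hf.2 θ δ hθ hθ' hδ
  obtain ⟨D, l, hD, h'⟩ := hF.2 θ δ hθ hθ' hδ
  refine ⟨C * D, k + l, by positivity, fun ρ ψ hρ hψ => ?_⟩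
  have hρ0 : 0 ≤ ρ := hδ.le.trans hρ
  rw [norm_smul, pow_add, mul_mul_mul_comm]
  exact mul_le_mul (h ρ ψ hρ hψ) (h' ρ ψ hρ hψ) (norm_nonneg _) (by positivity)

theorem IsSectorial.clm {Y : Type*} [NormedAddCommGroup Y] [NormedSpace ℂ Y] {F : ℂ → X}
    (hF : IsSectorial F) (L : X →L[ℂ] Y) : IsSectorial fun z => L (F z) := by
  refine ⟨fun z hz => L.differentiableAt.comp z (hF.1 z hz), fun θ δ hθ hθ' hδ => ?_⟩
  obtain ⟨D, l, hD, h'⟩ := hF.2 θ δ hθ hθ' hδ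
  refine ⟨‖L‖ * D, l, by positivity, fun ρ ψ hρ hψ => ?_⟩
  rw [mul_assoc]
  exact (L.le_opNorm _).trans (mul_le_mul_of_nonneg_left (h' ρ ψ hρ hψ) (norm_nonneg _))

theorem isSectorial_const (c : X) : IsSectorial fun _ => c :=
  ⟨fun _ _ => differentiableAt_const _, fun _ _ _ _ _ => ⟨‖c‖, 0, norm_nonneg _, by simp⟩⟩

theorem isSectorial_id : IsSectorial fun z => z :=
  ⟨fun _ _ => differentiableAt_id, fun _ _ _ _ hδ => ⟨1, 1, zero_le_one, fun ρ ψ hρ _ => by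
    rw [norm_polar (hδ.le.trans hρ), pow_one, one_mul]⟩⟩

theorem isSectorial_pow (m : ℕ) : IsSectorial fun z => z ^ m :=
  ⟨fun _ _ => differentiableAt_id.pow m, fun _ _ _ _ hδ => ⟨1, m, zero_le_one, fun ρ ψ hρ _ => by
    rw [norm_pow, norm_polar (hδ.le.trans hρ), one_mul]⟩⟩

theorem isSectorial_inv : IsSectorial fun z => z⁻¹ :=
  ⟨fun _ hz => differentiableAt_inv (Complex.slitPlane_ne_zero hz), fun _ δ _ _ hδ =>
    ⟨δ⁻¹, 0, by positivity, fun ρ ψ hρ _ => by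
      rw [norm_inv, norm_polar (hδ.le.trans hρ), pow_zero, mul_one]
      exact inv_anti₀ hδ hρ⟩⟩

theorem pow_mul_exp_neg_mul_le {a x : ℝ} (ha : 0 < a) (hx : 0 ≤ x) (k : ℕ) :
    x ^ k * Real.exp (-(a * x)) ≤ k.factorial / a ^ k := by
  have h := Real.pow_div_factorial_le_exp (a * x) (by positivity) k
  have hf : (0 : ℝ) < k.factorial := by exact_mod_cast k.factorial_pos
  rw [Real.exp_neg, ← div_eq_mul_inv, div_le_div_iff₀ (Real.exp_pos _) (by positivity),
    ← mul_pow, mul_comm x]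
  rw [div_le_iff₀ hf] at h
  linarith

theorem norm_exp_polar (ρ ψ t : ℝ) :
    ‖Complex.exp (ρ * Complex.exp (ψ * Complex.I) * t)‖ = Real.exp (ρ * Real.cos ψ * t) := by
  rw [Complex.norm_exp, Complex.re_mul_ofReal, re_polar]

/-- The modulus of `contourPath`. -/
def contourRadius (θ δ x : ℝ) : ℝ := δ + max (|x| - θ) 0

/-- The argument of `contourPath`. -/
def contourAngle (θ x : ℝ) : ℝ := max (-θ) (min x θ)

theorem contourPath_eq (θ δ x : ℝ) : contourPath θ δ x =
    contourRadius θ δ x * Complex.exp (contourAngle θ x * Complex.I) := rfl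

theorem le_contourRadius (θ δ x : ℝ) : δ ≤ contourRadius θ δ x :=
  le_add_of_nonneg_right (le_max_right _ _)

theorem abs_contourAngle_le {θ : ℝ} (hθ : 0 ≤ θ) (x : ℝ) : |contourAngle θ x| ≤ θ :=
  abs_le.2 ⟨le_max_left _ _, max_le (neg_le_self hθ) (min_le_right _ _)⟩

theorem norm_contourPath {θ δ : ℝ} (hδ : 0 < δ) (x : ℝ) :
    ‖contourPath θ δ x‖ = contourRadius θ δ x := by
  rw [contourPath_eq, norm_polar (hδ.le.trans (le_contourRadius θ δ x))]

theorem contourPath_mem_slitPlane {θ δ : ℝ} (hθ : 0 ≤ θ) (hθ' : θ < π) (hδ : 0 < δ) (x : ℝ) :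
    contourPath θ δ x ∈ Complex.slitPlane :=
  polar_mem_slitPlane (hδ.trans_le (le_contourRadius θ δ x))
    ((abs_contourAngle_le hθ x).trans_lt hθ')

theorem continuous_contourRadius (θ δ : ℝ) : Continuous (contourRadius θ δ) := by
  unfold contourRadius
  fun_prop

theorem continuous_contourPath (θ δ : ℝ) : Continuous (contourPath θ δ) := by
  unfold contourPath
  fun_prop

theorem measurable_contourPathDeriv (θ δ : ℝ) : Measurable (contourPathDeriv θ δ) := by
  unfold contourPathDeriv
  refine Measurable.ite measurableSet_Iic measurable_const (Measurable.ite measurableSet_Iic ?_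
    measurable_const)
  fun_prop

theorem norm_contourPathDeriv_le {θ δ : ℝ} (hδ : 0 < δ) (x : ℝ) :
    ‖contourPathDeriv θ δ x‖ ≤ 1 + δ := by
  unfold contourPathDeriv
  split_ifs
  · rw [norm_neg, Complex.norm_exp_ofReal_mul_I]
    linarith
  · rw [norm_mul, norm_mul, Complex.norm_exp_ofReal_mul_I, Complex.norm_I, Complex.norm_real,
      Real.norm_of_nonneg hδ.le]
    linarith
  · rw [Complex.norm_exp_ofReal_mul_I]
    linarith

/-- On the rays `Re z = R cos θ`. On the arc `Re z ≤ δ ≤ 2δ + δ cos θ`, so the slack `2δ` yields one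
bound for the whole contour. -/
theorem re_contourPath_le {θ δ : ℝ} (hθ : 0 ≤ θ) (hδ : 0 < δ) (x : ℝ) :
    (contourPath θ δ x).re ≤ 2 * δ + Real.cos θ * contourRadius θ δ x := by
  rw [contourPath_eq, re_polar]
  have h1 := Real.neg_one_le_cos θ
  have h2 := Real.cos_le_one (contourAngle θ x)
  rcases le_or_gt |x| θ with h | h
  · have : contourRadius θ δ x = δ := by
      rw [contourRadius, max_eq_right (sub_nonpos.2 h), add_zero]
    rw [this]
    nlinarith
  · have : Real.cos (contourAngle θ x) = Real.cos θ := by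
      rcases lt_abs.1 h with h | h
      · rw [contourAngle, min_eq_right h.le, max_eq_right (neg_le_self hθ)]
      · rw [contourAngle, min_eq_left (by linarith), max_eq_left (by linarith), Real.cos_neg]
    rw [this, mul_comm]
    linarith

theorem integrable_contourRadius_rpow {θ δ : ℝ} (hθ : 0 ≤ θ) (hδ : 0 < δ) :
    Integrable fun x => contourRadius θ δ x ^ (-(3 / 2) : ℝ) := by
  have h0 : 0 < 1 + θ + δ := by positivity
  -- This makes `c (1 + |x|) ≤ δ` on the arc and keeps `c (1 + |x|)` below the radius on the rays.
  -- The power `-3/2`, integrable at infinity, serves as the dominating function from here on.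
  set c := δ / (1 + θ + δ) with hc
  have hc0 : 0 < c := by positivity
  have h := (integrable_one_add_norm (E := ℝ) (μ := volume) (r := 3 / 2) (by norm_num)).const_mul
    (c ^ (-(3 / 2) : ℝ))
  refine h.mono' ((continuous_contourRadius θ δ).measurable.pow_const _).aestronglyMeasurable
    (Eventually.of_forall fun x => ?_)
  have hR : c * (1 + |x|) ≤ contourRadius θ δ x := by
    have h1 : (0 : ℝ) ≤ max (|x| - θ) 0 := le_max_right _ _
    have h2 : |x| - θ ≤ max (|x| - θ) 0 := le_max_left _ _
    rw [hc, div_mul_eq_mul_div, div_le_iff₀ h0, contourRadius]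
    nlinarith [mul_nonneg h1 hθ, mul_nonneg h1 hδ.le, mul_nonneg hδ.le hθ, abs_nonneg x,
      mul_nonneg hδ.le (abs_nonneg x)]
  have hp : 0 < c * (1 + |x|) := by positivity
  rw [Real.norm_of_nonneg (Real.rpow_nonneg (hp.le.trans hR) _), Real.norm_eq_abs,
    ← Real.mul_rpow hc0.le (by positivity)]
  exact Real.rpow_le_rpow_of_nonpos hp hR (by norm_num)

/-- Write `R^k = R^{k+2} R^{-1/2} R^{-3/2}`: the exponential absorbs `R^{k+2}`, and `R^{-1/2} ≤
δ^{-1/2}`. -/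
theorem exists_pow_mul_exp_le_rpow {a δ : ℝ} (ha : 0 < a) (hδ : 0 < δ) (k : ℕ) :
    ∃ C, 0 ≤ C ∧ ∀ R, δ ≤ R → R ^ k * Real.exp (-(a * R)) ≤ C * R ^ (-(3 / 2) : ℝ) := by
  refine ⟨(k + 2).factorial / a ^ (k + 2) * δ ^ (-(1 / 2) : ℝ), by positivity, fun R hR => ?_⟩
  have hR0 : 0 < R := hδ.trans_le hR
  have h1 := pow_mul_exp_neg_mul_le ha hR0.le (k + 2)
  have h2 : R ^ (-(1 / 2) : ℝ) ≤ δ ^ (-(1 / 2) : ℝ) :=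
    Real.rpow_le_rpow_of_nonpos hδ hR (by norm_num)
  have h3 : R ^ 2 * (R ^ (-(1 / 2) : ℝ) * R ^ (-(3 / 2) : ℝ)) = 1 := by
    rw [← Real.rpow_add hR0, ← Real.rpow_natCast, ← Real.rpow_add hR0]
    norm_num
  calc R ^ k * Real.exp (-(a * R)) =
        (R ^ (k + 2) * Real.exp (-(a * R))) * R ^ (-(1 / 2) : ℝ) * R ^ (-(3 / 2) : ℝ) := by
          linear_combination (-(R ^ k * Real.exp (-(a * R)))) * h3
    _ ≤ _ := by gcongr

/-- The integrand of the inverse Laplace transform along the parametrized contour. -/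
def contourIntegrand (θ δ : ℝ) (F : ℂ → X) (t x : ℝ) : X :=
  contourPathDeriv θ δ x • Complex.exp (contourPath θ δ x * t) • F (contourPath θ δ x)

theorem IsSectorial.continuous_comp_contourPath {F : ℂ → X} (hF : IsSectorial F) {θ δ : ℝ}
    (hθ : 0 ≤ θ) (hθ' : θ < π) (hδ : 0 < δ) : Continuous fun x => F (contourPath θ δ x) :=
  continuous_iff_continuousAt.2 fun x =>
    ContinuousAt.comp (f := contourPath θ δ)
      (hF.1 _ (contourPath_mem_slitPlane hθ hθ' hδ x)).continuousAt
      (continuous_contourPath θ δ).continuousAt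

theorem IsSectorial.aestronglyMeasurable_contourIntegrand {F : ℂ → X} (hF : IsSectorial F)
    {θ δ : ℝ} (hθ : 0 ≤ θ) (hθ' : θ < π) (hδ : 0 < δ) (t : ℝ) :
    AEStronglyMeasurable (contourIntegrand θ δ F t) := by
  refine (measurable_contourPathDeriv θ δ).aestronglyMeasurable.smul
    (AEStronglyMeasurable.smul ?_
      (hF.continuous_comp_contourPath hθ hθ' hδ).aestronglyMeasurable)
  have := continuous_contourPath θ δ
  exact Continuous.aestronglyMeasurable (by fun_prop)

/-- Since `cos θ < 0`, the exponential decays along the rays at the rate of the smallest time `t₀`.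
Uniformity on `[t₀, t₁]` is what differentiation in `t` needs. -/
theorem IsSectorial.norm_contourIntegrand_le {F : ℂ → X} (hF : IsSectorial F) {θ δ : ℝ}
    (hθ : π / 2 < θ) (hθ' : θ < π) (hδ : 0 < δ) {t₀ t₁ : ℝ} (ht₀ : 0 < t₀) :
    ∃ C, 0 ≤ C ∧ ∀ t ∈ Icc t₀ t₁, ∀ x,
      ‖contourIntegrand θ δ F t x‖ ≤ C * contourRadius θ δ x ^ (-(3 / 2) : ℝ) := by
  have hθ0 : 0 < θ := by linarith [Real.pi_pos]
  have hcos : Real.cos θ < 0 := Real.cos_neg_of_pi_div_two_lt_of_lt hθ (by linarith)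
  obtain ⟨C, k, hC, hb⟩ := hF.2 θ δ hθ0 hθ' hδ
  obtain ⟨D, hD, hd⟩ := exists_pow_mul_exp_le_rpow (a := -Real.cos θ * t₀) (δ := δ)
    (mul_pos (neg_pos.2 hcos) ht₀) hδ k
  refine ⟨(1 + δ) * Real.exp (2 * δ * t₁) * C * D, by positivity, fun t ht x => ?_⟩
  set R := contourRadius θ δ x with hR
  have hRδ : δ ≤ R := le_contourRadius θ δ x
  have h1 := norm_contourPathDeriv_le (θ := θ) hδ x
  have h2 : ‖Complex.exp (contourPath θ δ x * t)‖ ≤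
      Real.exp (2 * δ * t₁) * Real.exp (-(-Real.cos θ * t₀ * R)) := by
    rw [Complex.norm_exp, ← Real.exp_add, Complex.re_mul_ofReal]
    refine Real.exp_le_exp.2 ?_
    have h3 := mul_le_mul_of_nonneg_right (re_contourPath_le hθ0.le hδ (θ := θ) x)
      (ht₀.le.trans ht.1)
    have h4 : 0 ≤ (t - t₀) * (-Real.cos θ * R) :=
      mul_nonneg (sub_nonneg.2 ht.1) (mul_nonneg (neg_nonneg.2 hcos.le) (hδ.le.trans hRδ))
    have h5 : 2 * δ * t ≤ 2 * δ * t₁ := mul_le_mul_of_nonneg_left ht.2 (by positivity)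
    linarith
  have h3 : ‖F (contourPath θ δ x)‖ ≤ C * R ^ k :=
    hb _ _ hRδ (abs_contourAngle_le hθ0.le x)
  rw [contourIntegrand, norm_smul, norm_smul]
  calc _ ≤ (1 + δ) * ((Real.exp (2 * δ * t₁) * Real.exp (-(-Real.cos θ * t₀ * R))) *
        (C * R ^ k)) := by gcongr
    _ = (1 + δ) * Real.exp (2 * δ * t₁) * C * (R ^ k * Real.exp (-(-Real.cos θ * t₀ * R))) := by
        ring
    _ ≤ (1 + δ) * Real.exp (2 * δ * t₁) * C * (D * R ^ (-(3 / 2) : ℝ)) := by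
        exact mul_le_mul_of_nonneg_left (hd R hRδ) (by positivity)
    _ = _ := by ring

theorem IsSectorial.integrable_contourIntegrand {F : ℂ → X} (hF : IsSectorial F) {θ δ t : ℝ}
    (hθ : π / 2 < θ) (hθ' : θ < π) (hδ : 0 < δ) (ht : 0 < t) :
    Integrable (contourIntegrand θ δ F t) := by
  have hθ0 : 0 ≤ θ := by linarith [Real.pi_pos]
  obtain ⟨C, hC, h⟩ := hF.norm_contourIntegrand_le hθ hθ' hδ (t₁ := t) ht
  exact ((integrable_contourRadius_rpow hθ0 hδ).const_mul C).mono'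
    (hF.aestronglyMeasurable_contourIntegrand hθ0 hθ' hδ t)
    (Eventually.of_forall fun x => h t ⟨le_rfl, le_rfl⟩ x)

/-- The inverse Laplace transform of `F` along the contour `Γ_{θ,δ}`. -/
def laplaceInv (θ δ : ℝ) (F : ℂ → X) (t : ℝ) : X :=
  (2 * (π : ℂ) * Complex.I)⁻¹ • contourIntegral θ δ (fun z => Complex.exp (z * t) • F z)

theorem IsSectorial.laplaceInv_eq {F : ℂ → X} (hF : IsSectorial F) {θ δ t : ℝ}
    (hθ : π / 2 < θ) (hθ' : θ < π) (hδ : 0 < δ) (ht : 0 < t) :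
    laplaceInv θ δ F t = (2 * (π : ℂ) * Complex.I)⁻¹ • ∫ x, contourIntegrand θ δ F t x := by
  have hθ0 : 0 ≤ θ := by linarith [Real.pi_pos]
  rw [laplaceInv, contourIntegral_eq_integral hθ0 (hF.integrable_contourIntegrand hθ hθ' hδ ht)]
  rfl

/-- Differentiating `e^{zt}` produces the factor `z`, and `z F(z)` belongs to the same class, so the
step can be iterated indefinitely. -/
theorem IsSectorial.hasDerivAt_laplaceInv {F : ℂ → X} (hF : IsSectorial F) {θ δ t : ℝ}
    (hθ : π / 2 < θ) (hθ' : θ < π) (hδ : 0 < δ) (ht : 0 < t) :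
    HasDerivAt (laplaceInv θ δ F) (laplaceInv θ δ (fun z => z • F z) t) t := by
  have hθ0 : 0 ≤ θ := by linarith [Real.pi_pos]
  have hzF : IsSectorial fun z => z • F z := isSectorial_id.smul hF
  obtain ⟨C, hC, h⟩ := hzF.norm_contourIntegrand_le hθ hθ' hδ (t₀ := t / 2) (t₁ := 2 * t)
    (by positivity)
  have hnhds : Icc (t / 2) (2 * t) ∈ 𝓝 t := Icc_mem_nhds (by linarith) (by linarith)
  have key := (hasDerivAt_integral_of_dominated_loc_of_deriv_le (μ := volume)
    (F := contourIntegrand θ δ F) (F' := contourIntegrand θ δ fun z => z • F z) (x₀ := t)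
    hnhds
    (Eventually.of_forall fun s => hF.aestronglyMeasurable_contourIntegrand hθ0 hθ' hδ s)
    (hF.integrable_contourIntegrand hθ hθ' hδ ht)
    (hzF.aestronglyMeasurable_contourIntegrand hθ0 hθ' hδ t)
    (Eventually.of_forall fun x s hs => h s hs x)
    ((integrable_contourRadius_rpow hθ0 hδ).const_mul C)
    (Eventually.of_forall fun x s _ => ?_)).2
  · rw [hzF.laplaceInv_eq hθ hθ' hδ ht]
    refine (key.const_smul (2 * (π : ℂ) * Complex.I)⁻¹).congr_of_eventuallyEq ?_
    filter_upwards [lt_mem_nhds ht] with s hs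
    rw [hF.laplaceInv_eq hθ hθ' hδ hs]
    rfl
  · have h1 : HasDerivAt (fun s : ℝ => Complex.exp (contourPath θ δ x * s))
        (Complex.exp (contourPath θ δ x * s) * contourPath θ δ x) s := by
      have := ((Complex.ofRealCLM.hasDerivAt (x := s)).const_mul (contourPath θ δ x)).cexp
      simpa using this
    have h2 := (h1.smul_const (F (contourPath θ δ x))).const_smul (contourPathDeriv θ δ x)
    rw [mul_smul] at h2
    exact h2

theorem IsSectorial.iteratedDeriv_laplaceInv {F : ℂ → X} (hF : IsSectorial F) {θ δ t : ℝ}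
    (hθ : π / 2 < θ) (hθ' : θ < π) (hδ : 0 < δ) (ht : 0 < t) (m : ℕ) :
    iteratedDeriv m (laplaceInv θ δ F) t = laplaceInv θ δ (fun z => z ^ m • F z) t := by
  induction m generalizing F with
  | zero => simp
  | succ m ih =>
    rw [iteratedDeriv_succ']
    have : deriv (laplaceInv θ δ F) =ᶠ[𝓝 t] laplaceInv θ δ fun z => z • F z := by
      filter_upwards [lt_mem_nhds ht] with s hs
      exact (hF.hasDerivAt_laplaceInv hθ hθ' hδ hs).deriv
    rw [this.iteratedDeriv_eq, ih (isSectorial_id.smul hF)]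
    simp only [smul_smul, ← pow_succ]

theorem IsSectorial.contDiffOn_laplaceInv {F : ℂ → X} (hF : IsSectorial F) {θ δ : ℝ}
    (hθ : π / 2 < θ) (hθ' : θ < π) (hδ : 0 < δ) :
    ContDiffOn ℝ ∞ (laplaceInv θ δ F) (Ioi 0) := by
  refine contDiffOn_infty.2 fun n => ?_
  induction n generalizing F with
  | zero =>
    refine contDiffOn_zero.2 fun t ht => ?_
    exact (hF.hasDerivAt_laplaceInv hθ hθ' hδ ht).continuousAt.continuousWithinAt
  | succ n ih =>
    refine (contDiffOn_succ_iff_deriv_of_isOpen isOpen_Ioi).2 ⟨fun t ht =>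
      (hF.hasDerivAt_laplaceInv hθ hθ' hδ ht).differentiableAt.differentiableWithinAt,
      fun h => absurd h (by simp), (ih (isSectorial_id.smul hF)).congr fun t ht =>
      (hF.hasDerivAt_laplaceInv hθ hθ' hδ ht).deriv⟩

theorem IsSectorial.clm_laplaceInv {Y : Type*} [NormedAddCommGroup Y] [NormedSpace ℂ Y]
    [CompleteSpace X] [CompleteSpace Y] {F : ℂ → X} (hF : IsSectorial F) (L : X →L[ℂ] Y)
    {θ δ t : ℝ} (hθ : π / 2 < θ) (hθ' : θ < π) (hδ : 0 < δ) (ht : 0 < t) :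
    L (laplaceInv θ δ F t) = laplaceInv θ δ (fun z => L (F z)) t := by
  rw [hF.laplaceInv_eq hθ hθ' hδ ht, (hF.clm L).laplaceInv_eq hθ hθ' hδ ht, map_smul,
    ← L.integral_comp_comm (hF.integrable_contourIntegrand hθ hθ' hδ ht)]
  simp only [contourIntegrand, map_smul]

theorem IsSectorial.laplaceInv_sub {F G : ℂ → X} (hF : IsSectorial F) (hG : IsSectorial G)
    (hFG : IsSectorial fun z => F z - G z) {θ δ t : ℝ} (hθ : π / 2 < θ) (hθ' : θ < π)
    (hδ : 0 < δ) (ht : 0 < t) :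
    laplaceInv θ δ (fun z => F z - G z) t = laplaceInv θ δ F t - laplaceInv θ δ G t := by
  rw [hF.laplaceInv_eq hθ hθ' hδ ht, hG.laplaceInv_eq hθ hθ' hδ ht,
    hFG.laplaceInv_eq hθ hθ' hδ ht, ← smul_sub, ← integral_sub
    (hF.integrable_contourIntegrand hθ hθ' hδ ht) (hG.integrable_contourIntegrand hθ hθ' hδ ht)]
  simp only [contourIntegrand, smul_sub]

theorem laplaceInv_congr {F G : ℂ → X} {θ δ : ℝ} (hθ : 0 ≤ θ) (hθ' : θ < π) (hδ : 0 < δ)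
    (h : ∀ z ∈ Complex.slitPlane, F z = G z) : laplaceInv θ δ F = laplaceInv θ δ G := by
  have key : ∀ ρ : ℝ, δ ≤ ρ → ∀ ψ : ℝ, |ψ| ≤ θ → F (ρ * Complex.exp (ψ * Complex.I)) =
      G (ρ * Complex.exp (ψ * Complex.I)) := fun ρ hρ ψ hψ =>
    h _ (polar_mem_slitPlane (hδ.trans_le hρ) (hψ.trans_lt hθ'))
  funext t
  rw [laplaceInv, laplaceInv, contourIntegral_eq, contourIntegral_eq]
  congr 2
  · congr 1
    · refine setIntegral_congr_fun measurableSet_Ioi fun ρ hρ => ?_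
      simp only [key ρ (le_of_lt hρ) θ (abs_of_nonneg hθ).le]
    · refine setIntegral_congr_fun measurableSet_Ioi fun ρ hρ => ?_
      simp only [key ρ (le_of_lt hρ) (-θ) (by rw [abs_neg, abs_of_nonneg hθ])]
  · refine intervalIntegral.integral_congr fun ψ hψ => ?_
    rw [uIcc_of_le (neg_le_self hθ)] at hψ
    simp only [key δ le_rfl ψ (abs_le.2 hψ)]

end InverseLaplace

/-! ### Independence of the contour, and the estimate on the contour of radius `1/t`. -/

noncomputable section ContourIndependence

variable {X : Type*} [NormedAddCommGroup X] [NormedSpace ℂ X]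

theorem integrableOn_ray {F : ℂ → X} {C δ ψ : ℝ} (hδ : 0 < δ)
    (hF : ∀ ρ : ℝ, δ ≤ ρ → DifferentiableAt ℂ F (ρ * Complex.exp (ψ * Complex.I)))
    (hC : ∀ ρ : ℝ, δ ≤ ρ → ‖F (ρ * Complex.exp (ψ * Complex.I))‖ ≤ C * ρ ^ (-(3 / 2) : ℝ)) :
    IntegrableOn (fun ρ : ℝ => F (ρ * Complex.exp (ψ * Complex.I))) (Ioi δ) := by
  refine Integrable.mono' ((integrableOn_Ioi_rpow_of_lt (by norm_num : -(3 / 2 : ℝ) < -1)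
    hδ).const_mul C) (ContinuousOn.aestronglyMeasurable (fun ρ hρ => ?_) measurableSet_Ioi)
    ((ae_restrict_iff' measurableSet_Ioi).2 (Eventually.of_forall fun ρ hρ => hC ρ (le_of_lt hρ)))
  exact (ContinuousAt.comp (f := fun ρ : ℝ => (ρ : ℂ) * Complex.exp (ψ * Complex.I))
      (hF ρ (le_of_lt hρ)).continuousAt (by fun_prop)).continuousWithinAt

theorem tendsto_mul_const_mul_rpow (C : ℝ) :
    Tendsto (fun ρ : ℝ => ρ * (C * ρ ^ (-(3 / 2) : ℝ))) atTop (𝓝 0) := by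
  have h := (tendsto_rpow_neg_atTop (show (0 : ℝ) < 1 / 2 by norm_num)).const_mul C
  rw [mul_zero] at h
  refine h.congr' ?_
  filter_upwards [eventually_gt_atTop 0] with ρ hρ
  rw [show (-(1 / 2) : ℝ) = 1 + -(3 / 2) by norm_num, Real.rpow_add hρ, Real.rpow_one]
  ring

theorem exists_norm_exp_mul_pow_le {θ δ t : ℝ} (hθ : π / 2 < θ) (hδ : 0 < δ) (ht : 0 < t) (k : ℕ) :
    ∃ D, 0 ≤ D ∧ ∀ ρ ψ : ℝ, δ ≤ ρ → θ ≤ |ψ| → |ψ| ≤ π →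
      ‖Complex.exp (ρ * Complex.exp (ψ * Complex.I) * t)‖ * ρ ^ k ≤ D * ρ ^ (-(3 / 2) : ℝ) := by
  rcases le_or_gt θ π with hθ' | hθ'
  · have hcos : Real.cos θ < 0 := Real.cos_neg_of_pi_div_two_lt_of_lt hθ (by linarith [Real.pi_pos])
    obtain ⟨D, hD, hd⟩ := exists_pow_mul_exp_le_rpow (a := -Real.cos θ * t) (δ := δ)
      (mul_pos (neg_pos.2 hcos) ht) hδ k
    refine ⟨D, hD, fun ρ ψ hρ h1 h2 => le_trans ?_ (hd ρ hρ)⟩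
    have hρ0 := hδ.trans_le hρ
    rw [norm_exp_polar, mul_comm]
    refine mul_le_mul_of_nonneg_left (Real.exp_le_exp.2 ?_) (by positivity)
    have h3 : Real.cos ψ ≤ Real.cos θ := by
      rw [← Real.cos_abs ψ]
      exact Real.cos_le_cos_of_nonneg_of_le_pi (by linarith [Real.pi_pos]) h2 h1
    have := mul_le_mul_of_nonneg_left h3 (mul_pos hρ0 ht).le
    linarith
  -- For `θ > π` no `ψ` satisfies `θ ≤ |ψ| ≤ π`.
  · exact ⟨0, le_rfl, fun ρ ψ _ h1 h2 => absurd (h1.trans h2) (not_le.2 hθ')⟩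

theorem differentiableAt_exp_smul {F : ℂ → X} {z : ℂ} (t : ℝ) (h : DifferentiableAt ℂ F z) :
    DifferentiableAt ℂ (fun z => Complex.exp (z * t) • F z) z := by
  have : DifferentiableAt ℂ (fun z : ℂ => Complex.exp (z * t)) z := by fun_prop
  exact this.smul h

theorem IsSectorial.exists_norm_exp_smul_le {F : ℂ → X} (hF : IsSectorial F) {θ₁ θ₂ δ t : ℝ}
    (hθ₁ : π / 2 < θ₁) (hθ : θ₁ ≤ θ₂) (hθ₂ : θ₂ < π) (hδ : 0 < δ) (ht : 0 < t) :
    ∃ C, ∀ ρ : ℝ, δ ≤ ρ → ∀ ψ : ℝ, |ψ| ∈ Icc θ₁ θ₂ →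
      ‖Complex.exp (ρ * Complex.exp (ψ * Complex.I) * t) •
        F (ρ * Complex.exp (ψ * Complex.I))‖ ≤ C * ρ ^ (-(3 / 2) : ℝ) := by
  obtain ⟨C, k, hC, hb⟩ := hF.2 θ₂ δ (by linarith [Real.pi_pos]) hθ₂ hδ
  obtain ⟨D, hD, hd⟩ := exists_norm_exp_mul_pow_le hθ₁ hδ ht k
  refine ⟨C * D, fun ρ hρ ψ hψ => ?_⟩
  rw [norm_smul]
  calc _ ≤ _ * (C * ρ ^ k) := mul_le_mul_of_nonneg_left (hb ρ ψ hρ hψ.2) (norm_nonneg _)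
    _ = C * (_ * ρ ^ k) := by ring
    _ ≤ C * (D * ρ ^ (-(3 / 2) : ℝ)) :=
      mul_le_mul_of_nonneg_left (hd ρ ψ hρ hψ.1 (hψ.2.trans hθ₂.le)) hC
    _ = _ := by ring

theorem IsSectorial.laplaceInv_congr_contour [CompleteSpace X] {F : ℂ → X} (hF : IsSectorial F)
    {θ₁ θ₂ δ₁ δ₂ t : ℝ} (hθ₁ : π / 2 < θ₁) (hθ₁' : θ₁ < π) (hθ₂ : π / 2 < θ₂) (hθ₂' : θ₂ < π)
    (hδ₁ : 0 < δ₁) (hδ₂ : 0 < δ₂) (ht : 0 < t) :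
    laplaceInv θ₁ δ₁ F t = laplaceInv θ₂ δ₂ F t := by
  have hdiff : ∀ {ρ ψ : ℝ}, 0 < ρ → |ψ| < π → DifferentiableAt ℂ
      (fun z => Complex.exp (z * t) • F z) (ρ * Complex.exp (ψ * Complex.I)) := fun hρ hψ =>
    differentiableAt_exp_smul t (hF.1 _ (polar_mem_slitPlane hρ hψ))
  have hangle : ∀ {θ θ' δ : ℝ}, π / 2 < θ → θ ≤ θ' → θ' < π → 0 < δ →
      laplaceInv θ δ F t = laplaceInv θ' δ F t := by
    intro θ θ' δ h1 h2 h3 hδ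
    have h0 : 0 ≤ θ := by linarith [Real.pi_pos]
    obtain ⟨C, hC⟩ := hF.exists_norm_exp_smul_le h1 h2 h3 hδ ht
    rw [laplaceInv, laplaceInv, contourIntegral_congr_angle h0 h2 hδ
      (fun ρ hρ ψ hψ => hdiff (hδ.trans_le hρ) ((abs_le.2 hψ).trans_lt h3)) hC
      (tendsto_mul_const_mul_rpow C) fun ψ hψ => integrableOn_ray hδ
        (fun ρ hρ => hdiff (hδ.trans_le hρ) (hψ.2.trans_lt h3)) fun ρ hρ => hC ρ hρ ψ hψ]
  have hradius : ∀ {θ δ δ' : ℝ}, π / 2 < θ → θ < π → 0 < δ → δ ≤ δ' →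
      laplaceInv θ δ F t = laplaceInv θ δ' F t := by
    intro θ δ δ' h1 h2 hδ h3
    have h0 : 0 ≤ θ := by linarith [Real.pi_pos]
    obtain ⟨C, hC⟩ := hF.exists_norm_exp_smul_le h1 le_rfl h2 hδ ht
    rw [laplaceInv, laplaceInv, contourIntegral_congr_radius h0 hδ h3
      (fun ρ hρ ψ hψ => hdiff hρ ((abs_le.2 hψ).trans_lt h2))
      fun ψ hψ => integrableOn_ray hδ (fun ρ hρ => hdiff (hδ.trans_le hρ) (hψ ▸ h2))
        fun ρ hρ => hC ρ hρ ψ ⟨hψ.ge, hψ.le⟩]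
  have h1 : laplaceInv θ₁ δ₁ F t = laplaceInv θ₂ δ₁ F t := by
    rcases le_total θ₁ θ₂ with h | h
    · exact hangle hθ₁ h hθ₂' hδ₁
    · exact (hangle hθ₂ h hθ₁' hδ₁).symm
  rw [h1]
  rcases le_total δ₁ δ₂ with h | h
  · exact hradius hθ₂ hθ₂' hδ₁ h
  · exact (hradius hθ₂ hθ₂' hδ₂ h).symm

/-- The constant in the bound for inverse Laplace transforms. -/
def laplaceConst (k : ℕ) : ℝ :=
  2 * (∫ r in Ioi (1 : ℝ), r ^ k * Real.exp (-(1 / 2 * r))) + Real.exp 1 * (4 * π / 3)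

theorem laplaceConst_pos (k : ℕ) : 0 < laplaceConst k := by
  have h : 0 ≤ ∫ r in Ioi (1 : ℝ), r ^ k * Real.exp (-(1 / 2 * r)) :=
    setIntegral_nonneg measurableSet_Ioi fun r hr =>
      mul_nonneg (pow_nonneg (zero_le_one.trans (le_of_lt hr)) _) (Real.exp_pos _).le
  have := Real.pi_pos
  unfold laplaceConst
  positivity

theorem integrableOn_pow_mul_exp (k : ℕ) :
    IntegrableOn (fun r : ℝ => r ^ k * Real.exp (-(1 / 2 * r))) (Ioi 1) := by
  obtain ⟨C, hC, h⟩ := exists_pow_mul_exp_le_rpow (a := 1 / 2) (δ := 1) (by norm_num) one_pos k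
  refine Integrable.mono' ((integrableOn_Ioi_rpow_of_lt (by norm_num : -(3 / 2 : ℝ) < -1)
    one_pos).const_mul C) (Continuous.aestronglyMeasurable (by fun_prop))
    ((ae_restrict_iff' measurableSet_Ioi).2 (Eventually.of_forall fun ρ hρ => ?_))
  have h0 : (0 : ℝ) ≤ ρ := zero_le_one.trans (le_of_lt hρ)
  rw [Real.norm_of_nonneg (by positivity)]
  exact h ρ (le_of_lt hρ)

/-- The substitution `r = tρ` makes the contour independent of `t`: each ray contributes `t⁻¹ M ∫
r^k e^{-r/2} dr`, because `cos(2π/3) = -1/2`, and the arc contributes `t⁻¹ M` times `e` times its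
opening `4π/3`. The power `k` leaves room for the factor `z^k` of a `k`-th derivative. -/
theorem norm_laplaceInv_le {F : ℂ → X} {t M : ℝ} (ht : 0 < t) (k : ℕ)
    (hM : ∀ ρ ψ : ℝ, 1 ≤ t * ρ → |ψ| ≤ 2 * π / 3 →
      ‖F (ρ * Complex.exp (ψ * Complex.I))‖ ≤ M * (t * ρ) ^ k) :
    ‖laplaceInv (2 * π / 3) t⁻¹ F t‖ ≤ laplaceConst k * M / t := by
  have hπ := Real.pi_pos
  have hθ0 : 0 ≤ 2 * π / 3 := by positivity
  have hM0 : 0 ≤ M := by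
    have := hM t⁻¹ 0 (by rw [mul_inv_cancel₀ ht.ne']) (by simpa using hθ0)
    rw [mul_inv_cancel₀ ht.ne', one_pow, mul_one] at this
    exact (norm_nonneg _).trans this
  have hcos : Real.cos (2 * π / 3) = -(1 / 2) := by
    rw [show 2 * π / 3 = π - π / 3 by ring, Real.cos_pi_sub, Real.cos_pi_div_three]
  have hray : ∀ ψ : ℝ, |ψ| = 2 * π / 3 → ‖∫ ρ in Ioi t⁻¹, Complex.exp (ψ * Complex.I) •
      Complex.exp (ρ * Complex.exp (ψ * Complex.I) * t) • F (ρ * Complex.exp (ψ * Complex.I))‖ ≤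
      M * (t⁻¹ * ∫ r in Ioi (1 : ℝ), r ^ k * Real.exp (-(1 / 2 * r))) := by
    intro ψ hψ
    have hcosψ : Real.cos ψ = -(1 / 2) := by rw [← Real.cos_abs, hψ, hcos]
    have h1 := integral_comp_mul_left_Ioi (fun r : ℝ => r ^ k * Real.exp (-(1 / 2 * r))) t⁻¹ ht
    rw [mul_inv_cancel₀ ht.ne', smul_eq_mul] at h1
    have h2 : IntegrableOn (fun ρ : ℝ => (t * ρ) ^ k * Real.exp (-(1 / 2 * (t * ρ)))) (Ioi t⁻¹) := by
      refine (integrableOn_Ioi_comp_mul_left_iff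
        (fun r : ℝ => r ^ k * Real.exp (-(1 / 2 * r))) t⁻¹ ht).2 ?_
      rw [mul_inv_cancel₀ ht.ne']
      exact integrableOn_pow_mul_exp k
    rw [← h1, ← integral_const_mul]
    refine norm_integral_le_of_norm_le (h2.const_mul M)
      ((ae_restrict_iff' measurableSet_Ioi).2 (Eventually.of_forall fun ρ hρ => ?_))
    have hρ' : 1 ≤ t * ρ := by
      have := mul_le_mul_of_nonneg_left (le_of_lt hρ) ht.le
      rwa [mul_inv_cancel₀ ht.ne'] at this
    rw [norm_smul, norm_smul, Complex.norm_exp_ofReal_mul_I, one_mul, norm_exp_polar, hcosψ]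
    have h3 := mul_le_mul_of_nonneg_left (hM ρ ψ hρ' hψ.le)
      (Real.exp_pos (ρ * -(1 / 2) * t)).le
    refine h3.trans (le_of_eq ?_)
    rw [show ρ * -(1 / 2) * t = -(1 / 2 * (t * ρ)) by ring]
    ring
  have harc : ‖∫ ψ in (-(2 * π / 3))..(2 * π / 3),
      (Complex.I * (t⁻¹ : ℝ) * Complex.exp (ψ * Complex.I)) •
        Complex.exp ((t⁻¹ : ℝ) * Complex.exp (ψ * Complex.I) * t) •
          F ((t⁻¹ : ℝ) * Complex.exp (ψ * Complex.I))‖ ≤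
      M * (t⁻¹ * (Real.exp 1 * (4 * π / 3))) := by
    have h := intervalIntegral.norm_integral_le_of_norm_le_const (a := -(2 * π / 3))
      (b := 2 * π / 3) (C := t⁻¹ * Real.exp 1 * M)
      (f := fun ψ : ℝ => (Complex.I * (t⁻¹ : ℝ) * Complex.exp (ψ * Complex.I)) •
        Complex.exp ((t⁻¹ : ℝ) * Complex.exp (ψ * Complex.I) * t) •
          F ((t⁻¹ : ℝ) * Complex.exp (ψ * Complex.I))) ?_
    · refine h.trans (le_of_eq ?_)
      rw [sub_neg_eq_add, abs_of_nonneg (by positivity)]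
      ring
    · intro ψ hψ
      rw [uIoc_of_le (neg_le_self hθ0)] at hψ
      have h1 := hM t⁻¹ ψ (by rw [mul_inv_cancel₀ ht.ne']) (abs_le.2 ⟨hψ.1.le, hψ.2⟩)
      rw [mul_inv_cancel₀ ht.ne', one_pow, mul_one] at h1
      have h2 : t⁻¹ * Real.cos ψ * t ≤ 1 := by
        rw [mul_right_comm, inv_mul_cancel₀ ht.ne', one_mul]
        exact Real.cos_le_one ψ
      rw [norm_smul, norm_smul, norm_mul, norm_mul, Complex.norm_I, Complex.norm_exp_ofReal_mul_I,
        one_mul, mul_one, Complex.norm_real, Real.norm_of_nonneg (inv_pos.2 ht).le, norm_exp_polar,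
        mul_assoc t⁻¹ (Real.exp 1)]
      exact mul_le_mul_of_nonneg_left (mul_le_mul (Real.exp_le_exp.2 h2) h1 (norm_nonneg _)
        (Real.exp_pos _).le) (inv_pos.2 ht).le
  have hpi : ‖(2 * (π : ℂ) * Complex.I)⁻¹‖ ≤ 1 := by
    rw [norm_inv, norm_mul, norm_mul, Complex.norm_I, Complex.norm_real, Real.norm_of_nonneg hπ.le,
      mul_one]
    refine inv_le_one_of_one_le₀ ?_
    have := Real.pi_gt_three
    norm_num
    linarith
  rw [laplaceInv, contourIntegral_eq, norm_smul]
  refine (mul_le_of_le_one_left (norm_nonneg _) hpi).trans ?_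
  refine (norm_add_le _ _).trans ((add_le_add_left (norm_sub_le _ _) _).trans ?_)
  refine (add_le_add (add_le_add (hray _ (abs_of_nonneg hθ0))
    (hray _ (by rw [abs_neg, abs_of_nonneg hθ0]))) harc).trans (le_of_eq ?_)
  rw [laplaceConst]
  ring

/-- The function `1/z` has no cut, so the rays may be turned to the angles `±π`. There they coincide
and cancel, and the remaining circle is evaluated by Cauchy's integral formula. -/
theorem laplaceInv_inv_smul [CompleteSpace X] (v : X) {θ δ t : ℝ} (hθ : π / 2 < θ) (hθ' : θ < π)
    (hδ : 0 < δ) (ht : 0 < t) : laplaceInv θ δ (fun z => z⁻¹ • v) t = v := by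
  have hπ := Real.pi_pos
  have hθ0 : 0 ≤ θ := by linarith
  obtain ⟨D, hD, hd⟩ := exists_norm_exp_mul_pow_le hθ hδ ht 0
  have hne : ∀ {ρ ψ : ℝ}, δ ≤ ρ → (ρ * Complex.exp (ψ * Complex.I)) ≠ 0 := fun hρ =>
    mul_ne_zero (Complex.ofReal_ne_zero.2 (hδ.trans_le hρ).ne') (Complex.exp_ne_zero _)
  have hdiff : ∀ {ρ ψ : ℝ}, δ ≤ ρ → DifferentiableAt ℂ
      (fun z => Complex.exp (z * t) • z⁻¹ • v) (ρ * Complex.exp (ψ * Complex.I)) := fun hρ =>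
    differentiableAt_exp_smul t ((differentiableAt_inv (hne hρ)).smul_const v)
  have hC : ∀ ρ : ℝ, δ ≤ ρ → ∀ ψ : ℝ, |ψ| ∈ Icc θ π →
      ‖Complex.exp (ρ * Complex.exp (ψ * Complex.I) * t) •
        (ρ * Complex.exp (ψ * Complex.I))⁻¹ • v‖ ≤ (D * (δ⁻¹ * ‖v‖)) * ρ ^ (-(3 / 2) : ℝ) := by
    intro ρ hρ ψ hψ
    have h1 := hd ρ ψ hρ hψ.1 hψ.2
    rw [pow_zero, mul_one] at h1
    have hρ0 := hδ.trans_le hρ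
    rw [norm_smul, norm_smul, norm_inv, norm_polar hρ0.le, mul_right_comm D]
    refine mul_le_mul h1 ?_ (by positivity) ((norm_nonneg _).trans h1)
    exact mul_le_mul_of_nonneg_right (inv_anti₀ hδ hρ) (norm_nonneg _)
  rw [laplaceInv, contourIntegral_congr_angle hθ0 hθ'.le hδ (fun ρ hρ ψ _ => hdiff hρ) hC
      (tendsto_mul_const_mul_rpow _) fun ψ hψ => integrableOn_ray hδ
        (fun ρ hρ => hdiff hρ) fun ρ hρ => hC ρ hρ ψ hψ, contourIntegral]
  have e : Complex.exp (-(π * Complex.I)) = Complex.exp (π * Complex.I) := by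
    rw [Complex.exp_neg, Complex.exp_pi_mul_I]
    norm_num
  rw [e, sub_self, zero_add]
  have hcirc := Complex.circleIntegral_sub_center_inv_smul_of_differentiable_on_off_countable hδ
    (f := fun z : ℂ => Complex.exp (z * t) • v) (c := 0) countable_empty
    (by fun_prop) (fun z _ => by fun_prop)
  simp only [sub_zero, zero_mul, Complex.exp_zero, one_smul] at hcirc
  have hper : Function.Periodic (fun ψ : ℝ => (Complex.I * δ * Complex.exp (ψ * Complex.I)) •
      Complex.exp (δ * Complex.exp (ψ * Complex.I) * t) •
        (δ * Complex.exp (ψ * Complex.I))⁻¹ • v) (2 * π) := by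
    intro ψ
    have : Complex.exp ((ψ + 2 * π : ℝ) * Complex.I) = Complex.exp (ψ * Complex.I) := by
      push_cast
      rw [add_mul, Complex.exp_add, Complex.exp_two_pi_mul_I, mul_one]
    simp only [this]
  -- The contour runs over angles in `[-π, π]`, the circle integral over `[0, 2π]`; periodicity
  -- identifies them.
  have h2 := hper.intervalIntegral_add_eq (-π) 0
  rw [show -π + 2 * π = π by ring, zero_add] at h2
  rw [h2]
  have h3 : (∫ ψ in (0 : ℝ)..2 * π, (Complex.I * δ * Complex.exp (ψ * Complex.I)) •
      Complex.exp (δ * Complex.exp (ψ * Complex.I) * t) •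
        (δ * Complex.exp (ψ * Complex.I))⁻¹ • v) = (2 * (π : ℂ) * Complex.I) • v := by
    rw [← hcirc, circleIntegral]
    refine intervalIntegral.integral_congr fun ψ _ => ?_
    simp only [deriv_circleMap, circleMap, zero_add, smul_smul]
    congr 1
    ring
  rw [h3, smul_smul, inv_mul_cancel₀ Complex.two_pi_I_ne_zero, one_smul]

end ContourIndependence

/-! ### The Laplace transform of an inverse transform, and uniqueness. -/

noncomputable section LaplaceTransform

variable {X : Type*} [NormedAddCommGroup X] [NormedSpace ℂ X]

/-- With `δ = 1` the contour satisfies `Re z ≤ 2 + R cos θ`. Thus `Re p > 2` keeps `p` to its right,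
at a horizontal distance proportional to the radius. -/
theorem re_sub_contourPath_ge {θ : ℝ} (hθ : 0 ≤ θ) {p : ℂ} (hp : 2 < p.re) (x : ℝ) :
    -Real.cos θ * contourRadius θ 1 x ≤ p.re - (contourPath θ 1 x).re := by
  have := re_contourPath_le hθ one_pos x
  linarith

theorem exp_smul_contourIntegrand (θ : ℝ) (F : ℂ → X) (p : ℂ) (t x : ℝ) :
    Complex.exp (-p * t) • contourIntegrand θ 1 F t x =
      Complex.exp ((contourPath θ 1 x - p) * t) •
        (contourPathDeriv θ 1 x • F (contourPath θ 1 x)) := by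
  rw [contourIntegrand, smul_smul, smul_smul, smul_smul, sub_mul, sub_eq_add_neg, Complex.exp_add,
    neg_mul]
  congr 1
  ring

/-- The integral over `t` of the norm produces `1 / Re (p - z) ≲ 1/R`. Together with the assumed
decay `R^{-1/2}` of `F` this reaches the integrable power `R^{-3/2}`, so Fubini's theorem applies.
-/
theorem IsSectorial.integrable_prod {F : ℂ → X} (hF : IsSectorial F) {θ C : ℝ} (hθ : π / 2 < θ)
    (hθ' : θ < π) (hC : ∀ ρ ψ : ℝ, 1 ≤ ρ → |ψ| ≤ θ →
      ‖F (ρ * Complex.exp (ψ * Complex.I))‖ ≤ C * ρ ^ (-(1 / 2) : ℝ)) {p : ℂ} (hp : 2 < p.re) :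
    Integrable (Function.uncurry fun t x : ℝ =>
      Complex.exp (-p * t) • contourIntegrand θ 1 F t x)
      ((volume.restrict (Ioi 0)).prod volume) := by
  have hθ0 : 0 ≤ θ := by linarith [Real.pi_pos]
  have hcos : 0 < -Real.cos θ :=
    neg_pos.2 (Real.cos_neg_of_pi_div_two_lt_of_lt hθ (by linarith))
  have hR : ∀ x, 0 < contourRadius θ 1 x := fun x => one_pos.trans_le (le_contourRadius θ 1 x)
  have hs : ∀ x, 0 < p.re - (contourPath θ 1 x).re := fun x =>
    (mul_pos hcos (hR x)).trans_le (re_sub_contourPath_ge hθ0 hp x)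
  have hneg : ∀ x, (contourPath θ 1 x - p).re < 0 := fun x => by
    rw [Complex.sub_re]
    linarith [hs x]
  have hmeas : AEStronglyMeasurable (Function.uncurry fun t x : ℝ =>
      Complex.exp (-p * t) • contourIntegrand θ 1 F t x)
      ((volume.restrict (Ioi 0)).prod volume) := by
    have hc := continuous_contourPath θ 1
    have hc' := hF.continuous_comp_contourPath hθ0 hθ' one_pos
    refine AEStronglyMeasurable.smul (Continuous.aestronglyMeasurable (by fun_prop))
      (AEStronglyMeasurable.smul ((measurable_contourPathDeriv θ 1).comp
        measurable_snd).aestronglyMeasurable (AEStronglyMeasurable.smul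
        (Continuous.aestronglyMeasurable (by fun_prop)) ?_))
    exact (hc'.comp continuous_snd).aestronglyMeasurable
  refine (integrable_prod_iff' hmeas).2 ⟨Eventually.of_forall fun x => ?_, ?_⟩
  · simp only [Function.uncurry, exp_smul_contourIntegrand]
    exact (integrableOn_exp_mul_complex_Ioi (hneg x) 0).smul_const _
  · have hint : ∀ x, ∫ t in Ioi (0 : ℝ), ‖Function.uncurry (fun t x : ℝ =>
        Complex.exp (-p * t) • contourIntegrand θ 1 F t x) (t, x)‖ =
        (p.re - (contourPath θ 1 x).re)⁻¹ *
          ‖contourPathDeriv θ 1 x • F (contourPath θ 1 x)‖ := by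
      intro x
      simp only [Function.uncurry, exp_smul_contourIntegrand, norm_smul, Complex.norm_exp,
        Complex.re_mul_ofReal]
      rw [integral_mul_const, integral_exp_mul_Ioi (hneg x), mul_zero, Real.exp_zero,
        Complex.sub_re, neg_div, ← div_neg, neg_sub, one_div]
    simp only [hint]
    refine ((integrable_contourRadius_rpow hθ0 one_pos).const_mul
      ((-Real.cos θ)⁻¹ * ((1 + 1) * C))).mono' ?_ (Eventually.of_forall fun x => ?_)
    · refine AEStronglyMeasurable.mul ?_ (((measurable_contourPathDeriv θ 1).aestronglyMeasurable.smul
        (hF.continuous_comp_contourPath hθ0 hθ' one_pos).aestronglyMeasurable).norm)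
      have hc := continuous_contourPath θ 1
      exact (measurable_const.sub (Complex.measurable_re.comp hc.measurable)).inv.aestronglyMeasurable
    · rw [Real.norm_of_nonneg (mul_nonneg (inv_pos.2 (hs x)).le (norm_nonneg _)), norm_smul]
      have h1 := hC _ _ (le_contourRadius θ 1 x) (abs_contourAngle_le hθ0 x)
      have h2 := norm_contourPathDeriv_le (θ := θ) one_pos x
      have h3 : (p.re - (contourPath θ 1 x).re)⁻¹ ≤ (-Real.cos θ * contourRadius θ 1 x)⁻¹ :=
        inv_anti₀ (mul_pos hcos (hR x)) (re_sub_contourPath_ge hθ0 hp x)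
      have h4 : contourRadius θ 1 x ^ (-(3 / 2) : ℝ) =
          (contourRadius θ 1 x)⁻¹ * contourRadius θ 1 x ^ (-(1 / 2) : ℝ) := by
        rw [← Real.rpow_neg_one, ← Real.rpow_add (hR x)]
        norm_num
      calc _ ≤ (-Real.cos θ * contourRadius θ 1 x)⁻¹ *
            ((1 + 1) * (C * contourRadius θ 1 x ^ (-(1 / 2) : ℝ))) := by
            refine mul_le_mul h3 (mul_le_mul h2 h1 (norm_nonneg _) (by norm_num)) (by positivity)
              (inv_pos.2 (mul_pos hcos (hR x))).le
        _ = _ := by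
            rw [h4, mul_inv]
            ring

theorem integral_exp_smul_contourIntegrand [CompleteSpace X] (F : ℂ → X) {θ : ℝ}
    (hθ : π / 2 < θ) (hθ' : θ < π) {p : ℂ} (hp : 2 < p.re) (x : ℝ) :
    ∫ t in Ioi (0 : ℝ), Complex.exp (-p * t) • contourIntegrand θ 1 F t x =
      contourPathDeriv θ 1 x • (p - contourPath θ 1 x)⁻¹ • F (contourPath θ 1 x) := by
  have hθ0 : 0 ≤ θ := by linarith [Real.pi_pos]
  have hcos : 0 < -Real.cos θ :=
    neg_pos.2 (Real.cos_neg_of_pi_div_two_lt_of_lt hθ (by linarith))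
  have hneg : (contourPath θ 1 x - p).re < 0 := by
    have h1 := re_sub_contourPath_ge hθ0 hp x
    have h2 := mul_pos hcos (one_pos.trans_le (le_contourRadius θ 1 x))
    rw [Complex.sub_re]
    linarith
  simp only [exp_smul_contourIntegrand]
  rw [integral_smul_const, integral_exp_mul_complex_Ioi hneg, Complex.ofReal_zero, mul_zero,
    Complex.exp_zero, neg_div, ← div_neg, neg_sub, one_div, smul_comm]

theorem IsSectorial.integrable_div {F : ℂ → X} [CompleteSpace X] (hF : IsSectorial F) {θ C : ℝ}
    (hθ : π / 2 < θ) (hθ' : θ < π) (hC : ∀ ρ ψ : ℝ, 1 ≤ ρ → |ψ| ≤ θ →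
      ‖F (ρ * Complex.exp (ψ * Complex.I))‖ ≤ C * ρ ^ (-(1 / 2) : ℝ)) {p : ℂ} (hp : 2 < p.re) :
    Integrable fun x => contourPathDeriv θ 1 x • (p - contourPath θ 1 x)⁻¹ •
      F (contourPath θ 1 x) := by
  have h := (hF.integrable_prod hθ hθ' hC hp).integral_prod_right
  simpa only [Function.uncurry, integral_exp_smul_contourIntegrand F hθ hθ' hp] using h

theorem IsSectorial.integrableOn_exp_smul_laplaceInv {F : ℂ → X} (hF : IsSectorial F) {θ C : ℝ}
    (hθ : π / 2 < θ) (hθ' : θ < π) (hC : ∀ ρ ψ : ℝ, 1 ≤ ρ → |ψ| ≤ θ →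
      ‖F (ρ * Complex.exp (ψ * Complex.I))‖ ≤ C * ρ ^ (-(1 / 2) : ℝ)) {p : ℂ} (hp : 2 < p.re) :
    IntegrableOn (fun t : ℝ => Complex.exp (-p * t) • laplaceInv θ 1 F t) (Ioi 0) := by
  have h := (hF.integrable_prod hθ hθ' hC hp).integral_prod_left.smul (2 * (π : ℂ) * Complex.I)⁻¹
  refine IntegrableOn.congr_fun (f := _) h (fun t ht => ?_) measurableSet_Ioi
  rw [hF.laplaceInv_eq hθ hθ' one_pos ht]
  simp only [Function.uncurry, Pi.smul_apply, integral_smul, smul_comm (Complex.exp _)]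

theorem IsSectorial.integral_exp_smul_laplaceInv_eq [CompleteSpace X] {F : ℂ → X}
    (hF : IsSectorial F) {θ C : ℝ}
    (hθ : π / 2 < θ) (hθ' : θ < π) (hC : ∀ ρ ψ : ℝ, 1 ≤ ρ → |ψ| ≤ θ →
      ‖F (ρ * Complex.exp (ψ * Complex.I))‖ ≤ C * ρ ^ (-(1 / 2) : ℝ)) {p : ℂ} (hp : 2 < p.re) :
    ∫ t in Ioi (0 : ℝ), Complex.exp (-p * t) • laplaceInv θ 1 F t =
      (2 * (π : ℂ) * Complex.I)⁻¹ • ∫ x, contourPathDeriv θ 1 x •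
        (p - contourPath θ 1 x)⁻¹ • F (contourPath θ 1 x) := by
  have h := integral_integral_swap (hF.integrable_prod hθ hθ' hC hp)
  simp only [integral_exp_smul_contourIntegrand F hθ hθ' hp] at h
  rw [← h, ← integral_smul]
  refine setIntegral_congr_fun measurableSet_Ioi fun t ht => ?_
  rw [hF.laplaceInv_eq hθ hθ' one_pos ht, integral_smul, smul_comm]

/-- The Laplace transform inverts `laplaceInv`. -/
theorem IsSectorial.integral_exp_smul_laplaceInv [CompleteSpace X] {F : ℂ → X}
    (hF : IsSectorial F) {θ C : ℝ}
    (hθ : π / 2 < θ) (hθ' : θ < π) (hC : ∀ ρ ψ : ℝ, 1 ≤ ρ → |ψ| ≤ θ →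
      ‖F (ρ * Complex.exp (ψ * Complex.I))‖ ≤ C * ρ ^ (-(1 / 2) : ℝ)) {p : ℂ} (hp : 2 < p.re) :
    ∫ t in Ioi (0 : ℝ), Complex.exp (-p * t) • laplaceInv θ 1 F t = F p := by
  have hθ0 : 0 < θ := by linarith [Real.pi_pos]
  have hcos : 0 < -Real.cos θ :=
    neg_pos.2 (Real.cos_neg_of_pi_div_two_lt_of_lt hθ (by linarith))
  have hC0 : 0 ≤ C := by
    have := hC 1 0 le_rfl (by simpa using hθ0.le)
    rw [Real.one_rpow, mul_one] at this
    exact (norm_nonneg _).trans this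
  have hps : p ∈ Complex.slitPlane := Or.inl (by linarith)
  have hp0 : p ≠ 0 := Complex.slitPlane_ne_zero hps
  -- Fubini leaves the contour integral of `F(z) / (p - z)`. Comparing `F(z)` with `v / z`, which
  -- takes the same value at `p`, makes the difference quotient `Q` regular at `p`. Its contour
  -- integral vanishes, and for `v / z` the inverse transform is the constant `v`, whose Laplace
  -- transform is `v / p = F(p)`.
  set v := p • F p with hv
  have hG : IsSectorial fun z : ℂ => z⁻¹ • v := isSectorial_inv.smul (isSectorial_const v)
  have hGC : ∀ ρ ψ : ℝ, 1 ≤ ρ → |ψ| ≤ θ →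
      ‖(ρ * Complex.exp (ψ * Complex.I))⁻¹ • v‖ ≤ ‖v‖ * ρ ^ (-(1 / 2) : ℝ) := by
    intro ρ ψ hρ _
    have hρ0 := one_pos.trans_le hρ
    rw [norm_smul, norm_inv, norm_polar hρ0.le, mul_comm]
    refine mul_le_mul_of_nonneg_left ?_ (norm_nonneg _)
    rw [← Real.rpow_neg_one]
    exact Real.rpow_le_rpow_of_exponent_le hρ (by norm_num)
  -- the remainder is holomorphic in the sector
  set Q : ℂ → X := fun z => z⁻¹ • dslope (fun z => z • F z) p z with hQ
  have hQd : ∀ z ∈ Complex.slitPlane, DifferentiableAt ℂ Q z := by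
    intro z hz
    have h1 : DifferentiableOn ℂ (fun z => z • F z) Complex.slitPlane := fun z hz =>
      (differentiableAt_id.smul (hF.1 z hz)).differentiableWithinAt
    have h2 := (Complex.differentiableOn_dslope
      (Complex.isOpen_slitPlane.mem_nhds hps)).2 h1
    exact (differentiableAt_inv (Complex.slitPlane_ne_zero hz)).smul
      (h2.differentiableAt (Complex.isOpen_slitPlane.mem_nhds hz))
  have hQeq : ∀ z, z ≠ 0 → z ≠ p →
      Q z = (p - z)⁻¹ • z⁻¹ • v - (p - z)⁻¹ • F z := by
    intro z hz hzp
    simp only [hQ]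
    rw [dslope_of_ne _ hzp, slope_def_module, ← hv, ← neg_sub z p, inv_neg, neg_smul, neg_smul,
      smul_sub, smul_sub, smul_smul _ z, smul_comm z⁻¹ (z - p)⁻¹ v, smul_smul z⁻¹, mul_comm _ z,
      inv_mul_cancel_left₀ hz]
    abel
  -- Used with `c = 1/2` for large `ρ` throughout the sector, and with `c = -cos θ` on the two rays.
  have hQb : ∀ c ρ ψ : ℝ, 0 < c → 1 ≤ ρ → |ψ| ≤ θ →
      c * ρ ≤ ‖p - ρ * Complex.exp (ψ * Complex.I)‖ →
      ‖Q (ρ * Complex.exp (ψ * Complex.I))‖ ≤ (c⁻¹ * (‖v‖ + C)) * ρ ^ (-(3 / 2) : ℝ) := by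
    intro c ρ ψ hc hρ hψ hd
    have hρ0 := one_pos.trans_le hρ
    have hcρ : 0 < c * ρ := mul_pos hc hρ0
    rw [hQeq _ (Complex.slitPlane_ne_zero (polar_mem_slitPlane hρ0 (hψ.trans_lt hθ')))
      (fun h => by rw [h, sub_self, norm_zero] at hd; linarith), ← smul_sub, norm_smul, norm_inv]
    calc _ ≤ (c * ρ)⁻¹ * (‖v‖ * ρ ^ (-(1 / 2) : ℝ) + C * ρ ^ (-(1 / 2) : ℝ)) :=
          mul_le_mul (inv_anti₀ hcρ hd) ((norm_sub_le _ _).trans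
            (add_le_add (hGC ρ ψ hρ hψ) (hC ρ ψ hρ hψ))) (norm_nonneg _) (inv_pos.2 hcρ).le
      _ = _ := by
          rw [show (-(3 / 2) : ℝ) = -1 + -(1 / 2) by norm_num, Real.rpow_add hρ0,
            Real.rpow_neg_one, mul_inv]
          ring
  have hQ0 : contourIntegral θ 1 Q = 0 := by
    refine contourIntegral_eq_zero (g := fun ρ => ((1 / 2 : ℝ)⁻¹ * (‖v‖ + C)) * ρ ^ (-(3 / 2) : ℝ))
      hθ0.le one_pos (fun ρ hρ ψ hψ => hQd _ (polar_mem_slitPlane (one_pos.trans_le hρ)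
        ((abs_le.2 hψ).trans_lt hθ'))) ?_ (tendsto_mul_const_mul_rpow _) fun ψ hψ =>
      integrableOn_ray one_pos (fun ρ hρ => hQd _ (polar_mem_slitPlane (one_pos.trans_le hρ)
        (hψ ▸ hθ'))) fun ρ hρ => hQb (-Real.cos θ) ρ ψ hcos hρ hψ.le ?_
    · filter_upwards [eventually_ge_atTop 1, eventually_ge_atTop (2 * ‖p‖)] with ρ hρ hρp ψ hψ
      refine hQb _ ρ ψ (by norm_num) hρ (abs_le.2 hψ) ?_
      have h := norm_sub_norm_le ((ρ : ℂ) * Complex.exp (ψ * Complex.I)) p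
      rw [norm_polar (zero_le_one.trans hρ), norm_sub_rev] at h
      linarith
    · have h := Complex.re_le_norm (p - ρ * Complex.exp (ψ * Complex.I))
      rw [Complex.sub_re, re_polar, ← Real.cos_abs ψ, hψ] at h
      linarith
  have hne : ∀ x, contourPath θ 1 x ≠ p := by
    intro x h
    have h1 := re_sub_contourPath_ge hθ0.le hp x
    have h2 := mul_pos hcos (one_pos.trans_le (le_contourRadius θ 1 x))
    rw [h, sub_self] at h1
    linarith
  have hQx : ∀ x, contourPathDeriv θ 1 x • Q (contourPath θ 1 x) =
      contourPathDeriv θ 1 x • (p - contourPath θ 1 x)⁻¹ • (contourPath θ 1 x)⁻¹ • v -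
      contourPathDeriv θ 1 x • (p - contourPath θ 1 x)⁻¹ • F (contourPath θ 1 x) := fun x => by
    rw [hQeq _ (Complex.slitPlane_ne_zero (contourPath_mem_slitPlane hθ0.le hθ' one_pos x))
      (hne x), smul_sub]
  have hi1 := hG.integrable_div hθ hθ' hGC hp
  have hi2 := hF.integrable_div hθ hθ' hC hp
  have hz : ∫ x, contourPathDeriv θ 1 x • Q (contourPath θ 1 x) = 0 := by
    rw [← contourIntegral_eq_integral hθ0.le, hQ0]
    simp only [hQx]
    exact hi1.sub hi2
  simp only [hQx] at hz
  rw [integral_sub hi1 hi2, sub_eq_zero] at hz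
  rw [hF.integral_exp_smul_laplaceInv_eq hθ hθ' hC hp, ← hz,
    ← hG.integral_exp_smul_laplaceInv_eq hθ hθ' hGC hp]
  have hconst : ∫ t in Ioi (0 : ℝ), Complex.exp (-p * t) • laplaceInv θ 1 (fun z => z⁻¹ • v) t =
      ∫ t in Ioi (0 : ℝ), Complex.exp (-p * t) • v := by
    refine setIntegral_congr_fun measurableSet_Ioi fun t ht => ?_
    rw [laplaceInv_inv_smul v hθ hθ' one_pos ht]
  have hneg : (-p).re < 0 := by
    rw [Complex.neg_re]
    linarith
  rw [hconst, integral_smul_const, integral_exp_mul_complex_Ioi hneg, Complex.ofReal_zero,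
    mul_zero, Complex.exp_zero, hv, smul_smul, neg_div_neg_eq, one_div, inv_mul_cancel₀ hp0,
    one_smul]

/-- Functions with equal Laplace transforms on a vertical line agree where they are continuous. -/
theorem eq_of_laplace_eq [CompleteSpace X] {f g : ℝ → X} {σ : ℝ}
    (hf : ∀ p : ℂ, p.re = σ → IntegrableOn (fun t : ℝ => Complex.exp (-p * t) • f t) (Ioi 0))
    (hg : ∀ p : ℂ, p.re = σ → IntegrableOn (fun t : ℝ => Complex.exp (-p * t) • g t) (Ioi 0))
    (h : ∀ p : ℂ, p.re = σ → ∫ t in Ioi (0 : ℝ), Complex.exp (-p * t) • f t =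
      ∫ t in Ioi (0 : ℝ), Complex.exp (-p * t) • g t)
    {t : ℝ} (ht : 0 < t) (hft : ContinuousAt f t) (hgt : ContinuousAt g t) : f t = g t := by
  -- Extended by zero, the weighted difference has as its Fourier transform the difference of the
  -- Laplace transforms along `Re p = σ`. Fourier inversion recovers it at points of continuity.
  set k : ℝ → X := (Ioi 0).indicator fun t => Complex.exp (-(σ : ℂ) * t) • (f t - g t) with hk
  have hki : Integrable k := by
    refine (integrable_indicator_iff measurableSet_Ioi).2 ?_
    have := (hf σ (Complex.ofReal_re σ)).sub (hg σ (Complex.ofReal_re σ))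
    simp only [smul_sub]
    exact this
  have hFk : FourierTransform.fourier k = 0 := by
    funext w
    rw [Real.fourier_real_eq_integral_exp_smul, Pi.zero_apply]
    set p : ℂ := σ + 2 * π * w * Complex.I with hp
    have hpre : p.re = σ := by simp [hp]
    have e : ∀ v : ℝ, Complex.exp (((-2 * π * v * w : ℝ) : ℂ) * Complex.I) • k v =
        (Ioi 0).indicator (fun t : ℝ => Complex.exp (-p * t) • f t - Complex.exp (-p * t) • g t) v := by
      intro v
      by_cases hv : v ∈ Ioi (0 : ℝ)
      · rw [hk, indicator_of_mem hv, indicator_of_mem hv, smul_smul, ← Complex.exp_add, ← smul_sub]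
        congr 2
        rw [hp]
        push_cast
        ring
      · rw [hk, indicator_of_notMem hv, indicator_of_notMem hv, smul_zero]
    simp only [e]
    rw [integral_indicator measurableSet_Ioi, integral_sub (hf p hpre) (hg p hpre), h p hpre,
      sub_self]
  have hcont : ContinuousAt k t := by
    have h1 : ContinuousAt (fun t : ℝ => Complex.exp (-(σ : ℂ) * t) • (f t - g t)) t :=
      ContinuousAt.smul (by fun_prop) (hft.sub hgt)
    refine h1.congr ?_
    filter_upwards [lt_mem_nhds ht] with s hs
    rw [hk, indicator_of_mem (show s ∈ Ioi (0 : ℝ) from hs)]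
  have hinv := hki.fourierInv_fourier_eq (by rw [hFk]; exact integrable_zero _ _ _) hcont
  rw [hFk] at hinv
  have h0 : k t = 0 := by
    rw [← hinv, Real.fourierInv_eq]
    simp
  rw [hk, indicator_of_mem (show t ∈ Ioi (0 : ℝ) from ht)] at h0
  exact sub_eq_zero.1 ((smul_eq_zero.1 h0).resolve_left (Complex.exp_ne_zero _))

end LaplaceTransform

/-! ### Fractional integration as multiplication of the symbol by `z^{α-1}`. -/

noncomputable section FractionalIntegral

variable {X : Type*} [NormedAddCommGroup X] [NormedSpace ℂ X]

theorem integrableOn_rpow_mul_exp {s σ : ℝ} (hs : -1 < s) (hσ : 0 < σ) :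
    IntegrableOn (fun t : ℝ => t ^ s * Real.exp (-(σ * t))) (Ioi 0) := by
  have h := integrableOn_rpow_mul_exp_neg_mul_rpow hs one_pos hσ
  simpa only [Real.rpow_one, neg_mul] using h

theorem integrableOn_exp_mul_rpow {α : ℝ} (hα : α < 1) {p : ℂ} (hp : 0 < p.re) :
    IntegrableOn (fun t : ℝ => Complex.exp (-p * t) * ((t ^ (-α) : ℝ) : ℂ)) (Ioi 0) := by
  refine (integrableOn_rpow_mul_exp (s := -α) (by linarith) hp).mono' ?_
    ((ae_restrict_iff' measurableSet_Ioi).2 (Eventually.of_forall fun t ht => ?_))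
  · exact (by fun_prop : Measurable fun t : ℝ =>
      Complex.exp (-p * t) * ((t ^ (-α) : ℝ) : ℂ)).aestronglyMeasurable
  · rw [norm_mul, Complex.norm_exp, Complex.re_mul_ofReal, Complex.norm_real,
      Real.norm_of_nonneg (Real.rpow_nonneg (le_of_lt ht) _), mul_comm, Complex.neg_re, neg_mul]

/-- The Laplace transform of `t ^ (-α)` in the right half-plane. -/
theorem integral_exp_mul_rpow {α : ℝ} (hα : α < 1) {p : ℂ} (hp : 0 < p.re) :
    ∫ t in Ioi (0 : ℝ), Complex.exp (-p * t) * ((t ^ (-α) : ℝ) : ℂ) =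
      (Real.Gamma (1 - α) : ℂ) * p ^ ((α : ℂ) - 1) := by
  set U : Set ℂ := {z | 0 < z.re} with hU
  have hUo : IsOpen U := isOpen_lt continuous_const Complex.continuous_re
  have hUc : IsPreconnected U := (convex_halfSpace_re_gt 0).isPreconnected
  have hG : DifferentiableOn ℂ (fun p : ℂ => ∫ t in Ioi (0 : ℝ),
      Complex.exp (-p * t) * ((t ^ (-α) : ℝ) : ℂ)) U := by
    intro q hq
    have hq' : 0 < q.re := hq
    have hnhds : {z : ℂ | q.re / 2 < z.re} ∈ 𝓝 q :=
      (isOpen_lt continuous_const Complex.continuous_re).mem_nhds (by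
        change q.re / 2 < q.re
        linarith)
    refine (hasDerivAt_integral_of_dominated_loc_of_deriv_le
      (μ := volume.restrict (Ioi (0 : ℝ)))
      (F := fun (p : ℂ) (t : ℝ) => Complex.exp (-p * t) * ((t ^ (-α) : ℝ) : ℂ))
      (F' := fun (p : ℂ) (t : ℝ) => Complex.exp (-p * t) * (-t) * ((t ^ (-α) : ℝ) : ℂ))
      (bound := fun t => t ^ (1 - α) * Real.exp (-(q.re / 2 * t)))
      hnhds (Eventually.of_forall fun z => ?_) (integrableOn_exp_mul_rpow hα hq) ?_
      ((ae_restrict_iff' measurableSet_Ioi).2 (Eventually.of_forall fun t ht z hz => ?_))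
      (integrableOn_rpow_mul_exp (by linarith) (by linarith))
      (Eventually.of_forall fun t z _ => ?_)).2.differentiableAt.differentiableWithinAt
    · exact (by fun_prop : Measurable fun t : ℝ =>
        Complex.exp (-z * t) * ((t ^ (-α) : ℝ) : ℂ)).aestronglyMeasurable
    · exact (by fun_prop : Measurable fun t : ℝ =>
        Complex.exp (-q * t) * (-t) * ((t ^ (-α) : ℝ) : ℂ)).aestronglyMeasurable
    · have ht' : 0 < t := ht
      have hz' : q.re / 2 < z.re := hz
      rw [norm_mul, norm_mul, Complex.norm_exp, Complex.re_mul_ofReal, Complex.norm_real, norm_neg,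
        Complex.norm_real, Real.norm_of_nonneg (Real.rpow_nonneg ht'.le _),
        Real.norm_of_nonneg ht'.le, Complex.neg_re, sub_eq_add_neg, Real.rpow_add ht',
        Real.rpow_one, mul_assoc, mul_comm]
      refine mul_le_mul_of_nonneg_left (Real.exp_le_exp.2 ?_) (by positivity)
      nlinarith
    · have h1 : HasDerivAt (fun z : ℂ => -z * t) (-t : ℂ) z := by
        simpa using (hasDerivAt_id z).neg.mul_const (t : ℂ)
      exact h1.cexp.mul_const _
  have hR : DifferentiableOn ℂ (fun p : ℂ => (Real.Gamma (1 - α) : ℂ) * p ^ ((α : ℂ) - 1)) U := by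
    intro q hq
    have : DifferentiableAt ℂ (fun p : ℂ => p ^ ((α : ℂ) - 1)) q :=
      differentiableAt_id.cpow_const (Or.inl hq)
    exact (this.const_mul _).differentiableWithinAt
  have hreal : ∀ x : ℝ, 0 < x → ∫ t in Ioi (0 : ℝ), Complex.exp (-(x : ℂ) * t) *
      ((t ^ (-α) : ℝ) : ℂ) = (Real.Gamma (1 - α) : ℂ) * (x : ℂ) ^ ((α : ℂ) - 1) := by
    intro x hx
    have h := Real.integral_rpow_mul_exp_neg_mul_Ioi (a := 1 - α) (r := x) (by linarith) hx
    rw [one_div, Real.inv_rpow hx.le, ← Real.rpow_neg hx.le, mul_comm] at h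
    have h2 : (x : ℂ) ^ ((α : ℂ) - 1) = ((x ^ (-(1 - α)) : ℝ) : ℂ) := by
      rw [Complex.ofReal_cpow hx.le]
      push_cast
      ring_nf
    rw [h2, ← Complex.ofReal_mul, ← h, ← integral_complex_ofReal]
    refine setIntegral_congr_fun measurableSet_Ioi fun t _ => ?_
    simp only [sub_sub_cancel_left]
    push_cast
    rw [mul_comm, neg_mul]
  -- Both sides are holomorphic in the right half-plane and agree on the positive axis by the Gamma
  -- integral; these points accumulate at `1`.
  refine (hG.analyticOnNhd hUo).eqOn_of_preconnected_of_frequently_eq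
    (hR.analyticOnNhd hUo) hUc (z₀ := 1) (by simp [hU]) ?_ hp
  have htend : Tendsto (fun x : ℝ => (x : ℂ)) (𝓝[≠] 1) (𝓝[≠] 1) := by
    refine tendsto_nhdsWithin_iff.2 ⟨?_, ?_⟩
    · exact (Complex.continuous_ofReal.tendsto' 1 1 (by simp)).mono_left nhdsWithin_le_nhds
    · filter_upwards [self_mem_nhdsWithin] with x hx
      simpa using hx
  refine htend.frequently (Eventually.frequently ?_)
  filter_upwards [mem_nhdsWithin_of_mem_nhds (lt_mem_nhds (one_pos : (0 : ℝ) < 1))] with x hx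
  exact hreal x hx

/-- On each side of `t/2` only one of the two factors is singular. The power `s^{-1/2}` is a
convenient majorant of the logarithmic singularity of `S'(s) v` at `s = 0`. -/
theorem intervalIntegrable_sub_rpow_mul_rpow {α t : ℝ} (hα : α < 1) (hα0 : 0 ≤ α) (ht : 0 < t) :
    IntervalIntegrable (fun s : ℝ => (t - s) ^ (-α) * s ^ (-(1 / 2) : ℝ)) volume 0 t := by
  have h1 : IntervalIntegrable (fun s : ℝ => s ^ (-(1 / 2) : ℝ)) volume 0 t :=
    intervalIntegral.intervalIntegrable_rpow' (by norm_num)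
  have h2 : IntervalIntegrable (fun s : ℝ => (t - s) ^ (-α)) volume 0 t := by
    have := (intervalIntegral.intervalIntegrable_rpow' (r := -α) (a := 0) (b := t)
      (by linarith)).comp_sub_left t
    simpa using this.symm
  refine ((h2.const_mul ((t / 2) ^ (-(1 / 2) : ℝ))).add
    (h1.const_mul ((t / 2) ^ (-α)))).mono_fun' ?_ ?_
  · exact (by fun_prop : Measurable fun s : ℝ =>
      (t - s) ^ (-α) * s ^ (-(1 / 2) : ℝ)).aestronglyMeasurable
  · refine (ae_restrict_iff' measurableSet_uIoc).2 (Eventually.of_forall fun s hs => ?_)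
    rw [uIoc_of_le ht.le] at hs
    have h3 : 0 ≤ t - s := sub_nonneg.2 hs.2
    have h4 : 0 ≤ (t - s) ^ (-α) := Real.rpow_nonneg h3 _
    have h5 : 0 ≤ s ^ (-(1 / 2) : ℝ) := Real.rpow_nonneg hs.1.le _
    have h6 : 0 < t / 2 := by positivity
    simp only [Real.norm_of_nonneg (mul_nonneg h4 h5)]
    rcases le_total (t / 2) s with h | h
    · have := Real.rpow_le_rpow_of_nonpos h6 h (by norm_num : (-(1 / 2) : ℝ) ≤ 0)
      have := mul_le_mul_of_nonneg_left this h4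
      have := mul_nonneg (Real.rpow_nonneg h6.le (-α)) h5
      linarith
    · have := Real.rpow_le_rpow_of_nonpos h6 (show t / 2 ≤ t - s by linarith)
        (by linarith : -α ≤ 0)
      have := mul_le_mul_of_nonneg_right this h5
      have := mul_nonneg (Real.rpow_nonneg h6.le (-(1 / 2))) h4
      linarith

theorem intervalIntegrable_sub_rpow_smul {g : ℝ → X} (hg : ContinuousOn g (Ioi 0)) {α t C : ℝ}
    (hα : α < 1) (hα0 : 0 ≤ α) (ht : 0 < t)
    (hC : ∀ s, 0 < s → s ≤ t → ‖g s‖ ≤ C * s ^ (-(1 / 2) : ℝ)) :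
    IntervalIntegrable (fun s => (t - s) ^ (-α) • g s) volume 0 t := by
  refine ((intervalIntegrable_sub_rpow_mul_rpow hα hα0 ht).const_mul C).mono_fun' ?_ ?_
  · rw [uIoc_of_le ht.le]
    have h1 : AEStronglyMeasurable (fun s : ℝ => (t - s) ^ (-α)) (volume.restrict (Ioc 0 t)) :=
      (by fun_prop : Measurable fun s : ℝ => (t - s) ^ (-α)).aestronglyMeasurable
    exact h1.smul ((hg.mono Ioc_subset_Ioi_self).aestronglyMeasurable measurableSet_Ioc)
  · refine (ae_restrict_iff' measurableSet_uIoc).2 (Eventually.of_forall fun s hs => ?_)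
    rw [uIoc_of_le ht.le] at hs
    have h4 : 0 ≤ (t - s) ^ (-α) := Real.rpow_nonneg (sub_nonneg.2 hs.2) _
    simp only [norm_smul, Real.norm_of_nonneg h4]
    have := mul_le_mul_of_nonneg_left (hC s hs.1 hs.2) h4
    linarith

/-- The substitution `s = t r` fixes the interval, after which dominated convergence applies.
Continuity is needed because equality of Laplace transforms identifies functions only where they are
continuous. -/
theorem continuousAt_integral_sub_rpow_smul {g : ℝ → X} (hg : ContinuousOn g (Ioi 0)) {α t : ℝ}
    (hα : α < 1) (hα0 : 0 ≤ α) (ht : 0 < t)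
    (hC : ∀ T, 0 < T → ∃ C, ∀ s, 0 < s → s ≤ T → ‖g s‖ ≤ C * s ^ (-(1 / 2) : ℝ)) :
    ContinuousAt (fun t => ∫ s in (0 : ℝ)..t, (t - s) ^ (-α) • g s) t := by
  obtain ⟨C, hC⟩ := hC (2 * t) (by positivity)
  have hC0 : 0 ≤ C := by
    have h := (norm_nonneg _).trans (hC t ht (by linarith))
    exact nonneg_of_mul_nonneg_left h (Real.rpow_pos_of_pos ht _)
  have e : ∀ t : ℝ, ∫ s in (0 : ℝ)..t, (t - s) ^ (-α) • g s =
      t • ∫ r in (0 : ℝ)..1, (t - t * r) ^ (-α) • g (t * r) := by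
    intro t
    have := intervalIntegral.smul_integral_comp_mul_left (a := 0) (b := 1)
      (f := fun s => (t - s) ^ (-α) • g s) t
    rw [mul_zero, mul_one] at this
    exact this.symm
  simp only [e]
  refine continuousAt_id.smul ?_
  have hnear : ∀ᶠ x in 𝓝 t, t / 2 < x ∧ x < 2 * t :=
    (lt_mem_nhds (by linarith)).and (gt_mem_nhds (by linarith))
  have ht2 : 0 < t / 2 := by positivity
  have hIoo : ∀ᵐ r : ℝ, r ≠ 1 := by simp [ae_iff, measure_singleton]
  refine intervalIntegral.continuousAt_of_dominated_interval
    (bound := fun r => ((t / 2) ^ (-α) * (C * (t / 2) ^ (-(1 / 2) : ℝ))) *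
      ((1 - r) ^ (-α) * r ^ (-(1 / 2) : ℝ))) ?_ ?_
    ((intervalIntegrable_sub_rpow_mul_rpow hα hα0 one_pos).const_mul _) ?_
  · filter_upwards [hnear] with x hx
    have hx0 : 0 < x := ht2.trans hx.1
    rw [uIoc_of_le zero_le_one]
    have h1 : AEStronglyMeasurable (fun r : ℝ => (x - x * r) ^ (-α)) (volume.restrict (Ioc 0 1)) :=
      (by fun_prop : Measurable fun r : ℝ => (x - x * r) ^ (-α)).aestronglyMeasurable
    have h2 : ContinuousOn (fun r : ℝ => g (x * r)) (Ioc 0 1) :=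
      hg.comp (by fun_prop) fun r hr => mul_pos hx0 hr.1
    exact h1.smul (h2.aestronglyMeasurable measurableSet_Ioc)
  · filter_upwards [hnear] with x hx
    refine Eventually.of_forall fun r hr => ?_
    rw [uIoc_of_le zero_le_one] at hr
    have hx0 : 0 < x := ht2.trans hx.1
    have h1r : 0 ≤ 1 - r := sub_nonneg.2 hr.2
    have h1 : (x - x * r) ^ (-α) ≤ (t / 2) ^ (-α) * (1 - r) ^ (-α) := by
      rw [show x - x * r = x * (1 - r) by ring, Real.mul_rpow hx0.le h1r]
      exact mul_le_mul_of_nonneg_right (Real.rpow_le_rpow_of_nonpos ht2 hx.1.le (by linarith))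
        (Real.rpow_nonneg h1r _)
    have h2 : ‖g (x * r)‖ ≤ C * ((t / 2) ^ (-(1 / 2) : ℝ) * r ^ (-(1 / 2) : ℝ)) := by
      refine (hC _ (mul_pos hx0 hr.1) (by nlinarith [hr.1, hr.2])).trans ?_
      rw [Real.mul_rpow hx0.le hr.1.le]
      exact mul_le_mul_of_nonneg_left (mul_le_mul_of_nonneg_right
        (Real.rpow_le_rpow_of_nonpos ht2 hx.1.le (by norm_num)) (Real.rpow_nonneg hr.1.le _)) hC0
    have h3 : 0 ≤ x - x * r := by nlinarith
    rw [norm_smul, Real.norm_of_nonneg (Real.rpow_nonneg h3 _)]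
    refine (mul_le_mul h1 h2 (norm_nonneg _) (mul_nonneg (Real.rpow_nonneg ht2.le _)
      (Real.rpow_nonneg h1r _))).trans (le_of_eq (by ring))
  · filter_upwards [hIoo] with r hr1 hr
    rw [uIoc_of_le zero_le_one] at hr
    have hr' : r < 1 := lt_of_le_of_ne hr.2 hr1
    have h1 : ContinuousAt (fun x => (x - x * r) ^ (-α)) t :=
      ContinuousAt.rpow_const (by fun_prop) (Or.inl (by nlinarith))
    refine h1.smul ?_
    exact ContinuousAt.comp (f := fun x => x * r)
      (hg.continuousAt (Ioi_mem_nhds (mul_pos ht hr.1))) (by fun_prop)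

theorem norm_cpow_sub_one (α : ℝ) (z : ℂ) : ‖z ^ ((α : ℂ) - 1)‖ = ‖z‖ ^ (α - 1) := by
  rw [← Complex.norm_cpow_real]
  push_cast
  rfl

theorem isSectorial_cpow {α : ℝ} (hα : α ≤ 1) : IsSectorial fun z : ℂ => z ^ ((α : ℂ) - 1) := by
  refine ⟨fun z hz => differentiableAt_id.cpow_const hz, fun θ δ _ _ hδ =>
    ⟨δ ^ (α - 1), 0, by positivity, fun ρ ψ hρ _ => ?_⟩⟩
  rw [norm_cpow_sub_one, norm_polar (hδ.le.trans hρ), pow_zero, mul_one]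
  exact Real.rpow_le_rpow_of_nonpos hδ hρ (by linarith)

/-- Fractional integration of an inverse Laplace transform. -/
theorem IsSectorial.integral_sub_rpow_smul_laplaceInv [CompleteSpace X] {F : ℂ → X}
    (hF : IsSectorial F) {θ C : ℝ}
    (hθ : π / 2 < θ) (hθ' : θ < π) (hC : ∀ ρ ψ : ℝ, 1 ≤ ρ → |ψ| ≤ θ →
      ‖F (ρ * Complex.exp (ψ * Complex.I))‖ ≤ C * ρ ^ (-(1 / 2) : ℝ))
    (hbd : ∀ T, 0 < T → ∃ D, ∀ s, 0 < s → s ≤ T →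
      ‖laplaceInv θ 1 F s‖ ≤ D * s ^ (-(1 / 2) : ℝ)) {α t : ℝ} (hα0 : 0 ≤ α) (hα : α < 1)
    (ht : 0 < t) :
    ∫ s in (0 : ℝ)..t, (t - s) ^ (-α) • laplaceInv θ 1 F s =
      Real.Gamma (1 - α) • laplaceInv θ 1 (fun z => z ^ ((α : ℂ) - 1) • F z) t := by
  have hG : IsSectorial fun z : ℂ => z ^ ((α : ℂ) - 1) • F z := (isSectorial_cpow hα.le).smul hF
  have hGC : ∀ ρ ψ : ℝ, 1 ≤ ρ → |ψ| ≤ θ →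
      ‖(ρ * Complex.exp (ψ * Complex.I)) ^ ((α : ℂ) - 1) • F (ρ * Complex.exp (ψ * Complex.I))‖ ≤
        C * ρ ^ (-(1 / 2) : ℝ) := by
    intro ρ ψ hρ hψ
    rw [norm_smul, norm_cpow_sub_one, norm_polar (zero_le_one.trans hρ)]
    refine (mul_le_of_le_one_left (norm_nonneg _) ?_).trans (hC ρ ψ hρ hψ)
    exact Real.rpow_le_one_of_one_le_of_nonpos hρ (by linarith)
  have hcont : ContinuousOn (laplaceInv θ 1 F) (Ioi 0) := fun s hs =>
    (hF.hasDerivAt_laplaceInv hθ hθ' one_pos hs).continuousAt.continuousWithinAt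
  let L : X →L[ℝ] ℂ →L[ℝ] X := (ContinuousLinearMap.lsmul ℝ ℂ).flip
  -- Since `e^{-px} = e^{-ps} e^{-p(x-s)}`, the weighted fractional integral is the convolution of
  -- the two weighted functions, and its integral is the product of their integrals.
  have hconv : ∀ (p : ℂ) (x : ℝ), ∫ s in (0 : ℝ)..x, L (Complex.exp (-p * s) • laplaceInv θ 1 F s)
      (Complex.exp (-p * (x - s : ℝ)) * (((x - s) ^ (-α) : ℝ) : ℂ)) =
      Complex.exp (-p * x) • ∫ s in (0 : ℝ)..x, (x - s) ^ (-α) • laplaceInv θ 1 F s := by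
    intro p x
    rw [← intervalIntegral.integral_smul]
    refine intervalIntegral.integral_congr fun s _ => ?_
    change (Complex.exp (-p * (x - s : ℝ)) * (((x - s) ^ (-α) : ℝ) : ℂ)) •
      (Complex.exp (-p * s) • laplaceInv θ 1 F s) = _
    simp only [← Complex.coe_smul (((x - s) ^ (-α) : ℝ)), smul_smul]
    rw [mul_right_comm, ← Complex.exp_add]
    congr 3
    push_cast
    ring
  have hint : ∀ p : ℂ, 2 < p.re → IntegrableOn (fun t : ℝ => Complex.exp (-p * t) •
      ∫ s in (0 : ℝ)..t, (t - s) ^ (-α) • laplaceInv θ 1 F s) (Ioi 0) := by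
    intro p hp
    have h := integrable_posConvolution (hF.integrableOn_exp_smul_laplaceInv hθ hθ' hC hp)
      (integrableOn_exp_mul_rpow hα (by linarith : 0 < p.re)) L
    refine IntegrableOn.congr_fun h.integrableOn (fun t ht => ?_) measurableSet_Ioi
    rw [posConvolution, indicator_of_mem ht]
    exact hconv p t
  -- Any abscissa above `2` would do. Both Laplace transforms equal `Γ(1-α) p^{α-1} F(p)`.
  refine eq_of_laplace_eq (σ := 3) (fun p hp => hint p (by linarith)) (fun p hp => ?_)
    (fun p hp => ?_) ht (continuousAt_integral_sub_rpow_smul hcont hα hα0 ht hbd)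
    ((hG.hasDerivAt_laplaceInv hθ hθ' one_pos ht).continuousAt.const_smul (Real.Gamma (1 - α)))
  · have := (hG.integrableOn_exp_smul_laplaceInv hθ hθ' hGC
      (by linarith : 2 < p.re)).smul (Real.Gamma (1 - α))
    refine IntegrableOn.congr_fun (f := _) this (fun t _ => ?_) measurableSet_Ioi
    exact smul_comm _ _ _
  · have h := integral_posConvolution (hF.integrableOn_exp_smul_laplaceInv hθ hθ' hC
      (by linarith : 2 < p.re)) (integrableOn_exp_mul_rpow hα (by linarith : 0 < p.re)) L
    rw [hF.integral_exp_smul_laplaceInv hθ hθ' hC (by linarith : 2 < p.re),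
      integral_exp_mul_rpow hα (by linarith : 0 < p.re)] at h
    simp only [hconv] at h
    rw [h]
    change _ = ∫ t in Ioi (0 : ℝ), Complex.exp (-p * t) • (Real.Gamma (1 - α) •
      laplaceInv θ 1 (fun z => z ^ ((α : ℂ) - 1) • F z) t)
    rw [setIntegral_congr_fun measurableSet_Ioi (g := fun t : ℝ => Real.Gamma (1 - α) •
      (Complex.exp (-p * t) • laplaceInv θ 1 (fun z => z ^ ((α : ℂ) - 1) • F z) t))
      (fun t _ => smul_comm _ _ _), integral_smul,
      hG.integral_exp_smul_laplaceInv hθ hθ' hGC (by linarith : 2 < p.re),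
      ← Complex.coe_smul, smul_smul]
    rfl

end FractionalIntegral

/-! ### Upper and lower bounds for the distributed-order kernel `w`. -/

noncomputable section DistributedOrderKernel

variable {μ : ℝ → ℝ}

theorem exists_bound_Icc (hμc : ContinuousOn μ (Icc 0 1)) :
    ∃ M, 0 ≤ M ∧ ∀ α ∈ Icc (0 : ℝ) 1, |μ α| ≤ M := by
  obtain ⟨M, hM⟩ := isCompact_Icc.exists_bound_of_continuousOn hμc
  exact ⟨M, (abs_nonneg _).trans (hM 0 (by simp)), hM⟩

theorem intervalIntegrable_rpow_mul (hμc : ContinuousOn μ (Icc 0 1)) {ρ : ℝ} (hρ : 0 < ρ)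
    (a : ℝ) : IntervalIntegrable (fun α => ρ ^ (α + a) * μ α) volume 0 1 :=
  ContinuousOn.intervalIntegrable_of_Icc zero_le_one
    ((Continuous.rpow continuous_const (by fun_prop) fun _ => Or.inl hρ.ne').continuousOn.mul hμc)

theorem continuousOn_cpow_mul (hμc : ContinuousOn μ (Icc 0 1)) {z : ℂ} (hz : z ≠ 0) (a : ℂ) :
    ContinuousOn (fun α : ℝ => z ^ ((α : ℂ) + a) * (μ α : ℂ)) (Icc 0 1) := by
  refine ContinuousOn.mul (Continuous.continuousOn ?_)
    (Complex.continuous_ofReal.comp_continuousOn hμc)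
  exact Continuous.const_cpow (by fun_prop) (Or.inl hz)

theorem intervalIntegrable_cpow_mul (hμc : ContinuousOn μ (Icc 0 1)) {z : ℂ} (hz : z ≠ 0)
    (a : ℂ) : IntervalIntegrable (fun α : ℝ => z ^ ((α : ℂ) + a) * (μ α : ℂ)) volume 0 1 :=
  (continuousOn_cpow_mul hμc hz a).intervalIntegrable_of_Icc zero_le_one

theorem norm_cpow_ofReal_add (z : ℂ) (α a : ℝ) : ‖z ^ ((α : ℂ) + (a : ℂ))‖ = ‖z‖ ^ (α + a) := by
  rw [← Complex.norm_cpow_real]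
  push_cast
  rfl

theorem differentiableAt_kernelW (hμc : ContinuousOn μ (Icc 0 1)) {z : ℂ}
    (hz : z ∈ Complex.slitPlane) : DifferentiableAt ℂ (kernelW μ) z := by
  have hz0 : 0 < ‖z‖ := norm_pos_iff.2 (Complex.slitPlane_ne_zero hz)
  obtain ⟨M, hM, hb⟩ := exists_bound_Icc hμc
  have hs : {y : ℂ | y ∈ Complex.slitPlane ∧ ‖z‖ / 2 < ‖y‖} ∈ 𝓝 z :=
    (Complex.isOpen_slitPlane.inter (isOpen_lt continuous_const continuous_norm)).mem_nhds
      ⟨hz, half_lt_self hz0⟩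
  have key := intervalIntegral.hasDerivAt_integral_of_dominated_loc_of_deriv_le (μ := volume)
    (𝕜 := ℂ) (a := 0) (b := 1) (x₀ := z) (bound := fun α => M * (‖z‖ / 2) ^ (α + (-2)))
    (F := fun (y : ℂ) (α : ℝ) => y ^ ((α : ℂ) - 1) * (μ α : ℂ))
    (F' := fun (y : ℂ) (α : ℝ) => ((α : ℂ) - 1) * (y ^ ((α : ℂ) + (-2)) * (μ α : ℂ))) hs ?_ ?_ ?_
    ?_ ?_ ?_
  · exact key.2.differentiableAt
  · filter_upwards [hs] with y hy
    simpa only [← sub_eq_add_neg] using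
      (intervalIntegrable_cpow_mul hμc (Complex.slitPlane_ne_zero hy.1)
        (-1)).def'.aestronglyMeasurable
  · simpa only [← sub_eq_add_neg] using
      intervalIntegrable_cpow_mul hμc (Complex.slitPlane_ne_zero hz) (-1)
  · have h1 : AEStronglyMeasurable (fun α : ℝ => (α : ℂ) - 1) (volume.restrict (uIoc 0 1)) :=
      Continuous.aestronglyMeasurable (by fun_prop)
    exact h1.mul (intervalIntegrable_cpow_mul hμc (Complex.slitPlane_ne_zero hz)
      (-2)).def'.aestronglyMeasurable
  · refine Eventually.of_forall fun α hα y hy => ?_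
    rw [uIoc_of_le zero_le_one] at hα
    have h1 : ‖(α : ℂ) - 1‖ ≤ 1 := by
      rw [← Complex.ofReal_one, ← Complex.ofReal_sub, Complex.norm_real, Real.norm_eq_abs, abs_le]
      constructor <;> linarith [hα.1, hα.2]
    have h2 : ‖y ^ ((α : ℂ) + (-2))‖ ≤ (‖z‖ / 2) ^ (α + (-2)) := by
      have := norm_cpow_ofReal_add y α (-2)
      push_cast at this
      rw [this]
      exact Real.rpow_le_rpow_of_nonpos (by positivity) hy.2.le (by linarith [hα.2])
    rw [norm_mul, norm_mul, Complex.norm_real, Real.norm_eq_abs]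
    calc _ ≤ 1 * ((‖z‖ / 2) ^ (α + (-2)) * M) := mul_le_mul h1 (mul_le_mul h2
          (hb α ⟨hα.1.le, hα.2⟩) (abs_nonneg _) (by positivity)) (by positivity) zero_le_one
      _ = _ := by ring
  · exact (Continuous.intervalIntegrable (continuous_const.mul
      (Continuous.rpow continuous_const (by fun_prop) fun _ => Or.inl (by positivity))) _ _)
  · refine Eventually.of_forall fun α _ y hy => ?_
    have h := ((hasDerivAt_id y).cpow_const (c := (α : ℂ) - 1) hy.1).mul_const (μ α : ℂ)
    refine h.congr_deriv ?_
    simp only [id, mul_one]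
    rw [show (α : ℂ) - 1 - 1 = α + (-2) by ring]
    ring

theorem norm_kernelW_le (hμc : ContinuousOn μ (Icc 0 1)) (hμ0 : ∀ α ∈ Icc (0 : ℝ) 1, 0 ≤ μ α)
    {δ : ℝ} {z : ℂ} (hδ : 0 < δ) (hz : δ ≤ ‖z‖) :
    ‖kernelW μ z‖ ≤ ∫ α in (0 : ℝ)..1, δ ^ (α + (-1)) * μ α := by
  refine intervalIntegral.norm_integral_le_of_norm_le zero_le_one
    (Eventually.of_forall fun α hα => ?_) (intervalIntegrable_rpow_mul hμc hδ (-1))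
  rw [norm_mul, norm_cpow_sub_one, Complex.norm_real,
    Real.norm_of_nonneg (hμ0 α ⟨hα.1.le, hα.2⟩), ← sub_eq_add_neg]
  exact mul_le_mul_of_nonneg_right (Real.rpow_le_rpow_of_nonpos hδ hz (by linarith [hα.2]))
    (hμ0 α ⟨hα.1.le, hα.2⟩)

theorem isSectorial_kernelW (hμc : ContinuousOn μ (Icc 0 1))
    (hμ0 : ∀ α ∈ Icc (0 : ℝ) 1, 0 ≤ μ α) : IsSectorial (kernelW μ) := by
  refine ⟨fun z hz => differentiableAt_kernelW hμc hz, fun θ δ _ _ hδ =>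
    ⟨∫ α in (0 : ℝ)..1, δ ^ (α + (-1)) * μ α, 0, ?_, fun ρ ψ hρ _ => ?_⟩⟩
  · exact (norm_nonneg _).trans (norm_kernelW_le hμc hμ0 hδ (z := (δ : ℂ))
      (by rw [Complex.norm_real, Real.norm_of_nonneg hδ.le]))
  · rw [pow_zero, mul_one]
    exact norm_kernelW_le hμc hμ0 hδ (by rwa [norm_polar (hδ.le.trans hρ)])

theorem mul_kernelW {z : ℂ} (hz : z ≠ 0) :
    z * kernelW μ z = ∫ α in (0 : ℝ)..1, z ^ (α : ℂ) * (μ α : ℂ) := by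
  rw [kernelW, ← intervalIntegral.integral_const_mul]
  refine intervalIntegral.integral_congr fun α _ => ?_
  change z * (z ^ ((α : ℂ) - 1) * (μ α : ℂ)) = _
  rw [Complex.cpow_sub _ _ hz, Complex.cpow_one]
  field_simp

/-- The value of `z * kernelW μ z` at `z = ρ > 0`. -/
def kernelSymbol (μ : ℝ → ℝ) (ρ : ℝ) : ℝ := ∫ α in (0 : ℝ)..1, ρ ^ α * μ α

theorem norm_mul_kernelW_le (hμc : ContinuousOn μ (Icc 0 1))
    (hμ0 : ∀ α ∈ Icc (0 : ℝ) 1, 0 ≤ μ α) {z : ℂ} (hz : z ≠ 0) :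
    ‖z * kernelW μ z‖ ≤ kernelSymbol μ ‖z‖ := by
  rw [mul_kernelW hz, kernelSymbol]
  refine intervalIntegral.norm_integral_le_of_norm_le zero_le_one
    (Eventually.of_forall fun α hα => ?_)
    (by simpa using intervalIntegrable_rpow_mul hμc (norm_pos_iff.2 hz) 0)
  rw [norm_mul, Complex.norm_cpow_real, Complex.norm_real,
    Real.norm_of_nonneg (hμ0 α ⟨hα.1.le, hα.2⟩)]

theorem re_mul_cpow_polar {ρ ψ : ℝ} (hρ : 0 < ρ) (hψ : |ψ| < π) (α : ℝ) :
    (Complex.exp ((-(ψ / 2) : ℝ) * Complex.I) *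
      (ρ * Complex.exp (ψ * Complex.I)) ^ (α : ℂ)).re = ρ ^ α * Real.cos ((α - 1 / 2) * ψ) := by
  have hlog : Complex.log (Complex.exp (ψ * Complex.I)) = ψ * Complex.I := by
    refine Complex.log_exp ?_ ?_ <;> simp only [Complex.im_ofReal_mul, Complex.I_im, mul_one]
    · exact (abs_lt.1 hψ).1
    · exact (abs_lt.1 hψ).2.le
  rw [Complex.cpow_def_of_ne_zero (Complex.slitPlane_ne_zero (polar_mem_slitPlane hρ hψ)),
    Complex.log_ofReal_mul hρ (Complex.exp_ne_zero _), hlog, ← Complex.exp_add,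
    Complex.exp_re, Real.rpow_def_of_pos hρ]
  congr 2 <;> simp
  ring

/-- The powers `z^α`, `0 ≤ α ≤ 1`, have arguments `αψ` between `0` and `ψ`. Rotation by `-ψ/2`
centres this range, so every term has real part at least `ρ^α cos(ψ/2)`, and `μ ≥ 0` excludes
cancellation. -/
theorem cos_mul_kernelSymbol_le (hμc : ContinuousOn μ (Icc 0 1))
    (hμ0 : ∀ α ∈ Icc (0 : ℝ) 1, 0 ≤ μ α) {ρ ψ : ℝ} (hρ : 0 < ρ) (hψ : |ψ| < π) :
    Real.cos (ψ / 2) * kernelSymbol μ ρ ≤ (Complex.exp ((-(ψ / 2) : ℝ) * Complex.I) *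
      (ρ * Complex.exp (ψ * Complex.I) * kernelW μ (ρ * Complex.exp (ψ * Complex.I)))).re := by
  have hz := Complex.slitPlane_ne_zero (polar_mem_slitPlane hρ hψ)
  have hint : IntervalIntegrable (fun α : ℝ => Complex.exp ((-(ψ / 2) : ℝ) * Complex.I) *
      ((ρ * Complex.exp (ψ * Complex.I)) ^ (α : ℂ) * (μ α : ℂ))) volume 0 1 := by
    have := intervalIntegrable_cpow_mul hμc hz 0
    simp only [add_zero] at this
    exact this.const_mul _
  have hre : ∀ α : ℝ, Complex.reCLM (Complex.exp ((-(ψ / 2) : ℝ) * Complex.I) *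
      ((ρ * Complex.exp (ψ * Complex.I)) ^ (α : ℂ) * (μ α : ℂ))) =
      ρ ^ α * Real.cos ((α - 1 / 2) * ψ) * μ α := by
    intro α
    rw [← mul_assoc, Complex.reCLM_apply, Complex.re_mul_ofReal, re_mul_cpow_polar hρ hψ]
  have hint' : IntervalIntegrable (fun α => ρ ^ α * Real.cos ((α - 1 / 2) * ψ) * μ α)
      volume 0 1 := by
    refine ContinuousOn.intervalIntegrable_of_Icc zero_le_one (ContinuousOn.mul ?_ hμc)
    exact ((Continuous.rpow continuous_const continuous_id fun _ => Or.inl hρ.ne').mul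
      (by fun_prop)).continuousOn
  rw [mul_kernelW hz, ← intervalIntegral.integral_const_mul, kernelSymbol,
    ← intervalIntegral.integral_const_mul, ← Complex.reCLM_apply,
    ← Complex.reCLM.intervalIntegral_comp_comm hint]
  simp only [hre]
  refine intervalIntegral.integral_mono_on zero_le_one ?_ hint' fun α hα => ?_
  · have := (intervalIntegrable_rpow_mul hμc hρ 0).const_mul (Real.cos (ψ / 2))
    simpa using this
  · have hcos : Real.cos (ψ / 2) ≤ Real.cos ((α - 1 / 2) * ψ) := by
      rw [← Real.cos_abs (ψ / 2), ← Real.cos_abs ((α - 1 / 2) * ψ)]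
      refine Real.cos_le_cos_of_nonneg_of_le_pi (abs_nonneg _) ?_ ?_
      · rw [abs_div, abs_two]
        linarith [abs_nonneg ψ]
      · have hα' : |α - 1 / 2| ≤ 1 / 2 := abs_le.2 (by constructor <;> linarith [hα.1, hα.2])
        rw [abs_mul, abs_div, abs_two]
        linarith [mul_le_mul_of_nonneg_right hα' (abs_nonneg ψ)]
    have h0 := hμ0 α hα
    have h1 : 0 ≤ ρ ^ α := by positivity
    calc _ = ρ ^ α * Real.cos (ψ / 2) * μ α := by ring
      _ ≤ _ := by gcongr

/-- Only orders within about `1 / log ρ` of `1` are used: there `ρ^α` is comparable to `ρ` and `μ`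
is at least `μ(1) / 2`. The width of this window is the logarithmic loss. -/
theorem exists_le_kernelSymbol (hμc : ContinuousOn μ (Icc 0 1))
    (hμ0 : ∀ α ∈ Icc (0 : ℝ) 1, 0 ≤ μ α) (hμ1 : 0 < μ 1) :
    ∃ c, 0 < c ∧ ∀ ρ : ℝ, 0 < ρ → c * ρ / Real.log (max ρ 2) ≤ kernelSymbol μ ρ := by
  have hev : ∀ᶠ α in 𝓝[Icc 0 1] (1 : ℝ), μ 1 / 2 < μ α :=
    (hμc 1 (by simp)).eventually (lt_mem_nhds (half_lt_self hμ1))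
  obtain ⟨r, hr, hball⟩ := Metric.mem_nhdsWithin_iff.1 hev
  set ε := min (r / 2) 1 with hε
  have hε0 : 0 < ε := lt_min (by positivity) one_pos
  have hε1 : ε ≤ 1 := min_le_right _ _
  have hμε : ∀ α, 1 - ε ≤ α → α ≤ 1 → μ 1 / 2 ≤ μ α := by
    intro α h1 h2
    refine le_of_lt (hball ⟨?_, by linarith, h2⟩)
    rw [Metric.mem_ball, Real.dist_eq, abs_lt]
    have : ε ≤ r / 2 := min_le_left _ _
    constructor <;> linarith
  have hlog2 : 0 < Real.log 2 := Real.log_pos one_lt_two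
  refine ⟨μ 1 / 2 * (ε * Real.log 2) * Real.exp (-(ε * Real.log 2)), by positivity,
    fun ρ hρ => ?_⟩
  set l := Real.log (max ρ 2) with hl
  have hl2 : Real.log 2 ≤ l := Real.log_le_log two_pos (le_max_right _ _)
  have hl0 : 0 < l := hlog2.trans_le hl2
  have hρl : Real.log ρ ≤ l := Real.log_le_log hρ (le_max_left _ _)
  -- The numerator ensures `η ≤ ε`, because `l ≥ log 2`, and makes `ρ^{-η} ≥ e^{-ε log 2}` for every
  -- `ρ > 0`.
  set η := ε * Real.log 2 / l with hη
  have hη0 : 0 < η := by positivity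
  have hηl : η * l = ε * Real.log 2 := div_mul_cancel₀ _ hl0.ne'
  have hηε : η ≤ ε := by
    rw [hη, div_le_iff₀ hl0]
    exact mul_le_mul_of_nonneg_left hl2 hε0.le
  have hint : IntervalIntegrable (fun α => ρ ^ α * μ α) volume 0 1 := by
    simpa using intervalIntegrable_rpow_mul hμc hρ 0
  have h1 : ∫ α in (1 - η)..1, ρ ^ α * μ α ≤ kernelSymbol μ ρ := by
    refine intervalIntegral.integral_mono_interval (by linarith) (by linarith) le_rfl ?_ hint
    refine (ae_restrict_iff' measurableSet_Ioc).2 (Eventually.of_forall fun α hα => ?_)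
    exact mul_nonneg (by positivity) (hμ0 α ⟨hα.1.le, hα.2⟩)
  refine le_trans ?_ h1
  have h2 : ∫ _ in (1 - η)..1, ρ * Real.exp (-(ε * Real.log 2)) * (μ 1 / 2) ≤
      ∫ α in (1 - η)..1, ρ ^ α * μ α := by
    refine intervalIntegral.integral_mono_on (by linarith) (by simp)
      (hint.mono_set ?_) fun α hα => ?_
    · rw [uIcc_of_le (by linarith), uIcc_of_le zero_le_one]
      exact Icc_subset_Icc (by linarith) le_rfl
    · have h3 : ρ * Real.exp (-(ε * Real.log 2)) ≤ ρ ^ α := by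
        rw [Real.rpow_def_of_pos hρ]
        nth_rw 1 [← Real.exp_log hρ]
        rw [← Real.exp_add]
        refine Real.exp_le_exp.2 ?_
        have h4 : (1 - α) * Real.log ρ ≤ η * l := by
          refine (mul_le_mul_of_nonneg_left hρl (by linarith [hα.2])).trans
            (mul_le_mul_of_nonneg_right (by linarith [hα.1]) hl0.le)
        linarith
      exact mul_le_mul h3 (hμε α (by linarith [hα.1]) hα.2) (by positivity) (by positivity)
  refine le_of_eq_of_le ?_ h2
  rw [intervalIntegral.integral_const, smul_eq_mul, sub_sub_cancel, hη]
  ring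

theorem one_half_lt_log_two : 1 / 2 < Real.log 2 := by
  linarith [Real.log_two_gt_d9]

/-- Trades `log ρ` for `log(1/t)`: `max ρ 2 ≤ tρ · max t⁻¹ 2` and `log(tρ) ≤ tρ`. As the logarithm
on the right is at least `1/2`, the term `tρ` costs a factor two of it, whence the `3`. -/
theorem log_max_two_le {t ρ : ℝ} (ht : 0 < t) (h : 1 ≤ t * ρ) :
    Real.log (max ρ 2) ≤ 3 * Real.log (max t⁻¹ 2) * (t * ρ) := by
  have hm : 0 < max t⁻¹ 2 := lt_max_of_lt_right two_pos
  have hl : 1 / 2 ≤ Real.log (max t⁻¹ 2) :=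
    one_half_lt_log_two.le.trans (Real.log_le_log two_pos (le_max_right _ _))
  have h1 : max ρ 2 ≤ t * ρ * max t⁻¹ 2 := by
    refine max_le ?_ ?_
    · calc ρ = t * ρ * t⁻¹ := by field_simp
        _ ≤ _ := by gcongr; exact le_max_left _ _
    · calc (2 : ℝ) = 1 * 2 := (one_mul 2).symm
        _ ≤ _ := mul_le_mul h (le_max_right _ _) two_pos.le (by linarith)
  have h2 : Real.log (max ρ 2) ≤ Real.log (t * ρ) + Real.log (max t⁻¹ 2) := by
    rw [← Real.log_mul (by positivity) hm.ne']
    exact Real.log_le_log (lt_max_of_lt_right two_pos) h1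
  have h3 : Real.log (t * ρ) ≤ t * ρ :=
    (Real.log_le_sub_one_of_pos (by linarith)).trans (by linarith)
  nlinarith

/-- The integral equals `(1 - a) / log a⁻¹`. This is the origin of the inverse logarithm in the
bound for data in `L²`. -/
theorem integral_rpow_exponent_le {a : ℝ} (ha : 0 < a) (ha1 : a < 1) :
    ∫ α in (0 : ℝ)..1, a ^ (1 - α) ≤ (Real.log a⁻¹)⁻¹ := by
  have hl : Real.log a < 0 := Real.log_neg ha ha1
  have h : ∫ α in (0 : ℝ)..1, a ^ (1 - α) = ∫ α in (0 : ℝ)..1, Real.exp (α * Real.log a) := by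
    rw [intervalIntegral.integral_comp_sub_left (fun α => a ^ α)]
    simp only [sub_self, sub_zero, Real.rpow_def_of_pos ha, mul_comm]
  rw [h, intervalIntegral.integral_comp_mul_right _ hl.ne, integral_exp, Real.log_inv, zero_mul,
    one_mul, Real.exp_log ha, Real.exp_zero, smul_eq_mul, inv_neg, ← mul_neg_one]
  refine mul_le_mul_of_nonpos_left (by linarith) (inv_nonpos.2 hl.le)

/-- The bound on the kernel on the contour of radius `1 / t`. -/
theorem exists_norm_kernelW_le (hμc : ContinuousOn μ (Icc 0 1))
    (hμ0 : ∀ α ∈ Icc (0 : ℝ) 1, 0 ≤ μ α) {T : ℝ} (hT : 0 < T) :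
    ∃ K, 0 ≤ K ∧ ∀ t, 0 < t → t ≤ T → ∀ z : ℂ, 1 ≤ t * ‖z‖ →
      ‖kernelW μ z‖ ≤ K * (Real.log (2 * T / t))⁻¹ := by
  obtain ⟨M, hM, hb⟩ := exists_bound_Icc hμc
  refine ⟨max 1 (2 * T) * M, by positivity, fun t ht htT z hz => ?_⟩
  have hz' : t⁻¹ ≤ ‖z‖ := by rwa [inv_le_iff_one_le_mul₀' ht]
  refine (norm_kernelW_le hμc hμ0 (inv_pos.2 ht) hz').trans ?_
  -- Normalizing by `2T` rather than `T` gives `a ≤ 1/2`, so `log a⁻¹` stays away from zero up to `t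
  -- = T`. The price `(2T)^{1-α}` makes the constant depend on `T`.
  set a := t / (2 * T) with ha
  have ha0 : 0 < a := by positivity
  have ha1 : a < 1 := by
    rw [ha, div_lt_one (by positivity)]
    linarith
  have hta : t = 2 * T * a := by rw [ha]; field_simp
  have hcont : Continuous fun α : ℝ => a ^ (1 - α) :=
    Continuous.rpow continuous_const (by fun_prop) fun _ => Or.inl ha0.ne'
  have h1 : ∫ α in (0 : ℝ)..1, t⁻¹ ^ (α + (-1)) * μ α ≤
      ∫ α in (0 : ℝ)..1, max 1 (2 * T) * M * a ^ (1 - α) := by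
    refine intervalIntegral.integral_mono_on zero_le_one
      (intervalIntegrable_rpow_mul hμc (inv_pos.2 ht) (-1))
      ((hcont.const_mul _).intervalIntegrable _ _) fun α hα => ?_
    have h2 : t⁻¹ ^ (α + (-1)) = (2 * T) ^ (1 - α) * a ^ (1 - α) := by
      rw [Real.inv_rpow ht.le, ← Real.rpow_neg ht.le, ← Real.mul_rpow (by positivity) ha0.le, ← hta]
      congr 1
      ring
    have h3 : (2 * T) ^ (1 - α) ≤ max 1 (2 * T) := by
      rcases le_total 1 (2 * T) with h | h
      · exact (Real.rpow_le_self_of_one_le h (by linarith [hα.1])).trans (le_max_right _ _)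
      · exact (Real.rpow_le_one (by positivity) h (by linarith [hα.2])).trans (le_max_left _ _)
    have h4 : 0 ≤ a ^ (1 - α) := by positivity
    calc _ = (2 * T) ^ (1 - α) * μ α * a ^ (1 - α) := by rw [h2]; ring
      _ ≤ _ := by
        have h5 := (le_abs_self _).trans (hb α hα)
        have h6 := hμ0 α hα
        gcongr
  refine h1.trans ?_
  rw [intervalIntegral.integral_const_mul]
  refine mul_le_mul_of_nonneg_left ((integral_rpow_exponent_le ha0 ha1).trans_eq ?_) (by positivity)
  rw [ha, inv_div]

variable {X : Type*} [NormedAddCommGroup X] [NormedSpace ℂ X]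

/-- On the contour of radius `1` one has `|z| ≥ 1`, so `|z^{α-1}| ≤ 1` for all orders at once. This
justifies exchanging the integral over `α` with the contour integral. -/
theorem IsSectorial.integrable_prod_cpow_smul {F : ℂ → X} (hF : IsSectorial F)
    (hμc : ContinuousOn μ (Icc 0 1)) {θ t : ℝ} (hθ : π / 2 < θ) (hθ' : θ < π) (ht : 0 < t) :
    Integrable (Function.uncurry fun α x : ℝ => ((contourPath θ 1 x) ^ ((α : ℂ) - 1) * (μ α : ℂ)) •
      contourIntegrand θ 1 F t x) ((volume.restrict (Ioc 0 1)).prod volume) := by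
  have hθ0 : 0 ≤ θ := by linarith [Real.pi_pos]
  obtain ⟨M, hM, hb⟩ := exists_bound_Icc hμc
  have hint := (hF.integrable_contourIntegrand hθ hθ' one_pos ht).norm.const_mul M
  refine (hint.comp_snd (volume.restrict (Ioc (0 : ℝ) 1))).mono' ?_ ?_
  · have h1 : AEStronglyMeasurable (fun p : ℝ × ℝ => (contourPath θ 1 p.2) ^ ((p.1 : ℂ) - 1))
        ((volume.restrict (Ioc (0 : ℝ) 1)).prod volume) := by
      refine Continuous.aestronglyMeasurable (Continuous.cpow ?_ (by fun_prop) fun p =>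
        contourPath_mem_slitPlane hθ0 hθ' one_pos p.2)
      exact (continuous_contourPath θ 1).comp continuous_snd
    have h2 : AEStronglyMeasurable (fun α => (μ α : ℂ)) (volume.restrict (Ioc (0 : ℝ) 1)) :=
      ((Complex.continuous_ofReal.comp_continuousOn hμc).mono
        Ioc_subset_Icc_self).aestronglyMeasurable measurableSet_Ioc
    exact (h1.mul h2.comp_fst).smul
      (hF.aestronglyMeasurable_contourIntegrand hθ0 hθ' one_pos t).comp_snd
  · have hae : ∀ᵐ p : ℝ × ℝ ∂((volume.restrict (Ioc (0 : ℝ) 1)).prod volume),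
        p.1 ∈ Ioc (0 : ℝ) 1 :=
      Measure.quasiMeasurePreserving_fst.ae (ae_restrict_mem measurableSet_Ioc)
    filter_upwards [hae] with p hp
    have h1 : ‖(contourPath θ 1 p.2) ^ ((p.1 : ℂ) - 1)‖ ≤ 1 := by
      rw [norm_cpow_sub_one, norm_contourPath one_pos]
      exact Real.rpow_le_one_of_one_le_of_nonpos (le_contourRadius θ 1 p.2) (by linarith [hp.2])
    rw [Function.uncurry, norm_smul, norm_mul, Complex.norm_real]
    refine mul_le_mul_of_nonneg_right ?_ (norm_nonneg _)
    calc _ ≤ 1 * M := mul_le_mul h1 (hb p.1 ⟨hp.1.le, hp.2⟩) (abs_nonneg _) zero_le_one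
      _ = M := one_mul M

theorem IsSectorial.smul_laplaceInv_cpow_smul {F : ℂ → X} (hF : IsSectorial F)
    {θ t α : ℝ} (hθ : π / 2 < θ) (hθ' : θ < π) (ht : 0 < t) (hα : α ≤ 1) :
    μ α • laplaceInv θ 1 (fun z => z ^ ((α : ℂ) - 1) • F z) t = (2 * (π : ℂ) * Complex.I)⁻¹ •
      ∫ x, ((contourPath θ 1 x) ^ ((α : ℂ) - 1) * (μ α : ℂ)) • contourIntegrand θ 1 F t x := by
  rw [((isSectorial_cpow hα).smul hF).laplaceInv_eq hθ hθ' one_pos ht, smul_comm, ← integral_smul]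
  congr 2
  ext x
  rw [contourIntegrand, contourIntegrand, ← Complex.coe_smul]
  simp only [smul_smul]
  congr 1
  ring

theorem IsSectorial.intervalIntegrable_smul_laplaceInv {F : ℂ → X} (hF : IsSectorial F)
    (hμc : ContinuousOn μ (Icc 0 1)) {θ t : ℝ} (hθ : π / 2 < θ) (hθ' : θ < π) (ht : 0 < t) :
    IntervalIntegrable (fun α => μ α • laplaceInv θ 1 (fun z => z ^ ((α : ℂ) - 1) • F z) t)
      volume 0 1 := by
  rw [intervalIntegrable_iff_integrableOn_Ioc_of_le zero_le_one]
  refine IntegrableOn.congr_fun (f := _) ((hF.integrable_prod_cpow_smul hμc hθ hθ'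
    ht).integral_prod_left.smul (2 * (π : ℂ) * Complex.I)⁻¹) (fun α hα => ?_) measurableSet_Ioc
  exact (hF.smul_laplaceInv_cpow_smul hθ hθ' ht hα.2).symm

theorem IsSectorial.integral_smul_laplaceInv [CompleteSpace X] {F : ℂ → X} (hF : IsSectorial F)
    (hμc : ContinuousOn μ (Icc 0 1)) (hμ0 : ∀ α ∈ Icc (0 : ℝ) 1, 0 ≤ μ α) {θ t : ℝ}
    (hθ : π / 2 < θ) (hθ' : θ < π) (ht : 0 < t) :
    ∫ α in (0 : ℝ)..1, μ α • laplaceInv θ 1 (fun z => z ^ ((α : ℂ) - 1) • F z) t =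
      laplaceInv θ 1 (fun z => kernelW μ z • F z) t := by
  rw [((isSectorial_kernelW hμc hμ0).smul hF).laplaceInv_eq hθ hθ' one_pos ht,
    intervalIntegral.integral_of_le zero_le_one, setIntegral_congr_fun measurableSet_Ioc
    (fun α hα => hF.smul_laplaceInv_cpow_smul hθ hθ' ht hα.2), integral_smul,
    integral_integral_swap (hF.integrable_prod_cpow_smul hμc hθ hθ' ht)]
  congr 2
  ext x
  rw [integral_smul_const, ← intervalIntegral.integral_of_le zero_le_one, contourIntegrand,
    contourIntegrand, kernelW]
  simp only [smul_smul]
  congr 1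
  ring

end DistributedOrderKernel

/-! ### The operator-valued symbols `R(z)`, `H(z)` and `A H(z)`. -/

noncomputable section ResolventKernel

section Sectorial

variable {X : Type*} [NormedAddCommGroup X] [NormedSpace ℂ X]

theorem IsSectorial.sub {F G : ℂ → X} (hF : IsSectorial F) (hG : IsSectorial G) :
    IsSectorial fun z => F z - G z := by
  refine ⟨fun z hz => (hF.1 z hz).sub (hG.1 z hz), fun θ δ hθ hθ' hδ => ?_⟩
  obtain ⟨C, k, hC, h⟩ := hF.2 θ δ hθ hθ' hδ
  obtain ⟨D, l, hD, h'⟩ := hG.2 θ δ hθ hθ' hδ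
  refine ⟨C * (δ⁻¹) ^ l + D * (δ⁻¹) ^ k, k + l, by positivity, fun ρ ψ hρ hψ => ?_⟩
  have hρ0 : 0 < ρ := hδ.trans_le hρ
  -- As `ρ ≥ δ` only, these factors raise both degrees to `k + l` even when `δ < 1`.
  have h1 : ∀ n : ℕ, 1 ≤ (δ⁻¹ * ρ) ^ n := fun n =>
    one_le_pow₀ (by rw [inv_mul_eq_div, le_div_iff₀ hδ, one_mul]; exact hρ)
  calc _ ≤ C * ρ ^ k + D * ρ ^ l :=
        (norm_sub_le _ _).trans (add_le_add (h ρ ψ hρ hψ) (h' ρ ψ hρ hψ))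
    _ ≤ C * ρ ^ k * (δ⁻¹ * ρ) ^ l + D * ρ ^ l * (δ⁻¹ * ρ) ^ k :=
        add_le_add (le_mul_of_one_le_right (by positivity) (h1 l))
          (le_mul_of_one_le_right (by positivity) (h1 k))
    _ = _ := by ring

/-- Moving to the angle `2π/3` and the radius `1/t` first is what makes every estimate uniform in
`θ` and `δ`. -/
theorem IsSectorial.norm_laplaceInv_le [CompleteSpace X] {F : ℂ → X} (hF : IsSectorial F)
    {θ δ t M : ℝ} (hθ : π / 2 < θ) (hθ' : θ < π) (hδ : 0 < δ) (ht : 0 < t) (k : ℕ)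
    (hM : ∀ ρ ψ : ℝ, 1 ≤ t * ρ → |ψ| ≤ 2 * π / 3 →
      ‖F (ρ * Complex.exp (ψ * Complex.I))‖ ≤ M * (t * ρ) ^ k) :
    ‖laplaceInv θ δ F t‖ ≤ laplaceConst k * M / t := by
  rw [hF.laplaceInv_congr_contour hθ hθ' (θ₂ := 2 * π / 3) (δ₂ := t⁻¹)
    (by linarith [Real.pi_pos]) (by linarith [Real.pi_pos]) hδ (inv_pos.2 ht) ht]
  exact _root_.norm_laplaceInv_le ht k hM

/-- Since `z^n v = z^{n+1} (z⁻¹ v)`, the transform is the derivative of order `n + 1` of the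
constant `v`. -/
theorem laplaceInv_pow_smul [CompleteSpace X] (v : X) {θ δ t : ℝ} (hθ : π / 2 < θ) (hθ' : θ < π)
    (hδ : 0 < δ) (ht : 0 < t) (n : ℕ) : laplaceInv θ δ (fun z => z ^ n • v) t = 0 := by
  have hF : IsSectorial fun z : ℂ => z⁻¹ • v := isSectorial_inv.smul (isSectorial_const v)
  have h := hF.iteratedDeriv_laplaceInv hθ hθ' hδ ht (n + 1)
  have h1 : laplaceInv θ δ (fun z : ℂ => z⁻¹ • v) =ᶠ[𝓝 t] fun _ => v := by
    filter_upwards [lt_mem_nhds ht] with s hs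
    exact laplaceInv_inv_smul v hθ hθ' hδ hs
  rw [h1.iteratedDeriv_eq, iteratedDeriv_const, if_neg n.succ_ne_zero] at h
  rw [h]
  refine congrFun (laplaceInv_congr (by linarith [Real.pi_pos]) hθ' hδ fun z hz => ?_) t
  rw [smul_smul, pow_succ, mul_assoc, mul_inv_cancel₀ (Complex.slitPlane_ne_zero hz), mul_one]

end Sectorial

variable {d : ℕ} {Ω : Opens (EuclideanSpace ℝ (Fin d))}

/-- The Dirichlet Laplacian is closed, so it commutes with the inverse Laplace transform. -/
theorem laplaceInv_mem_domain {F G : ℂ → L2 Ω} (hF : IsSectorial F) (hG : IsSectorial G)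
    (hFG : ∀ z ∈ Complex.slitPlane, ∃ h : F z ∈ (dirichletLaplacian Ω).domain,
      dirichletLaplacian Ω ⟨F z, h⟩ = G z) {θ δ t : ℝ} (hθ : π / 2 < θ) (hθ' : θ < π)
    (hδ : 0 < δ) (ht : 0 < t) :
    ∃ h : laplaceInv θ δ F t ∈ (dirichletLaplacian Ω).domain,
      dirichletLaplacian Ω ⟨laplaceInv θ δ F t, h⟩ = laplaceInv θ δ G t := by
  have hθ0 : 0 ≤ θ := by linarith [Real.pi_pos]
  have hK : IsSectorial fun z => F z - (-1 : ℂ) • G z :=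
    hF.sub ((isSectorial_const (-1 : ℂ)).smul hG)
  -- If `G = A F`, then `F = (I + A)⁻¹ (F + G)`, and the bounded operator `(I + A)⁻¹` commutes with
  -- the integral. The sum is written as a difference so that `IsSectorial.sub` and
  -- `IsSectorial.laplaceInv_sub` apply.
  have h1 : shiftInverse Ω 1 (laplaceInv θ δ (fun z => F z - (-1 : ℂ) • G z) t) =
      laplaceInv θ δ F t := by
    rw [hK.clm_laplaceInv _ hθ hθ' hδ ht]
    refine congrFun (laplaceInv_congr hθ0 hθ' hδ fun z hz => ?_) t
    obtain ⟨h, hA⟩ := hFG z hz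
    have h2 := isShiftInverse_one.2 ⟨F z, h⟩
    rwa [hA, one_smul, ← sub_neg_eq_add, ← neg_one_smul ℂ (G z)] at h2
  obtain ⟨h2, h3⟩ := isShiftInverse_one.1 (laplaceInv θ δ (fun z => F z - (-1 : ℂ) • G z) t)
  have h4 : laplaceInv θ δ (fun z => F z - (F z - (-1 : ℂ) • G z)) t = laplaceInv θ δ F t -
      laplaceInv θ δ (fun z => F z - (-1 : ℂ) • G z) t :=
    hF.laplaceInv_sub hK (hF.sub hK) hθ hθ' hδ ht
  have h5 : laplaceInv θ δ (fun z => F z - (F z - (-1 : ℂ) • G z)) t = -laplaceInv θ δ G t := by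
    have := hG.clm_laplaceInv (-ContinuousLinearMap.id ℂ (L2 Ω)) hθ hθ' hδ ht
    simp only [neg_apply, ContinuousLinearMap.id_apply] at this
    rw [this]
    simp
  have h6 : ∀ {x y : L2 Ω}, x = y → ∀ (hx : x ∈ (dirichletLaplacian Ω).domain),
      ∃ hy : y ∈ (dirichletLaplacian Ω).domain,
        dirichletLaplacian Ω ⟨y, hy⟩ = dirichletLaplacian Ω ⟨x, hx⟩ := by
    rintro x _ rfl hx
    exact ⟨hx, rfl⟩
  obtain ⟨h7, h8⟩ := h6 h1 h2
  refine ⟨h7, ?_⟩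
  rw [one_smul] at h3
  rw [h8, eq_sub_of_add_eq' h3, h1, ← neg_sub, ← h4, h5, neg_neg]

variable {μ : ℝ → ℝ}

theorem kernelSymbol_pos (hμc : ContinuousOn μ (Icc 0 1))
    (hμ0 : ∀ α ∈ Icc (0 : ℝ) 1, 0 ≤ μ α) (hμ1 : 0 < μ 1) {ρ : ℝ} (hρ : 0 < ρ) :
    0 < kernelSymbol μ ρ := by
  obtain ⟨c, hc, h⟩ := exists_le_kernelSymbol hμc hμ0 hμ1
  have : 0 < Real.log (max ρ 2) := Real.log_pos (lt_max_of_lt_right one_lt_two)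
  exact lt_of_lt_of_le (by positivity) (h ρ hρ)

theorem cos_half_pos {ψ : ℝ} (hψ : |ψ| < π) : 0 < Real.cos (ψ / 2) := by
  have := abs_lt.1 hψ
  exact Real.cos_pos_of_mem_Ioo ⟨by linarith, by linarith⟩

theorem norm_exp_neg_half (ψ : ℝ) : ‖Complex.exp ((-(ψ / 2) : ℝ) * Complex.I)‖ = 1 :=
  Complex.norm_exp_ofReal_mul_I _

theorem re_exp_neg_half_pos {ψ : ℝ} (hψ : |ψ| < π) :
    0 < (Complex.exp ((-(ψ / 2) : ℝ) * Complex.I)).re := by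
  rw [Complex.exp_ofReal_mul_I_re, Real.cos_neg]
  exact cos_half_pos hψ

theorem re_mul_kernelW_pos (hμc : ContinuousOn μ (Icc 0 1))
    (hμ0 : ∀ α ∈ Icc (0 : ℝ) 1, 0 ≤ μ α) (hμ1 : 0 < μ 1) {ρ ψ : ℝ} (hρ : 0 < ρ) (hψ : |ψ| < π) :
    0 < (Complex.exp ((-(ψ / 2) : ℝ) * Complex.I) *
      (ρ * Complex.exp (ψ * Complex.I) * kernelW μ (ρ * Complex.exp (ψ * Complex.I)))).re :=
  (mul_pos (cos_half_pos hψ) (kernelSymbol_pos hμc hμ0 hμ1 hρ)).trans_le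
    (cos_mul_kernelSymbol_le hμc hμ0 hρ hψ)

theorem exists_polar_eq {z : ℂ} (hz : z ∈ Complex.slitPlane) :
    ∃ ρ ψ : ℝ, 0 < ρ ∧ |ψ| < π ∧ z = ρ * Complex.exp (ψ * Complex.I) := by
  refine ⟨‖z‖, z.arg, norm_pos_iff.2 (Complex.slitPlane_ne_zero hz), ?_,
    (Complex.norm_mul_exp_arg_mul_I z).symm⟩
  rw [Complex.mem_slitPlane_iff_arg] at hz
  exact abs_lt.2 ⟨Complex.neg_pi_lt_arg z, lt_of_le_of_ne (Complex.arg_le_pi z) hz.1⟩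

variable (Ω μ) in
/-- `R(z) = (z w(z) I + A)⁻¹`. -/
def resolventKernel (z : ℂ) : L2 Ω →L[ℂ] L2 Ω := shiftInverse Ω (z * kernelW μ z)

theorem isShiftInverse_resolventKernel (hμc : ContinuousOn μ (Icc 0 1))
    (hμ0 : ∀ α ∈ Icc (0 : ℝ) 1, 0 ≤ μ α) (hμ1 : 0 < μ 1) {z : ℂ} (hz : z ∈ Complex.slitPlane) :
    IsShiftInverse Ω (z * kernelW μ z) (resolventKernel Ω μ z) := by
  obtain ⟨ρ, ψ, hρ, hψ, rfl⟩ := exists_polar_eq hz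
  exact isShiftInverse_shiftInverse (norm_exp_neg_half ψ) (re_exp_neg_half_pos hψ)
    (re_mul_kernelW_pos hμc hμ0 hμ1 hρ hψ)

theorem differentiableAt_resolventKernel (hμc : ContinuousOn μ (Icc 0 1))
    (hμ0 : ∀ α ∈ Icc (0 : ℝ) 1, 0 ≤ μ α) (hμ1 : 0 < μ 1) {z : ℂ} (hz : z ∈ Complex.slitPlane) :
    DifferentiableAt ℂ (resolventKernel Ω μ) z := by
  have h1 : DifferentiableAt ℂ (fun z => z * kernelW μ z) z :=
    differentiableAt_id.mul (differentiableAt_kernelW hμc hz)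
  refine DifferentiableAt.comp (g := shiftInverse Ω) z ?_ h1
  obtain ⟨ρ, ψ, hρ, hψ, rfl⟩ := exists_polar_eq hz
  exact differentiableAt_shiftInverse (norm_exp_neg_half ψ) (re_exp_neg_half_pos hψ)
    (re_mul_kernelW_pos hμc hμ0 hμ1 hρ hψ)

theorem norm_resolventKernel_le_inv (hμc : ContinuousOn μ (Icc 0 1))
    (hμ0 : ∀ α ∈ Icc (0 : ℝ) 1, 0 ≤ μ α) (hμ1 : 0 < μ 1) {θ ρ ψ : ℝ} (hθ' : θ < π)
    (hρ : 0 < ρ) (hψ : |ψ| ≤ θ) :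
    ‖resolventKernel Ω μ (ρ * Complex.exp (ψ * Complex.I))‖ ≤
      (Real.cos (θ / 2))⁻¹ * (kernelSymbol μ ρ)⁻¹ := by
  have hψ' : |ψ| < π := hψ.trans_lt hθ'
  have hθ0 : 0 ≤ θ := (abs_nonneg ψ).trans hψ
  have hcos : Real.cos (θ / 2) ≤ Real.cos (ψ / 2) := by
    rw [← Real.cos_abs (ψ / 2)]
    refine Real.cos_le_cos_of_nonneg_of_le_pi (abs_nonneg _) (by linarith) ?_
    rw [abs_div, abs_two]
    linarith
  have hθc : 0 < Real.cos (θ / 2) := cos_half_pos (by rwa [abs_of_nonneg hθ0])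
  have hS := kernelSymbol_pos hμc hμ0 hμ1 hρ
  refine (norm_shiftInverse_le (norm_exp_neg_half ψ) (re_exp_neg_half_pos hψ')
    (re_mul_kernelW_pos hμc hμ0 hμ1 hρ hψ')).trans ?_
  rw [← mul_inv]
  exact inv_anti₀ (mul_pos hθc hS) ((mul_le_mul_of_nonneg_right hcos hS.le).trans
    (cos_mul_kernelSymbol_le hμc hμ0 hρ hψ'))

/-- Orders close to `1` carry no point mass, so the resolvent decays only like `log ρ / ρ`. The
dependence on the sector is explicit through `cos(θ/2)`. -/
theorem exists_norm_resolventKernel_le (hμc : ContinuousOn μ (Icc 0 1))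
    (hμ0 : ∀ α ∈ Icc (0 : ℝ) 1, 0 ≤ μ α) (hμ1 : 0 < μ 1) :
    ∃ c, 0 < c ∧ ∀ θ ρ ψ : ℝ, θ < π → 0 < ρ → |ψ| ≤ θ →
      ‖resolventKernel Ω μ (ρ * Complex.exp (ψ * Complex.I))‖ ≤
        c * (Real.cos (θ / 2))⁻¹ * (Real.log (max ρ 2) / ρ) := by
  obtain ⟨c, hc, h⟩ := exists_le_kernelSymbol hμc hμ0 hμ1
  refine ⟨c⁻¹, inv_pos.2 hc, fun θ ρ ψ hθ' hρ hψ => ?_⟩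
  have hθ0 : 0 ≤ θ := (abs_nonneg ψ).trans hψ
  have hθc : 0 < Real.cos (θ / 2) := cos_half_pos (by rwa [abs_of_nonneg hθ0])
  have hl : 0 < Real.log (max ρ 2) := Real.log_pos (lt_max_of_lt_right one_lt_two)
  refine (norm_resolventKernel_le_inv hμc hμ0 hμ1 hθ' hρ hψ).trans ?_
  calc _ ≤ (Real.cos (θ / 2))⁻¹ * (c * ρ / Real.log (max ρ 2))⁻¹ :=
        mul_le_mul_of_nonneg_left (inv_anti₀ (by positivity) (h ρ hρ)) (by positivity)
    _ = _ := by rw [inv_div]; field_simp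

theorem isSectorial_resolventKernel (hμc : ContinuousOn μ (Icc 0 1))
    (hμ0 : ∀ α ∈ Icc (0 : ℝ) 1, 0 ≤ μ α) (hμ1 : 0 < μ 1) :
    IsSectorial (resolventKernel Ω μ) := by
  obtain ⟨c, hc, h⟩ := exists_norm_resolventKernel_le (Ω := Ω) hμc hμ0 hμ1
  refine ⟨fun z hz => differentiableAt_resolventKernel hμc hμ0 hμ1 hz, fun θ δ hθ hθ' hδ =>
    ⟨c * (Real.cos (θ / 2))⁻¹ * (1 + 2 / δ), 0, ?_, fun ρ ψ hρ hψ => ?_⟩⟩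
  all_goals have hθc : 0 < Real.cos (θ / 2) := cos_half_pos (by rwa [abs_of_nonneg hθ.le])
  · positivity
  · have hρ0 : 0 < ρ := hδ.trans_le hρ
    rw [pow_zero, mul_one]
    refine (h θ ρ ψ hθ' hρ0 hψ).trans (mul_le_mul_of_nonneg_left ?_ (by positivity))
    have h1 : Real.log (max ρ 2) ≤ ρ + 2 :=
      (Real.log_le_self (by positivity)).trans (max_le (by linarith) (by linarith))
    rw [div_le_iff₀ hρ0, add_mul, one_mul]
    refine h1.trans (add_le_add le_rfl ?_)
    rw [div_mul_eq_mul_div, le_div_iff₀ hδ]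
    linarith

theorem isSectorial_kernelH (hμc : ContinuousOn μ (Icc 0 1))
    (hμ0 : ∀ α ∈ Icc (0 : ℝ) 1, 0 ≤ μ α) (hμ1 : 0 < μ 1) : IsSectorial (kernelH Ω μ) :=
  (isSectorial_kernelW hμc hμ0).smul (isSectorial_resolventKernel hμc hμ0 hμ1)

/-- `kernelSymbol μ ρ` bounds `|z w(z)|` from above and appears inverted in the resolvent bound. The
two cancel, no logarithm is lost, and `cos(π/3)⁻¹ = 2` remains. -/
theorem norm_mul_kernelW_smul_le (hμc : ContinuousOn μ (Icc 0 1))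
    (hμ0 : ∀ α ∈ Icc (0 : ℝ) 1, 0 ≤ μ α) (hμ1 : 0 < μ 1) {ρ ψ : ℝ} (hρ : 0 < ρ)
    (hψ : |ψ| ≤ 2 * π / 3) :
    ‖(ρ * Complex.exp (ψ * Complex.I) * kernelW μ (ρ * Complex.exp (ψ * Complex.I))) •
      resolventKernel Ω μ (ρ * Complex.exp (ψ * Complex.I))‖ ≤ 2 := by
  have hπ := Real.pi_pos
  have hS := kernelSymbol_pos hμc hμ0 hμ1 hρ
  have h1 := norm_resolventKernel_le_inv (Ω := Ω) hμc hμ0 hμ1 (by linarith : 2 * π / 3 < π) hρ hψ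
  rw [show 2 * π / 3 / 2 = π / 3 by ring, Real.cos_pi_div_three] at h1
  have h2 := norm_mul_kernelW_le hμc hμ0 (Complex.slitPlane_ne_zero
    (polar_mem_slitPlane hρ (hψ.trans_lt (by linarith))))
  rw [norm_polar hρ.le] at h2
  rw [norm_smul]
  calc _ ≤ kernelSymbol μ ρ * ((1 / 2)⁻¹ * (kernelSymbol μ ρ)⁻¹) :=
        mul_le_mul h2 h1 (norm_nonneg _) hS.le
    _ = 2 := by field_simp

theorem norm_kernelH_le (hμc : ContinuousOn μ (Icc 0 1))
    (hμ0 : ∀ α ∈ Icc (0 : ℝ) 1, 0 ≤ μ α) (hμ1 : 0 < μ 1) {ρ ψ : ℝ} (hρ : 0 < ρ)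
    (hψ : |ψ| ≤ 2 * π / 3) :
    ‖kernelH Ω μ (ρ * Complex.exp (ψ * Complex.I))‖ ≤ 2 / ρ := by
  have h := norm_mul_kernelW_smul_le (Ω := Ω) hμc hμ0 hμ1 hρ hψ
  rw [mul_smul, norm_smul, norm_polar hρ.le] at h
  rwa [le_div_iff₀' hρ]

variable (Ω μ) in
/-- `A H(z) = w(z) (I - z w(z) R(z))`. -/
def laplacianKernelH (z : ℂ) : L2 Ω →L[ℂ] L2 Ω :=
  kernelW μ z • (1 - (z * kernelW μ z) • resolventKernel Ω μ z)

theorem isSectorial_laplacianKernelH (hμc : ContinuousOn μ (Icc 0 1))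
    (hμ0 : ∀ α ∈ Icc (0 : ℝ) 1, 0 ≤ μ α) (hμ1 : 0 < μ 1) :
    IsSectorial (laplacianKernelH Ω μ) :=
  (isSectorial_kernelW hμc hμ0).smul ((isSectorial_const _).sub
    ((isSectorial_id.smul (isSectorial_kernelW hμc hμ0)).smul
      (isSectorial_resolventKernel hμc hμ0 hμ1)))

theorem norm_laplacianKernelH_le (hμc : ContinuousOn μ (Icc 0 1))
    (hμ0 : ∀ α ∈ Icc (0 : ℝ) 1, 0 ≤ μ α) (hμ1 : 0 < μ 1) {ρ ψ : ℝ} (hρ : 0 < ρ)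
    (hψ : |ψ| ≤ 2 * π / 3) :
    ‖laplacianKernelH Ω μ (ρ * Complex.exp (ψ * Complex.I))‖ ≤
      3 * ‖kernelW μ (ρ * Complex.exp (ψ * Complex.I))‖ := by
  rw [laplacianKernelH, norm_smul, mul_comm]
  refine mul_le_mul_of_nonneg_right ?_ (norm_nonneg _)
  have h1 : ‖(1 : L2 Ω →L[ℂ] L2 Ω)‖ ≤ 1 := ContinuousLinearMap.norm_id_le
  linarith [norm_sub_le (1 : L2 Ω →L[ℂ] L2 Ω) ((ρ * Complex.exp (ψ * Complex.I) *
    kernelW μ (ρ * Complex.exp (ψ * Complex.I))) •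
      resolventKernel Ω μ (ρ * Complex.exp (ψ * Complex.I))),
    norm_mul_kernelW_smul_le (Ω := Ω) hμc hμ0 hμ1 hρ hψ]

theorem kernelH_mem_domain (hμc : ContinuousOn μ (Icc 0 1))
    (hμ0 : ∀ α ∈ Icc (0 : ℝ) 1, 0 ≤ μ α) (hμ1 : 0 < μ 1) {z : ℂ} (hz : z ∈ Complex.slitPlane)
    (a : ℂ) (f : L2 Ω) : ∃ h : a • kernelH Ω μ z f ∈ (dirichletLaplacian Ω).domain,
      dirichletLaplacian Ω ⟨a • kernelH Ω μ z f, h⟩ = a • laplacianKernelH Ω μ z f := by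
  obtain ⟨h1, h2⟩ := (isShiftInverse_resolventKernel (Ω := Ω) hμc hμ0 hμ1 hz).1 f
  have h3 : a • kernelH Ω μ z f = (a * kernelW μ z) • resolventKernel Ω μ z f := by
    rw [kernelH, smul_apply, smul_smul]
    rfl
  have h4 : a • kernelH Ω μ z f ∈ (dirichletLaplacian Ω).domain := by
    rw [h3]
    exact Submodule.smul_mem _ _ h1
  refine ⟨h4, ?_⟩
  have h5 : (⟨a • kernelH Ω μ z f, h4⟩ : (dirichletLaplacian Ω).domain) =
      (a * kernelW μ z) • ⟨_, h1⟩ := Subtype.ext h3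
  rw [h5, LinearPMap.map_smul, eq_sub_of_add_eq' h2, laplacianKernelH, smul_apply, sub_apply,
    smul_apply, smul_smul, one_apply_eq_self]

/-- `A` commutes with its resolvent, so on `D(A)` bounds for `A S` reduce to bounds for `S` applied
to `A v`. -/
theorem laplacianKernelH_apply (hμc : ContinuousOn μ (Icc 0 1))
    (hμ0 : ∀ α ∈ Icc (0 : ℝ) 1, 0 ≤ μ α) (hμ1 : 0 < μ 1) {z : ℂ} (hz : z ∈ Complex.slitPlane)
    (v : (dirichletLaplacian Ω).domain) :
    laplacianKernelH Ω μ z (v : L2 Ω) = kernelH Ω μ z (dirichletLaplacian Ω v) := by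
  have h := (isShiftInverse_resolventKernel (Ω := Ω) hμc hμ0 hμ1 hz).2 v
  rw [map_add, map_smul] at h
  rw [laplacianKernelH, smul_apply, sub_apply, smul_apply, one_apply_eq_self,
    ← eq_sub_of_add_eq' h, kernelH, smul_apply]
  rfl

/-- Splits off `v`, which is constant in `z` and therefore invisible to the inverse transform for `t
> 0`. What remains has the decay of the resolvent. -/
theorem smul_kernelH_apply (hμc : ContinuousOn μ (Icc 0 1))
    (hμ0 : ∀ α ∈ Icc (0 : ℝ) 1, 0 ≤ μ α) (hμ1 : 0 < μ 1) {z : ℂ} (hz : z ∈ Complex.slitPlane)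
    (v : (dirichletLaplacian Ω).domain) :
    z • kernelH Ω μ z (v : L2 Ω) = v - resolventKernel Ω μ z (dirichletLaplacian Ω v) := by
  have h := (isShiftInverse_resolventKernel (Ω := Ω) hμc hμ0 hμ1 hz).2 v
  rw [map_add, map_smul] at h
  rw [eq_sub_iff_add_eq, kernelH, smul_apply, smul_smul]
  exact h

end ResolventKernel

/-! ### Estimates for the solution operator, initial value and differential equation. -/

noncomputable section SolutionOperator

theorem log_max_two_pos (x : ℝ) : 0 < Real.log (max x 2) :=
  Real.log_pos (lt_max_of_lt_right one_lt_two)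

/-- Replaces the logarithm by the power `s^{-1/2}`, the form of singularity and decay in which the
fractional integration results are stated. -/
theorem log_max_inv_two_le {s T : ℝ} (hs : 0 < s) (hsT : s ≤ T) :
    Real.log (max s⁻¹ 2) ≤ 2 * (1 + 2 * T) ^ (1 / 2 : ℝ) * s ^ (-(1 / 2) : ℝ) := by
  have h1 : max s⁻¹ 2 ≤ (1 + 2 * T) * s⁻¹ := by
    have h2 : 2 ≤ 2 * T * s⁻¹ := by
      rw [← div_eq_mul_inv, le_div_iff₀ hs]
      linarith
    have h3 : 0 < s⁻¹ := inv_pos.2 hs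
    exact max_le (by nlinarith) (by linarith)
  have h0 : 0 < max s⁻¹ 2 := lt_max_of_lt_right two_pos
  have hT : 0 < T := hs.trans_le hsT
  calc Real.log (max s⁻¹ 2) ≤ (max s⁻¹ 2) ^ (1 / 2 : ℝ) / (1 / 2) :=
        Real.log_le_rpow_div h0.le (by norm_num)
    _ ≤ ((1 + 2 * T) * s⁻¹) ^ (1 / 2 : ℝ) / (1 / 2) := by gcongr
    _ = _ := by
      rw [Real.mul_rpow (by positivity) (by positivity), Real.inv_rpow hs.le, ← Real.rpow_neg hs.le]
      ring

theorem log_max_two_div_le {ρ : ℝ} (hρ : 1 ≤ ρ) :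
    Real.log (max ρ 2) / ρ ≤ 4 * ρ ^ (-(1 / 2) : ℝ) := by
  have hρ0 : 0 < ρ := one_pos.trans_le hρ
  have h := log_max_inv_two_le (s := ρ⁻¹) (T := 1) (inv_pos.2 hρ0) (inv_le_one_of_one_le₀ hρ)
  rw [inv_inv, Real.inv_rpow hρ0.le, ← Real.rpow_neg hρ0.le, neg_neg] at h
  have h3 : (1 + 2 * 1 : ℝ) ^ (1 / 2 : ℝ) ≤ 2 := by
    rw [← Real.sqrt_eq_rpow, Real.sqrt_le_left two_pos.le]
    norm_num
  have h4 : ρ ^ (1 / 2 : ℝ) = ρ ^ (-(1 / 2) : ℝ) * ρ := by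
    nth_rw 3 [← Real.rpow_one ρ]
    rw [← Real.rpow_add hρ0]
    norm_num
  have h5 : 0 ≤ ρ ^ (1 / 2 : ℝ) := by positivity
  rw [div_le_iff₀ hρ0, mul_assoc, ← h4]
  nlinarith

section Caputo

variable {X : Type*} [NormedAddCommGroup X] [NormedSpace ℂ X] {μ : ℝ → ℝ} {θ C t : ℝ} {F : ℂ → X}
  {u : ℝ → X}

theorem intervalIntegrable_sub_rpow_smul_deriv (hF : IsSectorial F) (hθ : π / 2 < θ) (hθ' : θ < π)
    (hbd : ∀ T, 0 < T → ∃ D, ∀ s, 0 < s → s ≤ T →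
      ‖laplaceInv θ 1 F s‖ ≤ D * s ^ (-(1 / 2) : ℝ))
    (hu : ∀ s, 0 < s → HasDerivAt u (laplaceInv θ 1 F s) s) (ht : 0 < t) {α : ℝ}
    (hα : α ∈ Ioo (0 : ℝ) 1) :
    IntervalIntegrable (fun s => (t - s) ^ (-α) • deriv u s) volume 0 t := by
  have hcont : ContinuousOn (laplaceInv θ 1 F) (Ioi 0) := fun s hs =>
    (hF.hasDerivAt_laplaceInv hθ hθ' one_pos hs).continuousAt.continuousWithinAt
  obtain ⟨D, hD⟩ := hbd t ht
  refine (intervalIntegrable_sub_rpow_smul hcont hα.2 hα.1.le ht hD).congr fun s hs => ?_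
  rw [uIoc_of_le ht.le] at hs
  rw [(hu s hs.1).deriv]

theorem caputoDeriv_eq_laplaceInv [CompleteSpace X] (hF : IsSectorial F) (hθ : π / 2 < θ)
    (hθ' : θ < π) (hC : ∀ ρ ψ : ℝ, 1 ≤ ρ → |ψ| ≤ θ →
      ‖F (ρ * Complex.exp (ψ * Complex.I))‖ ≤ C * ρ ^ (-(1 / 2) : ℝ))
    (hbd : ∀ T, 0 < T → ∃ D, ∀ s, 0 < s → s ≤ T →
      ‖laplaceInv θ 1 F s‖ ≤ D * s ^ (-(1 / 2) : ℝ))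
    (hu : ∀ s, 0 < s → HasDerivAt u (laplaceInv θ 1 F s) s) (ht : 0 < t) {α : ℝ}
    (hα : α ∈ Ioo (0 : ℝ) 1) :
    caputoDeriv α u t = laplaceInv θ 1 (fun z => z ^ ((α : ℂ) - 1) • F z) t := by
  have h1 : ∫ s in (0 : ℝ)..t, (t - s) ^ (-α) • deriv u s =
      ∫ s in (0 : ℝ)..t, (t - s) ^ (-α) • laplaceInv θ 1 F s := by
    rw [intervalIntegral.integral_of_le ht.le, intervalIntegral.integral_of_le ht.le]
    refine setIntegral_congr_fun measurableSet_Ioc fun s hs => ?_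
    rw [(hu s hs.1).deriv]
  rw [caputoDeriv, h1, hF.integral_sub_rpow_smul_laplaceInv hθ hθ' hC hbd hα.1.le hα.2 ht,
    inv_smul_smul₀ (Real.Gamma_pos_of_pos (by linarith [hα.2])).ne']

theorem distributedDeriv_eq_laplaceInv [CompleteSpace X] (hμc : ContinuousOn μ (Icc 0 1))
    (hμ0 : ∀ α ∈ Icc (0 : ℝ) 1, 0 ≤ μ α) (hF : IsSectorial F) (hθ : π / 2 < θ)
    (hθ' : θ < π) (hC : ∀ ρ ψ : ℝ, 1 ≤ ρ → |ψ| ≤ θ →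
      ‖F (ρ * Complex.exp (ψ * Complex.I))‖ ≤ C * ρ ^ (-(1 / 2) : ℝ))
    (hbd : ∀ T, 0 < T → ∃ D, ∀ s, 0 < s → s ≤ T →
      ‖laplaceInv θ 1 F s‖ ≤ D * s ^ (-(1 / 2) : ℝ))
    (hu : ∀ s, 0 < s → HasDerivAt u (laplaceInv θ 1 F s) s) (ht : 0 < t) :
    IntervalIntegrable (fun α => μ α • caputoDeriv α u t) volume 0 1 ∧
      distributedDeriv μ u t = laplaceInv θ 1 (fun z => kernelW μ z • F z) t := by
  have hae : ∀ᵐ α ∂(volume : Measure ℝ), α ∈ uIoc (0 : ℝ) 1 →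
      μ α • laplaceInv θ 1 (fun z => z ^ ((α : ℂ) - 1) • F z) t = μ α • caputoDeriv α u t := by
    -- The order `α = 1`, where the fractional integral formula is not available, is a null set.
    filter_upwards [compl_mem_ae_iff.2 (measure_singleton (1 : ℝ))] with α hα hα'
    rw [uIoc_of_le zero_le_one] at hα'
    rw [caputoDeriv_eq_laplaceInv hF hθ hθ' hC hbd hu ht ⟨hα'.1, lt_of_le_of_ne hα'.2 hα⟩]
  refine ⟨(hF.intervalIntegrable_smul_laplaceInv hμc hθ hθ' ht).congr_ae
    ((ae_restrict_iff' measurableSet_uIoc).2 hae), ?_⟩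
  rw [distributedDeriv, ← intervalIntegral.integral_congr_ae hae,
    hF.integral_smul_laplaceInv hμc hμ0 hθ hθ' ht]

end Caputo

variable {d : ℕ} {Ω : Opens (EuclideanSpace ℝ (Fin d))} {μ : ℝ → ℝ} {θ δ t : ℝ}

theorem iteratedDeriv_solutionOp_apply (hμc : ContinuousOn μ (Icc 0 1))
    (hμ0 : ∀ α ∈ Icc (0 : ℝ) 1, 0 ≤ μ α) (hμ1 : 0 < μ 1) (hθ : π / 2 < θ) (hθ' : θ < π)
    (hδ : 0 < δ) (ht : 0 < t) (m : ℕ) (v : L2 Ω) :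
    iteratedDeriv m (solutionOp Ω μ θ δ) t v =
      laplaceInv θ δ (fun z => z ^ m • kernelH Ω μ z v) t := by
  have h := isSectorial_kernelH (Ω := Ω) hμc hμ0 hμ1
  have h1 : iteratedDeriv m (solutionOp Ω μ θ δ) t =
      laplaceInv θ δ (fun z => z ^ m • kernelH Ω μ z) t :=
    h.iteratedDeriv_laplaceInv hθ hθ' hδ ht m
  rw [h1]
  exact ((isSectorial_pow m).smul h).clm_laplaceInv
    (ContinuousLinearMap.apply ℂ (L2 Ω) v) hθ hθ' hδ ht

theorem solutionOp_apply (hμc : ContinuousOn μ (Icc 0 1))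
    (hμ0 : ∀ α ∈ Icc (0 : ℝ) 1, 0 ≤ μ α) (hμ1 : 0 < μ 1) (hθ : π / 2 < θ) (hθ' : θ < π)
    (hδ : 0 < δ) (ht : 0 < t) (v : L2 Ω) :
    solutionOp Ω μ θ δ t v = laplaceInv θ δ (fun z => kernelH Ω μ z v) t := by
  simpa using iteratedDeriv_solutionOp_apply hμc hμ0 hμ1 hθ hθ' hδ ht 0 v

theorem isSectorial_pow_smul_apply {K : ℂ → L2 Ω →L[ℂ] L2 Ω} (hK : IsSectorial K) (m : ℕ)
    (v : L2 Ω) : IsSectorial fun z => z ^ m • K z v :=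
  (isSectorial_pow m).smul (hK.clm (ContinuousLinearMap.apply ℂ (L2 Ω) v))

/-- The identity `ρ^m = t^{-m} (tρ)^m` puts a derivative of order `m` into the scaled form that the
contour estimate expects. -/
theorem norm_pow_smul_apply_le (K : ℂ → L2 Ω →L[ℂ] L2 Ω) {ρ ψ B : ℝ} (hρ : 0 < ρ) (ht : 0 < t)
    (m : ℕ) (v : L2 Ω) (h : ‖K (ρ * Complex.exp (ψ * Complex.I))‖ ≤ B) :
    ‖(ρ * Complex.exp (ψ * Complex.I)) ^ m • K (ρ * Complex.exp (ψ * Complex.I)) v‖ ≤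
      B * t ^ (-(m : ℤ)) * ‖v‖ * (t * ρ) ^ m := by
  rw [norm_smul, norm_pow, norm_polar hρ.le, zpow_neg, zpow_natCast, mul_pow]
  calc _ ≤ ρ ^ m * (B * ‖v‖) := by
        gcongr
        exact (ContinuousLinearMap.le_opNorm _ _).trans (by gcongr)
    _ = _ := by field_simp

theorem norm_iteratedDeriv_solutionOp_le (hμc : ContinuousOn μ (Icc 0 1))
    (hμ0 : ∀ α ∈ Icc (0 : ℝ) 1, 0 ≤ μ α) (hμ1 : 0 < μ 1) (hθ : π / 2 < θ) (hθ' : θ < π)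
    (hδ : 0 < δ) (ht : 0 < t) (m : ℕ) (v : L2 Ω) :
    ‖iteratedDeriv m (solutionOp Ω μ θ δ) t v‖ ≤
      2 * laplaceConst m * t ^ (-(m : ℤ)) * ‖v‖ := by
  rw [iteratedDeriv_solutionOp_apply hμc hμ0 hμ1 hθ hθ' hδ ht]
  refine ((isSectorial_pow_smul_apply (isSectorial_kernelH hμc hμ0 hμ1) m v).norm_laplaceInv_le
    (M := 2 * t * t ^ (-(m : ℤ)) * ‖v‖) hθ hθ' hδ ht m fun ρ ψ hρ hψ => ?_).trans_eq ?_
  · have hρ0 : 0 < ρ := pos_of_mul_pos_right (one_pos.trans_le hρ) ht.le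
    refine norm_pow_smul_apply_le _ hρ0 ht m v ((norm_kernelH_le hμc hμ0 hμ1 hρ0 hψ).trans ?_)
    rw [div_le_iff₀ hρ0]
    linarith
  · field_simp

theorem exists_laplacian_iteratedDeriv_solutionOp_eq (hμc : ContinuousOn μ (Icc 0 1))
    (hμ0 : ∀ α ∈ Icc (0 : ℝ) 1, 0 ≤ μ α) (hμ1 : 0 < μ 1) (hθ : π / 2 < θ) (hθ' : θ < π)
    (hδ : 0 < δ) (ht : 0 < t) (m : ℕ) (v : L2 Ω) :
    ∃ h : iteratedDeriv m (solutionOp Ω μ θ δ) t v ∈ (dirichletLaplacian Ω).domain,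
      dirichletLaplacian Ω ⟨iteratedDeriv m (solutionOp Ω μ θ δ) t v, h⟩ =
        laplaceInv θ δ (fun z => z ^ m • laplacianKernelH Ω μ z v) t := by
  rw [iteratedDeriv_solutionOp_apply hμc hμ0 hμ1 hθ hθ' hδ ht]
  exact laplaceInv_mem_domain (isSectorial_pow_smul_apply (isSectorial_kernelH hμc hμ0 hμ1) m v)
    (isSectorial_pow_smul_apply (isSectorial_laplacianKernelH hμc hμ0 hμ1) m v)
    (fun z hz => kernelH_mem_domain hμc hμ0 hμ1 hz (z ^ m) v) hθ hθ' hδ ht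

theorem exists_norm_laplaceInv_laplacianKernelH_le (hμc : ContinuousOn μ (Icc 0 1))
    (hμ0 : ∀ α ∈ Icc (0 : ℝ) 1, 0 ≤ μ α) (hμ1 : 0 < μ 1) (m : ℕ) {T : ℝ} (hT : 0 < T) :
    ∃ c, 0 ≤ c ∧ ∀ θ δ t : ℝ, π / 2 < θ → θ < π → 0 < δ → 0 < t → t ≤ T → ∀ v : L2 Ω,
      ‖laplaceInv θ δ (fun z => z ^ m • laplacianKernelH Ω μ z v) t‖ ≤
        c * t ^ (-(m : ℤ) - 1) * (Real.log (2 * T / t))⁻¹ * ‖v‖ := by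
  obtain ⟨K, hK, h⟩ := exists_norm_kernelW_le hμc hμ0 hT
  refine ⟨laplaceConst m * (3 * K), by have := laplaceConst_pos m; positivity,
    fun θ δ t hθ hθ' hδ ht htT v => ?_⟩
  refine ((isSectorial_pow_smul_apply (isSectorial_laplacianKernelH hμc hμ0 hμ1)
    m v).norm_laplaceInv_le (M := 3 * (K * (Real.log (2 * T / t))⁻¹) * t ^ (-(m : ℤ)) * ‖v‖)
    hθ hθ' hδ ht m fun ρ ψ hρ hψ => ?_).trans_eq ?_
  · have hρ0 : 0 < ρ := pos_of_mul_pos_right (one_pos.trans_le hρ) ht.le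
    refine norm_pow_smul_apply_le _ hρ0 ht m v
      ((norm_laplacianKernelH_le hμc hμ0 hμ1 hρ0 hψ).trans ?_)
    exact mul_le_mul_of_nonneg_left (h t ht htT _ (by rwa [norm_polar hρ0.le])) (by norm_num)
  · rw [zpow_sub₀ ht.ne', zpow_one]
    ring

theorem laplaceInv_laplacianKernelH_apply (hμc : ContinuousOn μ (Icc 0 1))
    (hμ0 : ∀ α ∈ Icc (0 : ℝ) 1, 0 ≤ μ α) (hμ1 : 0 < μ 1) (hθ : π / 2 < θ) (hθ' : θ < π)
    (hδ : 0 < δ) (ht : 0 < t) (m : ℕ) (v : (dirichletLaplacian Ω).domain) :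
    laplaceInv θ δ (fun z => z ^ m • laplacianKernelH Ω μ z (v : L2 Ω)) t =
      iteratedDeriv m (solutionOp Ω μ θ δ) t (dirichletLaplacian Ω v) := by
  rw [iteratedDeriv_solutionOp_apply hμc hμ0 hμ1 hθ hθ' hδ ht]
  refine congrFun (laplaceInv_congr (by linarith [Real.pi_pos]) hθ' hδ fun z hz => ?_) t
  rw [laplacianKernelH_apply hμc hμ0 hμ1 hz]

variable (Ω) in
theorem exists_norm_laplaceInv_resolventKernel_le (hμc : ContinuousOn μ (Icc 0 1))
    (hμ0 : ∀ α ∈ Icc (0 : ℝ) 1, 0 ≤ μ α) (hμ1 : 0 < μ 1) :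
    ∃ c, 0 < c ∧ ∀ (θ δ t : ℝ) (n : ℕ), π / 2 < θ → θ < π → 0 < δ → 0 < t → ∀ f : L2 Ω,
      ‖laplaceInv θ δ (fun z => z ^ n • resolventKernel Ω μ z f) t‖ ≤
        c * laplaceConst n * t ^ (-(n : ℤ)) * Real.log (max t⁻¹ 2) * ‖f‖ ∧
      ‖laplaceInv θ δ (fun z => z⁻¹ • resolventKernel Ω μ z f) t‖ ≤
        c * laplaceConst 0 * (t * Real.log (max t⁻¹ 2)) * ‖f‖ := by
  have hπ := Real.pi_pos
  obtain ⟨c, hc, h⟩ := exists_norm_resolventKernel_le (Ω := Ω) hμc hμ0 hμ1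
  have hR := isSectorial_resolventKernel (Ω := Ω) hμc hμ0 hμ1
  -- The factor `6` is `cos(π/3)⁻¹ = 2` times the `3` from `log_max_two_le`. In the second estimate
  -- `|z⁻¹| ≤ t` gains one further power of `t`.
  refine ⟨6 * c, by positivity, fun θ δ t n hθ hθ' hδ ht f => ?_⟩
  set l := Real.log (max t⁻¹ 2) with hl
  have hl0 : 0 < l := log_max_two_pos _
  have key : ∀ ρ ψ : ℝ, 1 ≤ t * ρ → |ψ| ≤ 2 * π / 3 → 0 < ρ ∧
      ‖resolventKernel Ω μ (ρ * Complex.exp (ψ * Complex.I))‖ ≤ 6 * c * l * t := by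
    intro ρ ψ hρ hψ
    have hρ0 : 0 < ρ := pos_of_mul_pos_right (one_pos.trans_le hρ) ht.le
    have h1 := h (2 * π / 3) ρ ψ (by linarith) hρ0 hψ
    rw [show 2 * π / 3 / 2 = π / 3 by ring, Real.cos_pi_div_three] at h1
    refine ⟨hρ0, h1.trans ?_⟩
    have h2 : Real.log (max ρ 2) / ρ ≤ 3 * l * t := by
      rw [div_le_iff₀ hρ0, mul_assoc]
      exact log_max_two_le ht hρ
    calc c * (1 / 2)⁻¹ * (Real.log (max ρ 2) / ρ) ≤ c * (1 / 2)⁻¹ * (3 * l * t) := by gcongr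
      _ = _ := by ring
  constructor
  · refine ((isSectorial_pow_smul_apply hR n f).norm_laplaceInv_le
      (M := 6 * c * l * t * t ^ (-(n : ℤ)) * ‖f‖) hθ hθ' hδ ht n fun ρ ψ hρ hψ => ?_).trans_eq ?_
    · obtain ⟨hρ0, h1⟩ := key ρ ψ hρ hψ
      exact norm_pow_smul_apply_le _ hρ0 ht n f h1
    · field_simp
  · refine ((isSectorial_inv.smul (hR.clm (ContinuousLinearMap.apply ℂ
      (L2 Ω) f))).norm_laplaceInv_le (M := t * (6 * c * l * t * ‖f‖)) hθ hθ' hδ ht 0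
      fun ρ ψ hρ hψ => ?_).trans_eq ?_
    · obtain ⟨hρ0, h1⟩ := key ρ ψ hρ hψ
      rw [norm_smul, norm_inv, norm_polar hρ0.le, pow_zero, mul_one]
      have h2 : ρ⁻¹ ≤ t := by rwa [inv_le_iff_one_le_mul₀ hρ0]
      refine mul_le_mul h2 (((resolventKernel Ω μ _).le_opNorm f).trans ?_) (norm_nonneg _) ht.le
      exact mul_le_mul_of_nonneg_right h1 (norm_nonneg f)
    · field_simp

/-- The symbol is `z^n (z H(z) v) = z^n v - z^n R(z) A v`, and its polynomial part has inverse
transform zero. -/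
theorem iteratedDeriv_succ_solutionOp_apply (hμc : ContinuousOn μ (Icc 0 1))
    (hμ0 : ∀ α ∈ Icc (0 : ℝ) 1, 0 ≤ μ α) (hμ1 : 0 < μ 1) (hθ : π / 2 < θ) (hθ' : θ < π)
    (hδ : 0 < δ) (ht : 0 < t) (n : ℕ) (v : (dirichletLaplacian Ω).domain) :
    iteratedDeriv (n + 1) (solutionOp Ω μ θ δ) t (v : L2 Ω) =
      -laplaceInv θ δ (fun z => z ^ n • resolventKernel Ω μ z (dirichletLaplacian Ω v)) t := by
  have h1 : IsSectorial fun z : ℂ => z ^ n • (v : L2 Ω) :=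
    (isSectorial_pow n).smul (isSectorial_const _)
  have h2 := isSectorial_pow_smul_apply (isSectorial_resolventKernel (Ω := Ω) hμc hμ0 hμ1) n
    (dirichletLaplacian Ω v)
  rw [iteratedDeriv_solutionOp_apply hμc hμ0 hμ1 hθ hθ' hδ ht, ← zero_sub,
    ← laplaceInv_pow_smul (v : L2 Ω) hθ hθ' hδ ht n,
    ← h1.laplaceInv_sub h2 (h1.sub h2) hθ hθ' hδ ht]
  refine congrFun (laplaceInv_congr (by linarith [Real.pi_pos]) hθ' hδ fun z hz => ?_) t
  rw [pow_succ, mul_smul, smul_kernelH_apply hμc hμ0 hμ1 hz, smul_sub]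

/-- Here `H(z) v = z⁻¹ v - z⁻¹ R(z) A v`, and the first term reproduces `v` exactly. The second is
of size `t log(1/t)`, a rate of convergence for data in `D(A)`. -/
theorem solutionOp_sub_apply (hμc : ContinuousOn μ (Icc 0 1))
    (hμ0 : ∀ α ∈ Icc (0 : ℝ) 1, 0 ≤ μ α) (hμ1 : 0 < μ 1) (hθ : π / 2 < θ) (hθ' : θ < π)
    (hδ : 0 < δ) (ht : 0 < t) (v : (dirichletLaplacian Ω).domain) :
    solutionOp Ω μ θ δ t (v : L2 Ω) - v =
      -laplaceInv θ δ (fun z => z⁻¹ • resolventKernel Ω μ z (dirichletLaplacian Ω v)) t := by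
  have h1 : IsSectorial fun z : ℂ => z⁻¹ • (v : L2 Ω) :=
    isSectorial_inv.smul (isSectorial_const _)
  have h2 : IsSectorial fun z : ℂ => z⁻¹ • resolventKernel Ω μ z (dirichletLaplacian Ω v) :=
    isSectorial_inv.smul ((isSectorial_resolventKernel hμc hμ0 hμ1).clm
      (ContinuousLinearMap.apply ℂ (L2 Ω) (dirichletLaplacian Ω v)))
  rw [solutionOp_apply hμc hμ0 hμ1 hθ hθ' hδ ht, sub_eq_iff_eq_add', ← sub_eq_add_neg]
  nth_rw 2 [← laplaceInv_inv_smul (v : L2 Ω) hθ hθ' hδ ht]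
  rw [← h1.laplaceInv_sub h2 (h1.sub h2) hθ hθ' hδ ht]
  refine congrFun (laplaceInv_congr (by linarith [Real.pi_pos]) hθ' hδ fun z hz => ?_) t
  rw [← smul_sub, ← smul_kernelH_apply hμc hμ0 hμ1 hz,
    inv_smul_smul₀ (Complex.slitPlane_ne_zero hz)]

theorem tendsto_mul_log_max_inv_two :
    Tendsto (fun t : ℝ => t * Real.log (max t⁻¹ 2)) (𝓝[>] 0) (𝓝 0) := by
  have h1 : Tendsto (fun t : ℝ => 2 * (1 + 2 * 1) ^ (1 / 2 : ℝ) * t ^ (1 / 2 : ℝ)) (𝓝[>] 0)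
      (𝓝 0) := by
    have h2 : ContinuousAt (fun t : ℝ => 2 * (1 + 2 * 1) ^ (1 / 2 : ℝ) * t ^ (1 / 2 : ℝ)) 0 :=
      continuousAt_const.mul (Real.continuousAt_rpow_const _ _ (Or.inr (by norm_num)))
    have h3 := h2.tendsto.mono_left (nhdsWithin_le_nhds (s := Ioi 0))
    simpa using h3
  refine squeeze_zero' ?_ ?_ h1
  · filter_upwards [self_mem_nhdsWithin] with t ht
    exact mul_nonneg (le_of_lt ht) (log_max_two_pos _).le
  · filter_upwards [self_mem_nhdsWithin, nhdsWithin_le_nhds (Iio_mem_nhds one_pos)] with t ht ht1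
    have ht0 : 0 < t := ht
    have h4 : t * t ^ (-(1 / 2) : ℝ) = t ^ (1 / 2 : ℝ) := by
      nth_rw 1 [← Real.rpow_one t]
      rw [← Real.rpow_add ht0]
      norm_num
    have h5 := mul_le_mul_of_nonneg_left (log_max_inv_two_le ht0 (le_of_lt ht1)) ht0.le
    rwa [mul_left_comm, h4] at h5

theorem tendsto_solutionOp_apply (hμc : ContinuousOn μ (Icc 0 1))
    (hμ0 : ∀ α ∈ Icc (0 : ℝ) 1, 0 ≤ μ α) (hμ1 : 0 < μ 1) (hθ : π / 2 < θ) (hθ' : θ < π)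
    (hδ : 0 < δ) (v : L2 Ω) :
    Tendsto (fun t => solutionOp Ω μ θ δ t v) (𝓝[>] 0) (𝓝 v) := by
  obtain ⟨c, hc, h⟩ := exists_norm_laplaceInv_resolventKernel_le Ω hμc hμ0 hμ1
  have hdom : ∀ w : (dirichletLaplacian Ω).domain,
      Tendsto (fun t => ‖solutionOp Ω μ θ δ t (w : L2 Ω) - w‖) (𝓝[>] 0) (𝓝 0) := by
    intro w
    have h1 := (tendsto_mul_log_max_inv_two.const_mul (c * laplaceConst 0)).mul_const
      ‖dirichletLaplacian Ω w‖
    rw [mul_zero, zero_mul] at h1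
    refine squeeze_zero' (Eventually.of_forall fun _ => norm_nonneg _) ?_ h1
    filter_upwards [self_mem_nhdsWithin] with t ht
    rw [solutionOp_sub_apply hμc hμ0 hμ1 hθ hθ' hδ ht, norm_neg]
    exact (h θ δ t 0 hθ hθ' hδ ht _).2
  set B := 2 * laplaceConst 0 with hB
  have hB0 : 0 < B := mul_pos two_pos (laplaceConst_pos 0)
  rw [tendsto_iff_norm_sub_tendsto_zero, Metric.tendsto_nhds]
  intro ε hε
  -- The share `ε / (B + 2)` is spent `B` times on `S(t)(v - w)`, once on `S(t) w - w` and once on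
  -- `v - w`.
  obtain ⟨w, hw, hwv⟩ := dense_domain.exists_dist_lt v (div_pos hε (by positivity : 0 < B + 2))
  have h2 := (hdom ⟨w, hw⟩).eventually (gt_mem_nhds (div_pos hε (by positivity : 0 < B + 2)))
  filter_upwards [h2, self_mem_nhdsWithin] with t ht1 ht
  rw [dist_zero_right, norm_norm]
  have h3 : ‖solutionOp Ω μ θ δ t (v - w)‖ ≤ B * ‖v - w‖ := by
    simpa using norm_iteratedDeriv_solutionOp_le hμc hμ0 hμ1 hθ hθ' hδ ht 0 (v - w)
  rw [dist_eq_norm] at hwv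
  have h4 : solutionOp Ω μ θ δ t v - v =
      solutionOp Ω μ θ δ t (v - w) + (solutionOp Ω μ θ δ t w - w) - (v - w) := by
    rw [map_sub]
    abel
  have h5 := norm_sub_le (solutionOp Ω μ θ δ t (v - w) + (solutionOp Ω μ θ δ t w - w)) (v - w)
  have h6 := norm_add_le (solutionOp Ω μ θ δ t (v - w)) (solutionOp Ω μ θ δ t w - w)
  rw [← h4] at h5
  have h7 : B * ‖v - w‖ < B * (ε / (B + 2)) := mul_lt_mul_of_pos_left hwv hB0
  have h8 : B * (ε / (B + 2)) + ε / (B + 2) + ε / (B + 2) = ε := by field_simp; ring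
  change ‖solutionOp Ω μ θ δ t w - w‖ < _ at ht1
  linarith

theorem exists_norm_resolventKernel_apply_le (hμc : ContinuousOn μ (Icc 0 1))
    (hμ0 : ∀ α ∈ Icc (0 : ℝ) 1, 0 ≤ μ α) (hμ1 : 0 < μ 1) (hθ : 0 ≤ θ) (hθ' : θ < π) (f : L2 Ω) :
    ∃ C, ∀ ρ ψ : ℝ, 1 ≤ ρ → |ψ| ≤ θ →
      ‖resolventKernel Ω μ (ρ * Complex.exp (ψ * Complex.I)) f‖ ≤ C * ρ ^ (-(1 / 2) : ℝ) := by
  obtain ⟨c, hc, h⟩ := exists_norm_resolventKernel_le (Ω := Ω) hμc hμ0 hμ1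
  have hθc : 0 < Real.cos (θ / 2) := cos_half_pos (by rwa [abs_of_nonneg hθ])
  refine ⟨c * (Real.cos (θ / 2))⁻¹ * 4 * ‖f‖, fun ρ ψ hρ hψ => ?_⟩
  refine (ContinuousLinearMap.le_opNorm _ _).trans ?_
  calc _ ≤ c * (Real.cos (θ / 2))⁻¹ * (4 * ρ ^ (-(1 / 2) : ℝ)) * ‖f‖ := by
        gcongr
        exact (h θ ρ ψ hθ' (one_pos.trans_le hρ) hψ).trans
          (mul_le_mul_of_nonneg_left (log_max_two_div_le hρ) (by positivity))
    _ = _ := by ring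

/-- The radius is normalized to `1`, the one for which the Laplace transform results are available.
-/
theorem hasDerivAt_solutionOp_apply (hμc : ContinuousOn μ (Icc 0 1))
    (hμ0 : ∀ α ∈ Icc (0 : ℝ) 1, 0 ≤ μ α) (hμ1 : 0 < μ 1) (hθ : π / 2 < θ) (hθ' : θ < π)
    (hδ : 0 < δ) (ht : 0 < t) (v : (dirichletLaplacian Ω).domain) :
    HasDerivAt (fun t => solutionOp Ω μ θ δ t (v : L2 Ω))
      (laplaceInv θ 1 (fun z => resolventKernel Ω μ z (-dirichletLaplacian Ω v)) t) t := by
  have hH := isSectorial_kernelH (Ω := Ω) hμc hμ0 hμ1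
  have hR := isSectorial_resolventKernel (Ω := Ω) hμc hμ0 hμ1
  have h1 : HasDerivAt (solutionOp Ω μ θ δ) (iteratedDeriv 1 (solutionOp Ω μ θ δ) t) t := by
    rw [iteratedDeriv_one]
    exact (hH.hasDerivAt_laplaceInv hθ hθ' hδ ht).differentiableAt.hasDerivAt
  have h2 := ((ContinuousLinearMap.apply ℂ (L2 Ω) (v : L2 Ω)).restrictScalars
    ℝ).hasFDerivAt.comp_hasDerivAt t h1
  refine h2.congr_deriv ?_
  change iteratedDeriv (0 + 1) (solutionOp Ω μ θ δ) t (v : L2 Ω) = _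
  have h3 := hR.clm (ContinuousLinearMap.apply ℂ (L2 Ω) (dirichletLaplacian Ω v))
  rw [iteratedDeriv_succ_solutionOp_apply hμc hμ0 hμ1 hθ hθ' hδ ht]
  simp only [pow_zero, one_smul, map_neg]
  have h4 := h3.clm_laplaceInv (-ContinuousLinearMap.id ℂ (L2 Ω)) hθ hθ' one_pos ht
  simp only [neg_apply, ContinuousLinearMap.id_apply, ContinuousLinearMap.apply_apply] at h4
  rw [← h4]
  exact congrArg _ (h3.laplaceInv_congr_contour hθ hθ' hθ hθ' hδ one_pos ht)

theorem isStrongSolution_solutionOp (hμc : ContinuousOn μ (Icc 0 1))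
    (hμ0 : ∀ α ∈ Icc (0 : ℝ) 1, 0 ≤ μ α) (hμ1 : 0 < μ 1) (hθ : π / 2 < θ) (hθ' : θ < π)
    (hδ : 0 < δ) (v : (dirichletLaplacian Ω).domain) :
    IsStrongSolution μ (v : L2 Ω) (fun t => solutionOp Ω μ θ δ t (v : L2 Ω)) := by
  have hθ0 : 0 ≤ θ := by linarith [Real.pi_pos]
  obtain ⟨c, hc, hbound⟩ := exists_norm_laplaceInv_resolventKernel_le Ω hμc hμ0 hμ1
  set f := dirichletLaplacian Ω v with hf
  set F : ℂ → L2 Ω := fun z => resolventKernel Ω μ z (-f) with hFdef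
  have hF : IsSectorial F := (isSectorial_resolventKernel (Ω := Ω) hμc hμ0 hμ1).clm
    (ContinuousLinearMap.apply ℂ (L2 Ω) (-f))
  have hderiv : ∀ s, 0 < s → HasDerivAt (fun t => solutionOp Ω μ θ δ t (v : L2 Ω))
      (laplaceInv θ 1 F s) s := fun s hs =>
    hasDerivAt_solutionOp_apply hμc hμ0 hμ1 hθ hθ' hδ hs v
  obtain ⟨C, hC⟩ := exists_norm_resolventKernel_apply_le hμc hμ0 hμ1 hθ0 hθ' (-f)
  have hbd : ∀ T, 0 < T → ∃ D, ∀ s, 0 < s → s ≤ T →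
      ‖laplaceInv θ 1 F s‖ ≤ D * s ^ (-(1 / 2) : ℝ) := by
    intro T hT
    have h0 := laplaceConst_pos 0
    refine ⟨c * laplaceConst 0 * (2 * (1 + 2 * T) ^ (1 / 2 : ℝ)) * ‖-f‖, fun s hs hsT => ?_⟩
    have h1 := (hbound θ 1 s 0 hθ hθ' one_pos hs (-f)).1
    simp only [pow_zero, one_smul, Nat.cast_zero, neg_zero, zpow_zero, mul_one] at h1
    refine h1.trans ?_
    calc _ ≤ c * laplaceConst 0 * (2 * (1 + 2 * T) ^ (1 / 2 : ℝ) * s ^ (-(1 / 2) : ℝ)) * ‖-f‖ := by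
          gcongr
          exact log_max_inv_two_le hs hsT
      _ = _ := by ring
  have hcaputo := fun t (ht : 0 < t) α hα =>
    intervalIntegrable_sub_rpow_smul_deriv hF hθ hθ' hbd hderiv ht (α := α) hα
  have hdistr := fun t (ht : 0 < t) =>
    distributedDeriv_eq_laplaceInv hμc hμ0 hF hθ hθ' hC hbd hderiv ht
  have hdiff := fun t (ht : 0 < t) => (hderiv t ht).differentiableAt
  have hlim := tendsto_solutionOp_apply hμc hμ0 hμ1 hθ hθ' hδ (v : L2 Ω)
  refine ⟨hlim, hdiff, hcaputo, fun t ht => (hdistr t ht).1, fun t ht => ?_⟩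
  obtain ⟨h1, h2⟩ := exists_laplacian_iteratedDeriv_solutionOp_eq (Ω := Ω) hμc hμ0 hμ1 hθ hθ' hδ
    ht 0 (v : L2 Ω)
  rw [laplaceInv_laplacianKernelH_apply hμc hμ0 hμ1 hθ hθ' hδ ht] at h2
  simp only [iteratedDeriv_zero] at h1 h2
  -- Multiplying the symbol `R(z)(-A v)` of `u'` by `w(z)` gives `H(z)(-A v)`, so the distributed
  -- derivative of `u` is `S(t)(-A v)`; it cancels `A S(t) v = S(t) A v`.
  have h3 : laplaceInv θ 1 (fun z => kernelW μ z • F z) t = solutionOp Ω μ θ δ t (-f) := by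
    rw [solutionOp_apply hμc hμ0 hμ1 hθ hθ' hδ ht]
    exact ((isSectorial_kernelH (Ω := Ω) hμc hμ0 hμ1).clm (ContinuousLinearMap.apply ℂ (L2 Ω)
      (-f))).laplaceInv_congr_contour hθ hθ' hθ hθ' one_pos hδ ht
  have h4 : distributedDeriv μ (fun t => solutionOp Ω μ θ δ t (v : L2 Ω)) t =
      solutionOp Ω μ θ δ t (-f) :=
    (hdistr t ht).2.trans h3
  refine ⟨h1, ?_⟩
  rw [h4, h2, map_neg, neg_add_cancel]

end SolutionOperator

theorem theorem2p1 (d : ℕ) (hd1 : 1 ≤ d) (hd3 : d ≤ 3)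
    (Ω : TopologicalSpace.Opens (EuclideanSpace ℝ (Fin d))) (hΩ : IsConvexPolytopeDomain Ω)
    (μ : ℝ → ℝ) (hμc : ContinuousOn μ (Set.Icc 0 1)) (hμ0 : ∀ α ∈ Set.Icc (0 : ℝ) 1, 0 ≤ μ α)
    (hμ01 : 0 < μ 0 * μ 1) :
    -- `S(t) v` solves the problem and `S` is smooth in `t > 0`
    (∀ θ δ : ℝ, Real.pi / 2 < θ → θ < Real.pi → 0 < δ →
      ContDiffOn ℝ ∞ (solutionOp Ω μ θ δ) (Set.Ioi 0) ∧
      (∀ v : L2 Ω, Tendsto (fun t => solutionOp Ω μ θ δ t v) (𝓝[>] 0) (𝓝 v)) ∧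
      ∀ v ∈ (dirichletLaplacian Ω).domain,
        IsStrongSolution μ v (fun t => solutionOp Ω μ θ δ t v)) ∧
    -- data in `L²(Ω)`: `ν = 0` and `ν = 1`
    (∀ (m : ℕ) (T : ℝ), 0 < T → ∃ cT : ℝ, 0 < cT ∧
      ∀ θ δ : ℝ, Real.pi / 2 < θ → θ < Real.pi → 0 < δ →
      ∀ t : ℝ, 0 < t → t ≤ T → ∀ v : L2 Ω,
        ‖iteratedDeriv m (solutionOp Ω μ θ δ) t v‖ ≤ cT * t ^ (-(m : ℤ)) * ‖v‖ ∧
        ∃ h : iteratedDeriv m (solutionOp Ω μ θ δ) t v ∈ (dirichletLaplacian Ω).domain,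
          ‖dirichletLaplacian Ω ⟨iteratedDeriv m (solutionOp Ω μ θ δ) t v, h⟩‖ ≤
            cT * t ^ (-(m : ℤ) - 1) * (Real.log (2 * T / t))⁻¹ * ‖v‖) ∧
    -- data in `D(A)`: `ν = 0` (then `m ≥ 1`) and `ν = 1`
    (∀ m : ℕ, ∃ c : ℝ, 0 < c ∧
      ∀ θ δ : ℝ, Real.pi / 2 < θ → θ < Real.pi → 0 < δ →
      ∀ t : ℝ, 0 < t → ∀ v : (dirichletLaplacian Ω).domain,
        (1 ≤ m → ‖iteratedDeriv m (solutionOp Ω μ θ δ) t (v : L2 Ω)‖ ≤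
          c * t ^ (-(m : ℤ) + 1) * Real.log (max t⁻¹ 2) * ‖dirichletLaplacian Ω v‖) ∧
        ∃ h : iteratedDeriv m (solutionOp Ω μ θ δ) t (v : L2 Ω) ∈ (dirichletLaplacian Ω).domain,
          ‖dirichletLaplacian Ω ⟨iteratedDeriv m (solutionOp Ω μ θ δ) t (v : L2 Ω), h⟩‖ ≤
            c * t ^ (-(m : ℤ)) * ‖dirichletLaplacian Ω v‖) := by
  have hμ1 : 0 < μ 1 := (hμ0 1 (by simp)).lt_of_ne fun h => by simp [← h] at hμ01
  refine ⟨fun θ δ hθ hθ' hδ => ⟨?_, fun v => ?_, fun v hv => ?_⟩, fun m T hT => ?_, fun m => ?_⟩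
  · exact (isSectorial_kernelH hμc hμ0 hμ1).contDiffOn_laplaceInv hθ hθ' hδ
  · exact tendsto_solutionOp_apply hμc hμ0 hμ1 hθ hθ' hδ v
  · exact isStrongSolution_solutionOp hμc hμ0 hμ1 hθ hθ' hδ ⟨v, hv⟩
  · obtain ⟨c, hc, h⟩ := exists_norm_laplaceInv_laplacianKernelH_le (Ω := Ω) hμc hμ0 hμ1 m hT
    have hm := laplaceConst_pos m
    refine ⟨2 * laplaceConst m + c, by positivity, fun θ δ hθ hθ' hδ t ht htT v => ⟨?_, ?_⟩⟩
    · refine (norm_iteratedDeriv_solutionOp_le hμc hμ0 hμ1 hθ hθ' hδ ht m v).trans ?_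
      gcongr
      linarith
    · obtain ⟨h1, h2⟩ :=
        exists_laplacian_iteratedDeriv_solutionOp_eq hμc hμ0 hμ1 hθ hθ' hδ ht m v
      refine ⟨h1, ?_⟩
      rw [h2]
      have hl : 0 < Real.log (2 * T / t) := Real.log_pos (by rw [lt_div_iff₀ ht]; linarith)
      refine (h θ δ t hθ hθ' hδ ht htT v).trans ?_
      gcongr
      linarith
  · obtain ⟨c, hc, h⟩ := exists_norm_laplaceInv_resolventKernel_le Ω hμc hμ0 hμ1
    have hm := laplaceConst_pos m
    have hm' := laplaceConst_pos (m - 1)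
    -- The second summand serves the case `ν = 0`, where `m ≥ 1`. For `m = 0` the truncated
    -- subtraction is harmless, since only the first summand is needed.
    refine ⟨2 * laplaceConst m + c * laplaceConst (m - 1), by positivity,
      fun θ δ hθ hθ' hδ t ht v => ⟨fun hm1 => ?_, ?_⟩⟩
    · obtain ⟨n, rfl⟩ := Nat.exists_eq_add_of_le' hm1
      rw [iteratedDeriv_succ_solutionOp_apply hμc hμ0 hμ1 hθ hθ' hδ ht, norm_neg]
      refine (h θ δ t n hθ hθ' hδ ht _).1.trans ?_
      have hl := log_max_two_pos t⁻¹
      rw [Nat.add_sub_cancel, show -((n + 1 : ℕ) : ℤ) + 1 = -(n : ℤ) by push_cast; ring]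
      gcongr
      linarith
    · obtain ⟨h1, h2⟩ :=
        exists_laplacian_iteratedDeriv_solutionOp_eq hμc hμ0 hμ1 hθ hθ' hδ ht m (v : L2 Ω)
      refine ⟨h1, ?_⟩
      -- By commutation this is the `L²` estimate with `ν = 0` for the datum `A v`, which involves
      -- no logarithm and no restriction on `t`.
      rw [h2, laplaceInv_laplacianKernelH_apply hμc hμ0 hμ1 hθ hθ' hδ ht]
      refine (norm_iteratedDeriv_solutionOp_le hμc hμ0 hμ1 hθ hθ' hδ ht m _).trans ?_
      gcongr
      have := mul_pos hc hm'
      linarith
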